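/- Let $\gamma>0$ and let $\Omega\subset\mathbb R$ be open. For $\lambda>0$ and a measurable function $w\colon\Omega\to\mathbb R$ put $$F_{\gamma,\lambda}(w,\Omega):=\lambda\iint_{E_{\gamma,\lambda}(w,\Omega)}|x-y|^{\gamma-1}\,dy\,dx,\qquad E_{\gamma,\lambda}(w,\Omega):=\{(x,y)\in\Omega\times\Omega:\ |w(x)-w(y)|>\lambda|x-y|^{1+\gamma}\}.$$ Let $\dot{\mathrm{BV}}(\Omega)$ be the set of all $w\in L^1_{\mathrm{loc}}(\Omega)$ whose distributional derivative $Dw$ in $\Omega$ is a signed Radon measure of finite total variation. For such $w$ let $Dw=D^aw+D^sw$ be the Lebesgue decomposition of $Dw$ into its absolutely continuous and singular parts with respect to Lebesgue measure, and let $\nabla w$ be the density of $D^aw$. Put $$A(w,\Omega):=\int_\Omega\Big(\sqrt{1+|\nabla w|^2}-1\Big)\,dx+|D^sw|(\Omega)\quad\text{if } w\in\dot{\mathrm{BV}}(\Omega),\qquad A(w,\Omega):=\infty\quad\text{otherwise.}$$ A family $(u_\lambda)_{\lambda>0}$ in $L^1_{\mathrm{loc}}(\Omega)$ is said to converge area-strictly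 in $\Omega$ to $u$ as $\lambda\to\infty$ if $u_\lambda\to u$ in $L^1_{\mathrm{loc}}(\Omega)$ and $A(u_\lambda,\Omega)\to A(u,\Omega)$. (If $\Omega$ has finite Lebesgue measure, the last condition says that $\int_\Omega\sqrt{1+|\nabla u_\lambda|^2}\,dx+|D^su_\lambda|(\Omega)\to\int_\Omega\sqrt{1+|\nabla u|^2}\,dx+|D^su|(\Omega)$.) **Proposition.** Let $u\in\dot{\mathrm{BV}}(\Omega)$ and let $u_\lambda\to u$ area-strictly in $\Omega$ as $\lambda\to\infty$. Then $$\liminf_{\lambda\to\infty}F_{\gamma,\lambda}(u_\lambda,\Omega)\ \ge\ \frac{2}{\gamma}\,|D^au|(\Omega)+\frac{2}{\gamma+1}\,|D^su|(\Omega).$$ -/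

import Mathlib

open MeasureTheory Set Filter Topology
open scoped ENNReal

noncomputable section

namespace NonlocalBV

/-- The measure `ν_γ(A) = ∬_A |x - y|^(γ - 1) dy dx` of a set `A ⊆ ℝ × ℝ` (dimension one). -/
def nu (γ : ℝ) (A : Set (ℝ × ℝ)) : ℝ≥0∞ :=
  ∫⁻ p in A, ENNReal.ofReal (|p.1 - p.2| ^ (γ - 1))

/-- The set `E_{γ,lam}(u, Ω)` of pairs `(x, y) ∈ Ω × Ω` with
`|u(x) - u(y)| > lam |x - y|^(1 + γ)`. -/
def superlevelPairs (γ lam : ℝ) (u : ℝ → ℝ) (Ω : Set ℝ) : Set (ℝ × ℝ) :=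
  {p | p.1 ∈ Ω ∧ p.2 ∈ Ω ∧ lam * |p.1 - p.2| ^ (1 + γ) < |u p.1 - u p.2|}

/-- The nonlocal functional `F_{γ,lam}(u, Ω) = lam · ν_γ(E_{γ,lam}(u, Ω))`. -/
def nonlocalF (γ lam : ℝ) (u : ℝ → ℝ) (Ω : Set ℝ) : ℝ≥0∞ :=
  ENNReal.ofReal lam * nu γ (superlevelPairs γ lam u Ω)

/-- The integral of a function against a finite signed measure. -/
def signedIntegral (μ : SignedMeasure ℝ) (φ : ℝ → ℝ) : ℝ :=
  ∫ x, φ x ∂μ.toJordanDecomposition.posPart - ∫ x, φ x ∂μ.toJordanDecomposition.negPart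

/-- The finite signed measure `μ` on `Ω` (viewed as a measure on `ℝ` that lives on `Ω`) is the
distributional derivative of `u` in `Ω`: `∫_Ω u φ' dx = - ∫_Ω φ dμ` for all `φ ∈ C_c^1(Ω)`. -/
structure IsDistribDeriv (u : ℝ → ℝ) (Ω : Set ℝ) (μ : SignedMeasure ℝ) : Prop where
  restrict_eq : μ.restrict Ω = μ
  integral_eq : ∀ φ : ℝ → ℝ, ContDiff ℝ 1 φ → HasCompactSupport φ → tsupport φ ⊆ Ω →
    ∫ x in Ω, u x * deriv φ x = - signedIntegral μ φ

/-- The homogeneous space of functions of bounded variation on `Ω`: the functions in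
`L^1_loc(Ω)` whose distributional derivative in `Ω` is a (signed) measure of finite total
variation. Values of `u` outside `Ω` play no role. -/
structure MemBVdot (u : ℝ → ℝ) (Ω : Set ℝ) : Prop where
  locallyIntegrableOn : LocallyIntegrableOn u Ω
  exists_deriv : ∃ μ : SignedMeasure ℝ, IsDistribDeriv u Ω μ

open Classical in
/-- The derivative measure `Du` of `u` in `Ω`; it is only used for `u` with `MemBVdot u Ω`. -/
def D (u : ℝ → ℝ) (Ω : Set ℝ) : SignedMeasure ℝ :=
  if h : ∃ μ : SignedMeasure ℝ, IsDistribDeriv u Ω μ then h.choose else 0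

/-- The density `∇u` of the absolutely continuous part of `Du`. -/
def grad (u : ℝ → ℝ) (Ω : Set ℝ) : ℝ → ℝ :=
  (D u Ω).rnDeriv volume

/-- The absolutely continuous part `D^a u` of `Du` with respect to Lebesgue measure. -/
def Da (u : ℝ → ℝ) (Ω : Set ℝ) : SignedMeasure ℝ :=
  volume.withDensityᵥ (grad u Ω)

/-- The singular part `D^s u` of `Du` with respect to Lebesgue measure. -/
def Ds (u : ℝ → ℝ) (Ω : Set ℝ) : SignedMeasure ℝ :=
  (D u Ω).singularPart volume

/-- The decomposition `Du = D^a u + D^s u`. -/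
theorem Ds_add_Da (u : ℝ → ℝ) (Ω : Set ℝ) : Ds u Ω + Da u Ω = D u Ω :=
  SignedMeasure.singularPart_add_withDensity_rnDeriv_eq volume (D u Ω)

open Classical in
/-- The area functional `∫_Ω E(Du) = ∫_Ω √(1 + |∇u|²) dx + |D^s u|(Ω)`, with value `∞` when the
derivative of `u` in `Ω` is not a finite measure. -/
def area (u : ℝ → ℝ) (Ω : Set ℝ) : ℝ≥0∞ :=
  if MemBVdot u Ω then
    (∫⁻ x in Ω, ENNReal.ofReal (√(1 + grad u Ω x ^ 2))) + (Ds u Ω).totalVariation Ω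
  else ∞

open Classical in
/-- The excess area `∫_Ω (√(1 + |∇u|²) - 1) dx + |D^s u|(Ω)`, with value `∞` when the
derivative of `u` in `Ω` is not a finite measure. It is the area minus the Lebesgue measure of
`Ω`, and unlike the area it is finite also when `Ω` has infinite Lebesgue measure. -/
def excessArea (u : ℝ → ℝ) (Ω : Set ℝ) : ℝ≥0∞ :=
  if MemBVdot u Ω then
    (∫⁻ x in Ω, ENNReal.ofReal (√(1 + grad u Ω x ^ 2) - 1)) + (Ds u Ω).totalVariation Ω
  else ∞

/-- Convergence in `L^1_loc(Ω)` of a family `(v lam)`, `lam > 0`, as `lam → ∞`. -/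
structure TendstoL1loc (v : ℝ → ℝ → ℝ) (u : ℝ → ℝ) (Ω : Set ℝ) : Prop where
  locallyIntegrableOn : ∀ lam : ℝ, 0 < lam → LocallyIntegrableOn (v lam) Ω
  locallyIntegrableOn_limit : LocallyIntegrableOn u Ω
  tendsto : ∀ K : Set ℝ, IsCompact K → K ⊆ Ω →
    Tendsto (fun lam => ∫⁻ x in K, ‖v lam x - u x‖ₑ) atTop (𝓝 0)

/-- Area-strict convergence in `Ω` of a family `(v lam)`, `lam > 0`, as `lam → ∞`: convergence in
`L^1_loc(Ω)` together with convergence of the areas. The areas are compared after subtraction of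
the constant integrand `1`, so that the condition keeps its meaning on sets `Ω` of infinite
Lebesgue measure, where `∫_Ω √(1 + |∇u|²) dx` is always infinite. For `Ω` of finite Lebesgue
measure this is the convergence of the areas themselves, see `tendstoAreaStrict_iff`. -/
structure TendstoAreaStrict (v : ℝ → ℝ → ℝ) (u : ℝ → ℝ) (Ω : Set ℝ) : Prop where
  tendstoL1loc : TendstoL1loc v u Ω
  tendsto_excessArea : Tendsto (fun lam => excessArea (v lam) Ω) atTop (𝓝 (excessArea u Ω))

theorem area_eq (u : ℝ → ℝ) (Ω : Set ℝ) : area u Ω = excessArea u Ω + volume Ω := by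
  unfold area excessArea
  split_ifs
  · have key : ∀ x, ENNReal.ofReal (√(1 + grad u Ω x ^ 2))
        = ENNReal.ofReal (√(1 + grad u Ω x ^ 2) - 1) + 1 := by
      intro x
      have h : (1 : ℝ) ≤ √(1 + grad u Ω x ^ 2) := by
        rw [Real.one_le_sqrt]
        nlinarith [sq_nonneg (grad u Ω x)]
      rw [← ENNReal.ofReal_one, ← ENNReal.ofReal_add (by linarith) zero_le_one, sub_add_cancel]
    simp_rw [key]
    rw [lintegral_add_right _ measurable_const]
    simp only [lintegral_const, Measure.restrict_apply_univ, one_mul]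
    ring
  · simp

/-- On sets of finite Lebesgue measure, area-strict convergence is convergence in `L^1_loc`
together with convergence of the areas. -/
theorem tendstoAreaStrict_iff (v : ℝ → ℝ → ℝ) (u : ℝ → ℝ) (Ω : Set ℝ) (hΩ : volume Ω ≠ ∞) :
    TendstoAreaStrict v u Ω ↔
      TendstoL1loc v u Ω ∧ Tendsto (fun lam => area (v lam) Ω) atTop (𝓝 (area u Ω)) := by
  constructor
  · rintro ⟨h1, h2⟩
    refine ⟨h1, ?_⟩
    simp_rw [area_eq]
    exact h2.add tendsto_const_nhds
  · rintro ⟨h1, h2⟩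
    refine ⟨h1, ?_⟩
    have h := ENNReal.Tendsto.sub h2 (tendsto_const_nhds (x := volume Ω)) (Or.inr hΩ)
    simp_rw [area_eq, ENNReal.add_sub_cancel_right hΩ] at h
    exact h

end NonlocalBV

end

/-!
The excess area `A(w)` has a dual representation: it is the supremum over `φ ∈ C_c^1(Ω)` with
`|φ| ≤ 1` of `-∫_Ω w φ' dx - ∫_Ω (1 - √(1 - φ²)) dx`. What a single `φ` misses is the defect
`dualGap`, which integrates the gap `areaGap (∇w) φ` in Young's inequality and the functions `1 ∓ φ`
against the positive and negative parts of `D^s w` (`HasWeakDeriv.dualGap_eq`). There are `φ` for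
which the defect of the limit `u` is as small as desired (`exists_dualGap_le`). For fixed `φ` only
`A(w)` and an integral of `w` enter, so under area-strict convergence the defect of `u_λ` tends to
that of `u` (`IsAreaStrict.tendsto_dualGap`). One `φ` therefore controls the derivatives of all
`u_λ` with large `λ`, on three disjoint sets.

* On `{|φ| < a}` with `a < 1` the derivative of `u_λ` is close in total variation to `ψ dx` with the
  continuous slope `ψ = φ / √(1 - φ²)`, which does not depend on `λ`. A primitive of `ψ` is a fixed
  `C^1` function, for which Fatou's lemma gives the constant `1 / γ`
  (`le_liminf_nu_of_hasDerivAt`, `IsAreaStrict.eventually_slope_le`).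
* On `{φ > a}` the negative part of the derivative of `u_λ` is small, so `u_λ` is nearly increasing
  there. For an increasing function, which may depend on `λ`, the functional is at least
  `1 / (γ + 1)` times the increase, as soon as `λ` exceeds a bound that depends only on the total
  increase and on the distance to the boundary (`le_nu_of_measure`). As the defect of `u` is small,
  the set carries almost all of the positive part of `D^s u`, and a smooth cutoff of `φ` shows that
  `D u_λ` has there at least about the same mass (`IsAreaStrict.eventually_measure_le`).
* The set `{φ < -a}` is treated in the same way after a change of sign.

All these constants refer to pairs `x < y`; symmetry doubles them (`two_mul_nu_le`). The small
errors in total variation are absorbed by a weak-type estimate from Vitali's covering lemma: a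
finite measure `τ` contributes at most a constant times its mass, whatever `λ` is (`nu_maximal_le`,
`nu_perturbation_le`). It applies because the increments of `u_λ` over almost all intervals are the
masses of its derivative (`HasWeakDeriv.ae_sub_eq`). As only pairs with `[x, y]` inside one of the
three sets are counted, the contributions add up. For `a` close to `1` the slope `ψ` recovers the
slopes of `u` up to a given bound (`lintegral_abs_le_truncSlope`, `IsAreaStrict.le_mul_liminf`), and
bounded slopes on bounded intervals exhaust `D^a u`.
-/

noncomputable section

namespace NonlocalBV

/-! ### Pairs of points and a weak-type estimate -/

/-- The pairs `x < y` for which the closed interval `[x, y]` is contained in `U`. -/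
def segs (U : Set ℝ) : Set (ℝ × ℝ) := {p | p.1 < p.2 ∧ Icc p.1 p.2 ⊆ U}

theorem segs_mono {U V : Set ℝ} (h : U ⊆ V) : segs U ⊆ segs V :=
  fun _ hp => ⟨hp.1, hp.2.trans h⟩

theorem isOpen_segs {U : Set ℝ} (hU : IsOpen U) : IsOpen (segs U) := by
  rw [Metric.isOpen_iff]
  rintro ⟨a, b⟩ ⟨hab, hU'⟩
  simp only at hab hU'
  obtain ⟨δ, hδ, hsub⟩ := isCompact_Icc.exists_thickening_subset_open hU hU'
  refine ⟨min δ ((b - a) / 2), lt_min hδ (by linarith), ?_⟩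
  rintro ⟨x, y⟩ hp
  rw [Metric.mem_ball, Prod.dist_eq, max_lt_iff, lt_min_iff, lt_min_iff, Real.dist_eq,
    Real.dist_eq, abs_lt, abs_lt, abs_lt, abs_lt] at hp
  simp only at hp
  obtain ⟨⟨⟨h1, h2⟩, h3, h4⟩, ⟨h5, h6⟩, h7, h8⟩ := hp
  refine ⟨by simp only; linarith, fun z hz => hsub ?_⟩
  simp only [mem_Icc] at hz
  rw [Metric.mem_thickening_iff]
  refine ⟨max a (min z b), ⟨le_max_left _ _, max_le hab.le (min_le_right _ _)⟩, ?_⟩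
  rw [Real.dist_eq, abs_lt]
  rcases le_total z a with h | h
  · rw [max_eq_left ((min_le_left _ _).trans h)]
    constructor <;> linarith
  · rcases le_total z b with h' | h'
    · rw [min_eq_left h', max_eq_right h]
      constructor <;> linarith
    · rw [min_eq_right h', max_eq_right hab.le]
      constructor <;> linarith

theorem nu_mono (γ : ℝ) {A B : Set (ℝ × ℝ)} (h : A ⊆ B) : nu γ A ≤ nu γ B :=
  lintegral_mono_set h

theorem nu_mono_ae (γ : ℝ) {A B : Set (ℝ × ℝ)} (h : ∀ᵐ p : ℝ × ℝ, p ∈ A → p ∈ B) :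
    nu γ A ≤ nu γ B :=
  lintegral_mono_set' h

theorem nu_union_le (γ : ℝ) (A B : Set (ℝ × ℝ)) : nu γ (A ∪ B) ≤ nu γ A + nu γ B :=
  lintegral_union_le _ _ _

/-- Only one of the disjoint sets has to be measurable, and `A` need not be: the pairs with large
difference quotient of a function need not form a measurable set. -/
theorem nu_inter_add_le (γ : ℝ) (A : Set (ℝ × ℝ)) {B C : Set (ℝ × ℝ)} (hB : MeasurableSet B)
    (hBC : Disjoint B C) : nu γ (A ∩ B) + nu γ (A ∩ C) ≤ nu γ A := by
  unfold nu
  rw [← lintegral_inter_add_sdiff _ A hB]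
  have : A ∩ C ⊆ A \ B := fun p hp => ⟨hp.1, hBC.notMem_of_mem_right hp.2⟩
  exact add_le_add_right (lintegral_mono_set this) _

/-- By symmetry in the two variables, the pairs `x < y` account for half of the functional. -/
theorem two_mul_nu_le (γ lam : ℝ) (w : ℝ → ℝ) (Ω : Set ℝ) :
    2 * nu γ {p ∈ segs Ω | lam * |p.1 - p.2| ^ (1 + γ) < |w p.1 - w p.2|}
      ≤ nu γ (superlevelPairs γ lam w Ω) := by
  set A : Set (ℝ × ℝ) := {p ∈ segs Ω | lam * |p.1 - p.2| ^ (1 + γ) < |w p.1 - w p.2|}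
  have hswap : nu γ (Prod.swap ⁻¹' A) = nu γ A := by
    unfold nu
    have := (Measure.measurePreserving_swap (μ := (volume : Measure ℝ))
      (ν := (volume : Measure ℝ))).setLIntegral_comp_preimage_emb
      MeasurableEquiv.prodComm.measurableEmbedding
      (fun p => ENNReal.ofReal (|p.1 - p.2| ^ (γ - 1))) A
    rw [← Measure.volume_eq_prod] at this
    rw [← this]
    simp only [Prod.fst_swap, Prod.snd_swap, abs_sub_comm]
  have hA : A ⊆ superlevelPairs γ lam w Ω ∩ {p | p.1 < p.2} := fun p hp =>
    ⟨⟨hp.1.2 ⟨le_rfl, hp.1.1.le⟩, hp.1.2 ⟨hp.1.1.le, le_rfl⟩, hp.2⟩, hp.1.1⟩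
  have hA' : Prod.swap ⁻¹' A ⊆ superlevelPairs γ lam w Ω ∩ {p | p.2 < p.1} := by
    intro p hp
    obtain ⟨⟨h1, h2, h3⟩, h4⟩ := hA hp
    refine ⟨⟨h2, h1, ?_⟩, h4⟩
    simpa only [Prod.fst_swap, Prod.snd_swap, abs_sub_comm] using h3
  calc 2 * nu γ A = nu γ A + nu γ (Prod.swap ⁻¹' A) := by rw [hswap, two_mul]
    _ ≤ nu γ (superlevelPairs γ lam w Ω ∩ {p | p.1 < p.2})
        + nu γ (superlevelPairs γ lam w Ω ∩ {p | p.2 < p.1}) :=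
      add_le_add (nu_mono γ hA) (nu_mono γ hA')
    _ ≤ _ := nu_inter_add_le γ _ (measurableSet_lt measurable_fst measurable_snd)
      (disjoint_left.2 fun p (h : p.1 < p.2) (h' : p.2 < p.1) => lt_asymm h h')

theorem measurable_gap (γ : ℝ) :
    Measurable fun p : ℝ × ℝ => ENNReal.ofReal (|p.1 - p.2| ^ (γ - 1)) := by
  fun_prop

theorem lintegral_Ioo_rpow {s : ℝ} (hs : -1 < s) {ρ : ℝ} (hρ : 0 ≤ ρ) :
    ∫⁻ r in Ioo 0 ρ, ENNReal.ofReal (r ^ s) = ENNReal.ofReal (ρ ^ (s + 1) / (s + 1)) := by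
  have hint : IntervalIntegrable (fun r : ℝ => r ^ s) volume 0 ρ :=
    intervalIntegral.intervalIntegrable_rpow' hs
  rw [intervalIntegrable_iff_integrableOn_Ioo_of_le hρ] at hint
  rw [← ofReal_integral_eq_lintegral_ofReal hint, ← integral_Ioc_eq_integral_Ioo,
    ← intervalIntegral.integral_of_le hρ, integral_rpow (Or.inl hs),
    Real.zero_rpow (by linarith), sub_zero]
  filter_upwards [ae_restrict_mem measurableSet_Ioo] with r hr
  exact Real.rpow_nonneg hr.1.le _

theorem lintegral_gap_right {γ : ℝ} (hγ : 0 < γ) (x : ℝ) {ρ : ℝ} (hρ : 0 ≤ ρ) :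
    ∫⁻ y in Ioo x (x + ρ), ENNReal.ofReal (|x - y| ^ (γ - 1)) = ENNReal.ofReal (ρ ^ γ / γ) := by
  have h := lintegral_Ioo_rpow (s := γ - 1) (by linarith) hρ
  rw [sub_add_cancel] at h
  rw [← h, ← (measurePreserving_add_left volume x).setLIntegral_comp_preimage_emb
    (measurableEmbedding_addLeft x)]
  simp only [preimage_const_add_Ioo, sub_self, add_sub_cancel_left]
  refine setLIntegral_congr_fun measurableSet_Ioo fun r hr => ?_
  simp only [sub_add_cancel_left, abs_neg, abs_of_pos hr.1]

theorem lintegral_gap_left {γ : ℝ} (hγ : 0 < γ) (x : ℝ) {ρ : ℝ} (hρ : 0 ≤ ρ) :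
    ∫⁻ y in Ioo (x - ρ) x, ENNReal.ofReal (|x - y| ^ (γ - 1)) = ENNReal.ofReal (ρ ^ γ / γ) := by
  have h := lintegral_Ioo_rpow (s := γ - 1) (by linarith) hρ
  rw [sub_add_cancel] at h
  rw [← h, ← (Measure.measurePreserving_sub_left volume x).setLIntegral_comp_preimage_emb
    (MeasurableEquiv.subLeft x).measurableEmbedding]
  simp only [preimage_const_sub_Ioo, sub_self, sub_sub_cancel]
  refine setLIntegral_congr_fun measurableSet_Ioo fun r hr => ?_
  simp only [abs_of_pos hr.1]

theorem nu_square_le {γ : ℝ} (hγ : 0 < γ) (a : ℝ) {ℓ : ℝ} (hℓ : 0 ≤ ℓ) :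
    nu γ (Icc a (a + ℓ) ×ˢ Icc a (a + ℓ)) ≤ ENNReal.ofReal (2 / γ * ℓ ^ (γ + 1)) := by
  have hin : ∀ x ∈ Icc a (a + ℓ), ∫⁻ y in Icc a (a + ℓ), ENNReal.ofReal (|x - y| ^ (γ - 1))
      ≤ ENNReal.ofReal (2 / γ * ℓ ^ γ) := by
    intro x hx
    have hae : (Icc a (a + ℓ) : Set ℝ) ≤ᵐ[volume] (Ioo (x - ℓ) x ∪ Ioo x (x + ℓ) : Set ℝ) := by
      have h0 : ∀ᵐ y : ℝ, y ≠ x ∧ y ≠ x - ℓ ∧ y ≠ x + ℓ := by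
        simp only [eventually_and]
        exact ⟨Measure.ae_ne _ _, Measure.ae_ne _ _, Measure.ae_ne _ _⟩
      filter_upwards [h0] with y hy hy'
      obtain ⟨h1, h2, h3⟩ := hy
      rcases lt_or_gt_of_ne h1 with h | h
      · exact Or.inl ⟨lt_of_le_of_ne (by linarith [hx.2, hy'.1]) h2.symm, h⟩
      · exact Or.inr ⟨h, lt_of_le_of_ne (by linarith [hx.1, hy'.2]) h3⟩
    calc _ ≤ ∫⁻ y in Ioo (x - ℓ) x ∪ Ioo x (x + ℓ), ENNReal.ofReal (|x - y| ^ (γ - 1)) :=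
          lintegral_mono_set' hae
      _ ≤ _ := lintegral_union_le _ _ _
      _ = ENNReal.ofReal (2 / γ * ℓ ^ γ) := by
        rw [lintegral_gap_left hγ x hℓ, lintegral_gap_right hγ x hℓ, ← ENNReal.ofReal_add]
        · congr 1; ring
        all_goals positivity
  unfold nu
  rw [Measure.volume_eq_prod, ← Measure.prod_restrict, lintegral_prod _ (by fun_prop)]
  calc _ ≤ ∫⁻ x in Icc a (a + ℓ), ENNReal.ofReal (2 / γ * ℓ ^ γ) :=
        setLIntegral_mono measurable_const hin
    _ = ENNReal.ofReal (2 / γ * ℓ ^ (γ + 1)) := by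
      rw [setLIntegral_const, Real.volume_Icc, add_sub_cancel_left, ← ENNReal.ofReal_mul
        (by positivity), mul_assoc]
      congr 2
      rcases hℓ.eq_or_lt with rfl | h
      · rw [mul_zero, Real.zero_rpow (by linarith)]
      · rw [Real.rpow_add h, Real.rpow_one]

/-- The constant of the weak-type estimate `nu_maximal_le`. -/
def maximalConst (γ : ℝ) : ℝ := 2 / γ * 5 ^ (γ + 1)

theorem maximalConst_pos {γ : ℝ} (hγ : 0 < γ) : 0 < maximalConst γ := by
  unfold maximalConst; positivity

/-- A weak-type estimate: the intervals on which a finite measure `σ` has mass at least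
`lam * length ^ (1 + γ)` are covered by fivefold enlargements of disjoint ones. -/
theorem nu_maximal_le {γ : ℝ} (hγ : 0 < γ) (σ : Measure ℝ) [IsFiniteMeasure σ] {lam : ℝ}
    (hlam : 0 < lam) :
    nu γ {p | p.1 < p.2 ∧ ENNReal.ofReal (lam * |p.1 - p.2| ^ (1 + γ)) ≤ σ (Ioc p.1 p.2)}
      ≤ ENNReal.ofReal (maximalConst γ / lam) * σ univ := by
  set t : Set (ℝ × ℝ) :=
    {p | p.1 < p.2 ∧ ENNReal.ofReal (lam * |p.1 - p.2| ^ (1 + γ)) ≤ σ (Ioc p.1 p.2)} with ht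
  have hball : ∀ p : ℝ × ℝ, Metric.closedBall ((p.1 + p.2) / 2) ((p.2 - p.1) / 2)
      = Icc p.1 p.2 := by
    intro p; rw [Real.closedBall_eq_Icc]; congr 1 <;> ring
  set V := (σ univ).toReal
  have hR : ∀ p ∈ t, (p.2 - p.1) / 2 ≤ (V / lam) ^ (1 / (1 + γ)) := by
    rintro p ⟨h1, h2⟩
    have h3 : lam * (p.2 - p.1) ^ (1 + γ) ≤ V := by
      have := h2.trans (measure_mono (subset_univ _))
      rw [ENNReal.ofReal_le_iff_le_toReal (measure_ne_top _ _), abs_sub_comm,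
        abs_of_pos (sub_pos.2 h1)] at this
      exact this
    have h4 : p.2 - p.1 ≤ (V / lam) ^ (1 / (1 + γ)) := by
      rw [← Real.rpow_le_rpow_iff (sub_pos.2 h1).le (by positivity)
        (show (0 : ℝ) < 1 + γ by linarith), ← Real.rpow_mul (by positivity),
        one_div_mul_cancel (by linarith), Real.rpow_one, le_div_iff₀ hlam]
      linarith
    linarith
  obtain ⟨u, hut, hdisj, hcov⟩ := Vitali.exists_disjoint_subfamily_covering_enlargement_closedBall
    t (fun p : ℝ × ℝ => (p.1 + p.2) / 2) (fun p => (p.2 - p.1) / 2) _ hR 5 (by norm_num)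
  simp only [hball] at hdisj hcov
  have hcount : u.Countable := by
    refine hdisj.countable_of_nonempty_interior fun p hp => ?_
    rw [interior_Icc]
    exact nonempty_Ioo.2 (hut hp).1
  have hcover : t ⊆ ⋃ p ∈ u, Icc (3 * p.1 - 2 * p.2) (3 * p.1 - 2 * p.2 + 5 * (p.2 - p.1)) ×ˢ
      Icc (3 * p.1 - 2 * p.2) (3 * p.1 - 2 * p.2 + 5 * (p.2 - p.1)) := by
    intro q hq
    obtain ⟨p, hp, hsub⟩ := hcov q hq
    rw [Real.closedBall_eq_Icc] at hsub
    refine mem_biUnion hp ⟨?_, ?_⟩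
    · have := hsub ⟨le_rfl, hq.1.le⟩
      constructor <;> linarith [this.1, this.2]
    · have := hsub ⟨hq.1.le, le_rfl⟩
      constructor <;> linarith [this.1, this.2]
  have hterm : ∀ p ∈ u, nu γ (Icc (3 * p.1 - 2 * p.2) (3 * p.1 - 2 * p.2 + 5 * (p.2 - p.1)) ×ˢ
      Icc (3 * p.1 - 2 * p.2) (3 * p.1 - 2 * p.2 + 5 * (p.2 - p.1)))
      ≤ ENNReal.ofReal (maximalConst γ / lam) * σ (Icc p.1 p.2) := by
    intro p hp
    obtain ⟨h1, h2⟩ := hut hp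
    have h0 : 0 < p.2 - p.1 := sub_pos.2 h1
    calc _ ≤ _ := nu_square_le hγ _ (by positivity)
      _ = ENNReal.ofReal (maximalConst γ / lam)
          * ENNReal.ofReal (lam * |p.1 - p.2| ^ (1 + γ)) := by
        have := maximalConst_pos hγ
        rw [← ENNReal.ofReal_mul (by positivity)]
        congr 1
        rw [abs_sub_comm, abs_of_pos h0, Real.mul_rpow (by norm_num) h0.le, add_comm 1 γ,
          maximalConst]
        field_simp
      _ ≤ _ := by gcongr; exact h2.trans (measure_mono Ioc_subset_Icc_self)
  have := hcount.to_subtype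
  calc nu γ t ≤ nu γ (⋃ p ∈ u, _) := nu_mono γ hcover
    _ ≤ ∑' p : u, ENNReal.ofReal (maximalConst γ / lam) * σ (Icc p.1.1 p.1.2) := by
      rw [biUnion_eq_iUnion]
      exact (lintegral_iUnion_le _ _).trans (ENNReal.tsum_le_tsum fun p => hterm p p.2)
    _ = ENNReal.ofReal (maximalConst γ / lam) * σ (⋃ p ∈ u, Icc p.1 p.2) := by
      rw [ENNReal.tsum_mul_left, measure_biUnion hcount hdisj fun p _ => measurableSet_Icc]
    _ ≤ _ := by gcongr; exact subset_univ _

/-- A perturbation by a finite measure `τ` changes the measure of the set of pairs with large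
difference quotient only by a multiple of the mass of `τ`. -/
theorem nu_perturbation_le {γ : ℝ} (hγ : 0 < γ) {U : Set ℝ} (τ : Measure ℝ) [IsFiniteMeasure τ]
    {lam κ : ℝ} (hlam : 0 < lam) (hκ : 0 < κ) (f : ℝ × ℝ → ℝ≥0∞) (w : ℝ → ℝ)
    (hf : ∀ᵐ p : ℝ × ℝ, p ∈ segs U → f p ≤ ENNReal.ofReal |w p.1 - w p.2| + τ (Ioc p.1 p.2)) :
    nu γ {p ∈ segs U | ENNReal.ofReal ((1 + κ) * lam * |p.1 - p.2| ^ (1 + γ)) < f p}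
      ≤ nu γ {p ∈ segs U | lam * |p.1 - p.2| ^ (1 + γ) < |w p.1 - w p.2|}
        + ENNReal.ofReal (maximalConst γ / (κ * lam)) * τ univ := by
  refine le_trans ?_ (add_le_add_right (nu_maximal_le hγ τ (mul_pos hκ hlam)) _)
  refine le_trans (nu_mono_ae γ ?_) (nu_union_le γ _ _)
  filter_upwards [hf] with p hp hpf
  by_contra hcon
  have hseg := hpf.1
  simp only [mem_union, mem_ofPred_eq, not_or, not_and, not_lt, not_le] at hcon
  have h1 := hcon.1 hseg
  have h2 := hcon.2 hseg.1
  refine absurd hpf.2 (not_lt.2 ?_)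
  refine (hp hseg).trans ?_
  have : (1 + κ) * lam * |p.1 - p.2| ^ (1 + γ)
      = lam * |p.1 - p.2| ^ (1 + γ) + κ * lam * |p.1 - p.2| ^ (1 + γ) := by ring
  rw [this, ENNReal.ofReal_add (by positivity) (by positivity)]
  gcongr

/-! ### The sharp lower bound for monotone functions -/

theorem measurable_measure_Ioc (σ : Measure ℝ) [SFinite σ] :
    Measurable fun p : ℝ × ℝ => σ (Ioc p.1 p.2) := by
  have : MeasurableSet {x : (ℝ × ℝ) × ℝ | x.1.1 < x.2 ∧ x.2 ≤ x.1.2} :=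
    (measurableSet_lt (f := fun x : (ℝ × ℝ) × ℝ => x.1.1) (g := fun x => x.2)
      (by fun_prop) (by fun_prop)).inter
      (measurableSet_le (f := fun x : (ℝ × ℝ) × ℝ => x.2) (g := fun x => x.1.2)
        (by fun_prop) (by fun_prop))
  exact measurable_measure_prodMk_left this

/-- Up to the first radius `b` at which `h r ≤ lam * r ^ (1 + γ)`, monotonicity bounds `h` by
`lam * b ^ (1 + γ)`, so the interval `(0, b)` alone gives the asserted lower bound. -/
theorem le_lintegral_of_monotoneOn {γ lam : ℝ} (hγ : 0 < γ) (hlam : 0 < lam) {h : ℝ → ℝ≥0∞}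
    (hmono : MonotoneOn h (Ioi 0)) {M : ℝ} (hM : ∀ r, h r ≤ ENNReal.ofReal M) {r₀ : ℝ}
    (hr₀ : 0 < r₀) (hh : ∀ r ∈ Ioo 0 r₀, ENNReal.ofReal (lam * r ^ (1 + γ)) < h r) :
    ENNReal.ofReal (1 / ((γ + 1) * lam)) ≤ ∫⁻ r in Ioi 0, ENNReal.ofReal (r ^ γ) *
      {r | ENNReal.ofReal (lam * r ^ (1 + γ)) < h r}.indicator (fun r => (h r)⁻¹) r := by
  set B : Set ℝ := {b | ∀ r ∈ Ioo 0 b, ENNReal.ofReal (lam * r ^ (1 + γ)) < h r} with hB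
  have hγ1 : 0 < 1 + γ := by linarith
  have hbdd : BddAbove B := by
    refine ⟨(max M 0 / lam) ^ (1 / (1 + γ)) + 1, fun b hb => ?_⟩
    by_contra hcon
    push Not at hcon
    set r := (max M 0 / lam) ^ (1 / (1 + γ)) + 1 with hr
    have hr1 : 0 ≤ (max M 0 / lam) ^ (1 / (1 + γ)) := by positivity
    have hrpos : 0 < r := by linarith
    have h1 := (hb r ⟨hrpos, hcon⟩).trans_le (hM r)
    rw [ENNReal.ofReal_lt_ofReal_iff_of_nonneg (by positivity)] at h1
    have h2 : (max M 0 / lam) ≤ r ^ (1 + γ) := by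
      calc max M 0 / lam = ((max M 0 / lam) ^ (1 / (1 + γ))) ^ (1 + γ) := by
            rw [← Real.rpow_mul (by positivity), one_div_mul_cancel hγ1.ne', Real.rpow_one]
        _ ≤ r ^ (1 + γ) := Real.rpow_le_rpow hr1 (by linarith) hγ1.le
    rw [div_le_iff₀ hlam] at h2
    linarith [le_max_left M 0]
  have hr₀B : r₀ ∈ B := hh
  set b := sSup B with hb
  have hb0 : 0 < b := hr₀.trans_le (le_csSup hbdd hr₀B)
  have hgood : ∀ r ∈ Ioo 0 b, ENNReal.ofReal (lam * r ^ (1 + γ)) < h r := by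
    intro r hr
    obtain ⟨b', hb', hrb'⟩ := exists_lt_of_lt_csSup ⟨r₀, hr₀B⟩ hr.2
    exact hb' r ⟨hr.1, hrb'⟩
  have hupper : ∀ r ∈ Ioo 0 b, h r ≤ ENNReal.ofReal (lam * b ^ (1 + γ)) := by
    intro r hr
    have hlim : Tendsto (fun c : ℝ => ENNReal.ofReal (lam * c ^ (1 + γ))) (𝓝[>] b)
        (𝓝 (ENNReal.ofReal (lam * b ^ (1 + γ)))) := by
      refine (ENNReal.continuous_ofReal.tendsto _).comp (Tendsto.mono_left ?_ nhdsWithin_le_nhds)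
      exact ((Real.continuousAt_rpow_const b (1 + γ) (Or.inl hb0.ne')).const_mul lam)
    refine ge_of_tendsto hlim ?_
    filter_upwards [self_mem_nhdsWithin] with c hc
    have hcB : c ∉ B := fun hcB => absurd (le_csSup hbdd hcB) (not_le.2 hc)
    simp only [hB, mem_ofPred_eq, not_forall, not_lt] at hcB
    obtain ⟨r', hr', hle⟩ := hcB
    have hbr' : b ≤ r' := by
      by_contra hcon
      exact absurd hle (not_le.2 (hgood r' ⟨hr'.1, not_le.1 hcon⟩))
    refine (hmono hr.1 hr'.1 (hr.2.le.trans hbr')).trans (hle.trans ?_)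
    gcongr
    exacts [hr'.1.le, hr'.2.le]
  have hpos : 0 < lam * b ^ (1 + γ) := by positivity
  calc ENNReal.ofReal (1 / ((γ + 1) * lam))
      = ∫⁻ r in Ioo 0 b, ENNReal.ofReal (r ^ γ) * (ENNReal.ofReal (lam * b ^ (1 + γ)))⁻¹ := by
        rw [lintegral_mul_const _ (by fun_prop), lintegral_Ioo_rpow (by linarith) hb0.le,
          ← ENNReal.ofReal_inv_of_pos hpos, ← ENNReal.ofReal_mul (by positivity)]
        congr 1
        have : 0 < b ^ (1 + γ) := by positivity
        rw [add_comm γ 1]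
        field_simp
    _ ≤ ∫⁻ r in Ioo 0 b, ENNReal.ofReal (r ^ γ) *
      {r | ENNReal.ofReal (lam * r ^ (1 + γ)) < h r}.indicator (fun r => (h r)⁻¹) r := by
        refine setLIntegral_mono' measurableSet_Ioo fun r hr => ?_
        rw [indicator_of_mem (mem_ofPred_eq ▸ hgood r hr)]
        gcongr
        exact hupper r hr
    _ ≤ _ := lintegral_mono_set Ioo_subset_Ioi_self

/-- At almost every point with respect to `σ` the lower density of `σ` is positive, so short
intervals around it carry more mass than `lam * r ^ (1 + γ)`. -/
theorem ae_forall_lt_measure_Ioc {γ : ℝ} (hγ : 0 < γ) (lam : ℝ) (σ : Measure ℝ)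
    [IsFiniteMeasure σ] :
    ∀ᵐ q ∂σ, ∀ θ ∈ Ioo (0 : ℝ) 1, ∃ r₀ > 0, ∀ r ∈ Ioo (0 : ℝ) r₀,
      ENNReal.ofReal (lam * r ^ (1 + γ)) < σ (Ioc (q - θ * r) (q - θ * r + r)) := by
  filter_upwards [Besicovitch.ae_tendsto_rnDeriv volume σ,
    Measure.rnDeriv_lt_top (volume : Measure ℝ) σ] with q hq hfin θ hθ
  set L := (volume : Measure ℝ).rnDeriv σ q
  -- `volume` has a finite density `L` with respect to `σ`, so `σ` has at `q` the lower density
  -- `1 / L`, to be compared with the mass `lam * r ^ γ` per length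
  set c : ℝ := L.toReal + 1 with hc
  have hc0 : 0 < c := by positivity
  have hLc : L < ENNReal.ofReal c := by
    rw [ENNReal.lt_ofReal_iff_toReal_lt hfin.ne]; linarith
  set m := min θ (1 - θ) with hm
  have hm0 : 0 < m := lt_min hθ.1 (by linarith [hθ.2])
  have hmul : Tendsto (fun r : ℝ => m * r / 2) (𝓝[>] 0) (𝓝[>] 0) := by
    refine tendsto_nhdsWithin_iff.2 ⟨?_, ?_⟩
    · have : Tendsto (fun r : ℝ => m * r / 2) (𝓝 0) (𝓝 (m * 0 / 2)) :=
        Continuous.tendsto (by fun_prop) 0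
      simp only [mul_zero, zero_div] at this
      exact this.mono_left nhdsWithin_le_nhds
    · filter_upwards [self_mem_nhdsWithin] with r (hr : 0 < r)
      exact mem_Ioi.2 (by positivity)
  have hpow : Tendsto (fun r : ℝ => lam * r ^ γ) (𝓝[>] 0) (𝓝 0) := by
    have : Tendsto (fun r : ℝ => lam * r ^ γ) (𝓝 0) (𝓝 (lam * 0 ^ γ)) :=
      (Real.continuousAt_rpow_const 0 γ (Or.inr hγ.le)).const_mul lam
    rw [Real.zero_rpow hγ.ne', mul_zero] at this
    exact this.mono_left nhdsWithin_le_nhds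
  have hev : ∀ᶠ r in 𝓝[>] (0 : ℝ),
      ENNReal.ofReal (lam * r ^ (1 + γ)) < σ (Ioc (q - θ * r) (q - θ * r + r)) := by
    filter_upwards [hmul.eventually (hq.eventually_lt_const hLc), self_mem_nhdsWithin,
      hpow.eventually_lt_const (show 0 < m / c by positivity)] with r hr (hr0 : 0 < r) hr1
    have hσ : σ (Metric.closedBall q (m * r / 2)) ≠ 0 := by
      intro h0
      rw [h0, Real.volume_closedBall, ENNReal.div_zero] at hr
      · exact absurd hr (by simp)
      · simp only [ne_eq, ENNReal.ofReal_eq_zero, not_le]; positivity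
    rw [ENNReal.div_lt_iff (Or.inl hσ) (Or.inl (measure_ne_top _ _)), Real.volume_closedBall,
      mul_comm (ENNReal.ofReal c)] at hr
    have h2 : ENNReal.ofReal (m * r / c) < σ (Metric.closedBall q (m * r / 2)) := by
      rw [ENNReal.ofReal_div_of_pos hc0]
      refine ENNReal.div_lt_of_lt_mul (lt_of_eq_of_lt ?_ hr)
      congr 1; ring
    refine lt_of_le_of_lt ?_ (h2.trans_le (measure_mono ?_))
    · refine ENNReal.ofReal_le_ofReal ?_
      rw [Real.rpow_add hr0, Real.rpow_one]
      calc lam * (r * r ^ γ) = (lam * r ^ γ) * r := by ring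
        _ ≤ m / c * r := by gcongr
        _ = m * r / c := by ring
    · rw [Real.closedBall_eq_Icc]
      have h3 : m * r ≤ θ * r := by gcongr; exact min_le_left _ _
      have h4 : m * r ≤ (1 - θ) * r := by gcongr; exact min_le_right _ _
      have h5 : 0 < m * r := by positivity
      intro z hz
      constructor <;> nlinarith [hz.1, hz.2]
  obtain ⟨r₀, hr₀, hsub⟩ := mem_nhdsGT_iff_exists_Ioo_subset.1 hev
  exact ⟨r₀, hr₀, fun r hr => hsub hr⟩

/-- The change of variables `(x, y) = (q - θ r, q - θ r + r)`, with Jacobian determinant `r`. -/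
theorem lintegral_segments_le (q : ℝ) {F : ℝ × ℝ → ℝ≥0∞} (hF : Measurable F) :
    ∫⁻ θ in Ioo (0 : ℝ) 1, ∫⁻ r in Ioi (0 : ℝ),
      ENNReal.ofReal r * F (q - θ * r, q - θ * r + r) ≤ ∫⁻ p, F p := by
  have hinner : ∀ r ∈ Ioi (0 : ℝ), ∫⁻ θ : ℝ, ENNReal.ofReal r * F (q - θ * r, q - θ * r + r)
      = ∫⁻ x, F (x, x + r) := by
    intro r (hr : 0 < r)
    have hm : Measurable fun x : ℝ => F (q - x, q - x + r) := by fun_prop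
    rw [← lintegral_sub_left_eq_self (fun x => F (x, x + r)) q]
    conv_rhs => rw [← Real.smul_map_volume_mul_right hr.ne']
    rw [lintegral_smul_measure, lintegral_map hm (by fun_prop), abs_of_pos hr,
      lintegral_const_mul _ (by fun_prop), smul_eq_mul]
  calc _ = ∫⁻ r in Ioi (0 : ℝ), ∫⁻ θ in Ioo (0 : ℝ) 1,
        ENNReal.ofReal r * F (q - θ * r, q - θ * r + r) := by
        rw [lintegral_lintegral_swap]
        exact Measurable.aemeasurable (by fun_prop)
    _ ≤ ∫⁻ r in Ioi (0 : ℝ), ∫⁻ x, F (x, x + r) := by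
        refine setLIntegral_mono' measurableSet_Ioi fun r hr => ?_
        rw [← hinner r hr]
        exact setLIntegral_le_lintegral _ _
    _ ≤ ∫⁻ r : ℝ, ∫⁻ x, F (x, x + r) := setLIntegral_le_lintegral _ _
    _ = ∫⁻ x, ∫⁻ r : ℝ, F (x, x + r) := by
        rw [lintegral_lintegral_swap]
        exact Measurable.aemeasurable (by fun_prop)
    _ = ∫⁻ x, ∫⁻ y, F (x, y) := by
        refine lintegral_congr fun x => ?_
        exact lintegral_add_left_eq_self (fun y => F (x, y)) x
    _ = ∫⁻ p, F p := by
        rw [Measure.volume_eq_prod, lintegral_prod _ hF.aemeasurable]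

theorem measurableSet_measure_Ioc_gt (γ lam : ℝ) {U : Set ℝ} (hU : IsOpen U) (σ : Measure ℝ)
    [SFinite σ] :
    MeasurableSet {p ∈ segs U | ENNReal.ofReal (lam * |p.1 - p.2| ^ (1 + γ)) < σ (Ioc p.1 p.2)} :=
  (isOpen_segs hU).measurableSet.inter
    (measurableSet_lt (by fun_prop) (measurable_measure_Ioc σ))

/-- The sharp lower bound for monotone functions. Writing `1 = ∫ 1_{x < q ≤ y} dσ(q) / σ (x, y]`
on the set of pairs in question, the integral becomes an average over the points `q` of integrals
over nested families of intervals `(q - θ r, q - θ r + r]`, to which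
`le_lintegral_of_monotoneOn` applies. -/
theorem le_nu_of_measure {γ lam η : ℝ} (hγ : 0 < γ) (hlam : 0 < lam) (hη : 0 < η) {U K : Set ℝ}
    (hU : IsOpen U) (hK : MeasurableSet K) (hKU : ∀ q ∈ K, Icc (q - η) (q + η) ⊆ U)
    (σ : Measure ℝ) [IsFiniteMeasure σ] (hσ : σ univ ≤ ENNReal.ofReal (lam * η ^ (1 + γ))) :
    ENNReal.ofReal (1 / ((γ + 1) * lam)) * σ K ≤
      nu γ {p ∈ segs U | ENNReal.ofReal (lam * |p.1 - p.2| ^ (1 + γ)) < σ (Ioc p.1 p.2)} := by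
  set T : Set (ℝ × ℝ) :=
    {p ∈ segs U | ENNReal.ofReal (lam * |p.1 - p.2| ^ (1 + γ)) < σ (Ioc p.1 p.2)} with hT
  have hTm : MeasurableSet T := measurableSet_measure_Ioc_gt γ lam hU σ
  have hIoc := measurable_measure_Ioc σ
  -- where `σ (Ioc p.1 p.2) = 0` the inverse is `∞`, but there are no such pairs in `T`
  set f : ℝ × ℝ → ℝ≥0∞ := T.indicator
    (fun p => ENNReal.ofReal (|p.1 - p.2| ^ (γ - 1)) * (σ (Ioc p.1 p.2))⁻¹) with hf
  have hfm : Measurable f := ((measurable_gap γ).mul hIoc.inv).indicator hTm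
  have hS : MeasurableSet {x : (ℝ × ℝ) × ℝ | x.2 ∈ Ioc x.1.1 x.1.2} :=
    (measurableSet_lt (f := fun x : (ℝ × ℝ) × ℝ => x.1.1) (g := fun x => x.2)
      (by fun_prop) (by fun_prop)).inter
      (measurableSet_le (f := fun x : (ℝ × ℝ) × ℝ => x.2) (g := fun x => x.1.2)
        (by fun_prop) (by fun_prop))
  set F : (ℝ × ℝ) → ℝ → ℝ≥0∞ := fun p q => (Ioc p.1 p.2).indicator (fun _ => f p) q with hF
  have hFm : Measurable (Function.uncurry F) := by
    have : Function.uncurry F = {x : (ℝ × ℝ) × ℝ | x.2 ∈ Ioc x.1.1 x.1.2}.indicator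
        (fun x => f x.1) := by
      ext x
      simp only [Function.uncurry, hF, indicator_apply, mem_ofPred_eq]
    rw [this]
    exact (hfm.comp measurable_fst).indicator hS
  have hone : nu γ T ≥ ∫⁻ p, ∫⁻ q in K, F p q ∂σ := by
    unfold nu
    rw [← lintegral_indicator hTm]
    refine lintegral_mono fun p => ?_
    simp only [hF]
    rw [lintegral_indicator measurableSet_Ioc, setLIntegral_const]
    by_cases hp : p ∈ T
    · rw [hf, indicator_of_mem hp, indicator_of_mem hp, mul_assoc]
      refine mul_le_of_le_one_right (by positivity) ?_
      calc _ ≤ (σ (Ioc p.1 p.2))⁻¹ * σ (Ioc p.1 p.2) := by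
            gcongr; exact Measure.restrict_le_self
        _ ≤ 1 := ENNReal.inv_mul_le_one _
    · rw [hf, indicator_of_notMem hp, zero_mul]
      exact zero_le
  refine le_trans ?_ hone
  rw [lintegral_lintegral_swap hFm.aemeasurable]
  have hc : ENNReal.ofReal (1 / ((γ + 1) * lam)) * σ K
      = ∫⁻ _ in K, ENNReal.ofReal (1 / ((γ + 1) * lam)) ∂σ := (setLIntegral_const _ _).symm
  rw [hc]
  refine lintegral_mono_ae ?_
  filter_upwards [ae_restrict_of_ae (ae_forall_lt_measure_Ioc hγ lam σ), ae_restrict_mem hK]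
    with q hq hqK
  refine le_trans ?_ (lintegral_segments_le q (hFm.comp (measurable_id.prodMk measurable_const)))
  have hc' : ENNReal.ofReal (1 / ((γ + 1) * lam))
      = ∫⁻ _ in Ioo (0 : ℝ) 1, ENNReal.ofReal (1 / ((γ + 1) * lam)) := by
    rw [setLIntegral_const, Real.volume_Ioo, sub_zero, ENNReal.ofReal_one, mul_one]
  rw [hc']
  refine setLIntegral_mono' measurableSet_Ioo fun θ hθ => ?_
  obtain ⟨r₀, hr₀, hgood⟩ := hq θ hθ
  have hmono : MonotoneOn (fun r => σ (Ioc (q - θ * r) (q - θ * r + r))) (Ioi 0) := by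
    intro r hr r' hr' hrr'
    refine measure_mono (Ioc_subset_Ioc ?_ ?_)
    · nlinarith [hθ.1]
    · nlinarith [hθ.2]
  have hM : ∀ r, σ (Ioc (q - θ * r) (q - θ * r + r)) ≤ ENNReal.ofReal (σ univ).toReal := by
    intro r
    rw [ENNReal.ofReal_toReal (measure_ne_top _ _)]
    exact measure_mono (subset_univ _)
  refine (le_lintegral_of_monotoneOn hγ hlam hmono hM hr₀ hgood).trans ?_
  refine setLIntegral_mono' measurableSet_Ioi fun r hr => ?_
  have hr0 : 0 < r := hr
  by_cases hg : ENNReal.ofReal (lam * r ^ (1 + γ)) < σ (Ioc (q - θ * r) (q - θ * r + r))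
  · -- the bound on the total mass keeps the intervals around `q` shorter than `η`, so inside `U`
    have hdist : |q - θ * r - (q - θ * r + r)| = r := by
      rw [sub_add_cancel_left, abs_neg, abs_of_pos hr0]
    have hrη : r < η := by
      have := hg.trans_le ((measure_mono (subset_univ _)).trans hσ)
      rw [ENNReal.ofReal_lt_ofReal_iff_of_nonneg (by positivity),
        mul_lt_mul_iff_right₀ hlam] at this
      exact (Real.rpow_lt_rpow_iff hr0.le hη.le (by linarith)).1 this
    have hT' : (q - θ * r, q - θ * r + r) ∈ T := by
      refine ⟨⟨by simp only; linarith, fun z hz => hKU q hqK ?_⟩, ?_⟩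
      · simp only [mem_Icc] at hz ⊢
        constructor <;> nlinarith [hθ.1, hθ.2]
      · simpa only [hdist] using hg
    have hqI : q ∈ Ioc (q - θ * r) (q - θ * r + r) := by
      constructor <;> nlinarith [hθ.1, hθ.2]
    rw [indicator_of_mem (mem_ofPred_eq ▸ hg)]
    simp only [hF]
    rw [indicator_of_mem hqI, hf, indicator_of_mem hT']
    simp only [hdist]
    rw [← mul_assoc, ← ENNReal.ofReal_mul hr0.le]
    gcongr
    rw [Real.rpow_sub_one hr0.ne', mul_div_cancel₀ _ hr0.ne']
  · rw [indicator_of_notMem (mem_ofPred_eq ▸ hg), mul_zero]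
    exact zero_le

/-! ### The lower bound for a fixed differentiable function -/

theorem measurableSet_abs_sub_gt (γ lam : ℝ) {G : Set ℝ} (hG : IsOpen G) {Ψ : ℝ → ℝ}
    (hΨ : Measurable Ψ) :
    MeasurableSet {p ∈ segs G | ENNReal.ofReal (lam * |p.1 - p.2| ^ (1 + γ))
      < ENNReal.ofReal |Ψ p.1 - Ψ p.2|} :=
  (isOpen_segs hG).measurableSet.inter (measurableSet_lt
    (f := fun p : ℝ × ℝ => ENNReal.ofReal (lam * |p.1 - p.2| ^ (1 + γ)))
    (g := fun p : ℝ × ℝ => ENNReal.ofReal |Ψ p.1 - Ψ p.2|) (by fun_prop) (by fun_prop))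

theorem exists_Ioo_lt_abs_sub {G : Set ℝ} (hG : IsOpen G) {Ψ : ℝ → ℝ} {x a κ : ℝ} (hx : x ∈ G)
    (hΨ : HasDerivAt Ψ a x) (hκ : κ < |a|) :
    ∃ r₀ > 0, ∀ y ∈ Ioo x (x + r₀), Icc x y ⊆ G ∧ κ * (y - x) < |Ψ x - Ψ y| := by
  obtain ⟨δ, hδ, hsub⟩ := Metric.isOpen_iff.1 hG x hx
  have h1 : ∀ᶠ y in 𝓝[>] x, κ < |slope Ψ x y| :=
    ((hasDerivAt_iff_tendsto_slope.1 hΨ).mono_left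
      (nhdsWithin_mono x fun y (hy : x < y) => hy.ne')).abs.eventually_const_lt hκ
  obtain ⟨u, hu, hsub'⟩ := mem_nhdsGT_iff_exists_Ioo_subset.1 h1
  refine ⟨min δ (u - x), lt_min hδ (sub_pos.2 hu), fun y hy => ⟨fun z hz => hsub ?_, ?_⟩⟩
  · rw [Metric.mem_ball, Real.dist_eq, abs_of_nonneg (sub_nonneg.2 hz.1)]
    linarith [hz.2, hy.2, min_le_left δ (u - x)]
  · have hy0 : 0 < y - x := sub_pos.2 hy.1
    have h2 : κ < |slope Ψ x y| := hsub' ⟨hy.1, by linarith [hy.2, min_le_right δ (u - x)]⟩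
    rw [slope_def_field, abs_div, abs_of_pos hy0, lt_div_iff₀ hy0, abs_sub_comm] at h2
    exact h2

/-- For a fixed differentiable function the functional sees, near each point, all increments up
to the length `(|Ψ'(x)| / lam) ^ (1 / γ)`; Fatou's lemma sums these contributions. -/
theorem le_liminf_nu_of_hasDerivAt {γ : ℝ} (hγ : 0 < γ) {G : Set ℝ} (hG : IsOpen G)
    {Ψ ψ : ℝ → ℝ} (hΨ : ∀ x, HasDerivAt Ψ (ψ x) x) :
    ENNReal.ofReal (1 / γ) * ∫⁻ x in G, ENNReal.ofReal |ψ x| ≤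
      liminf (fun lam : ℝ => ENNReal.ofReal lam * nu γ {p ∈ segs G |
        ENNReal.ofReal (lam * |p.1 - p.2| ^ (1 + γ)) < ENNReal.ofReal |Ψ p.1 - Ψ p.2|}) atTop := by
  have hΨm : Measurable Ψ :=
    (continuous_iff_continuousAt.2 fun x => (hΨ x).continuousAt).measurable
  set T : ℝ → Set (ℝ × ℝ) := fun lam => {p ∈ segs G |
    ENNReal.ofReal (lam * |p.1 - p.2| ^ (1 + γ)) < ENNReal.ofReal |Ψ p.1 - Ψ p.2|} with hT
  have hTm : ∀ lam, MeasurableSet (T lam) := fun lam => measurableSet_abs_sub_gt γ lam hG hΨm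
  set f : ℝ → ℝ × ℝ → ℝ≥0∞ := fun lam =>
    (T lam).indicator fun p => ENNReal.ofReal (|p.1 - p.2| ^ (γ - 1)) with hf
  have hfm : ∀ lam, Measurable (f lam) := fun lam => (measurable_gap γ).indicator (hTm lam)
  have hfub : ∀ lam : ℝ, ENNReal.ofReal lam * nu γ (T lam)
      = ∫⁻ x, ENNReal.ofReal lam * ∫⁻ y, f lam (x, y) := by
    intro lam
    unfold nu
    rw [← lintegral_indicator (hTm lam), Measure.volume_eq_prod,
      lintegral_prod _ (hfm lam).aemeasurable, lintegral_const_mul _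
      (hfm lam).lintegral_prod_right']
  rw [show (fun lam : ℝ => ENNReal.ofReal lam * nu γ (T lam))
      = fun lam => ∫⁻ x, ENNReal.ofReal lam * ∫⁻ y, f lam (x, y) from funext hfub]
  refine le_trans ?_ (lintegral_liminf_le fun lam =>
    (hfm lam).lintegral_prod_right'.const_mul _)
  refine (le_of_eq (lintegral_const_mul' _ _ ENNReal.ofReal_ne_top).symm).trans ?_
  refine (setLIntegral_mono' hG.measurableSet fun x hx => ?_).trans
    (setLIntegral_le_lintegral G _)
  rw [← ENNReal.ofReal_mul (by positivity)]
  refine ENNReal.le_of_forall_nnreal_lt fun r hr => ?_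
  rcases eq_or_ne r 0 with rfl | hr0
  · simp
  have hrpos : 0 < (r : ℝ) := NNReal.coe_pos.2 (pos_iff_ne_zero.2 hr0)
  rw [← ENNReal.ofReal_coe_nnreal, ENNReal.ofReal_lt_ofReal_iff_of_nonneg hrpos.le] at hr
  have hκ : γ * r < |ψ x| := by
    rw [one_div, inv_mul_eq_div, lt_div_iff₀ hγ] at hr
    linarith
  have hκ0 : 0 < γ * r := by positivity
  obtain ⟨r₀, hr₀, hgood⟩ := exists_Ioo_lt_abs_sub hG hx (hΨ x) hκ
  refine le_liminf_of_le (by isBoundedDefault) ?_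
  have hsmall : ∀ᶠ lam : ℝ in atTop, (γ * r / lam) ^ (1 / γ) < r₀ := by
    have h0 : Tendsto (fun lam : ℝ => (γ * r / lam) ^ (1 / γ)) atTop (𝓝 (0 ^ (1 / γ))) :=
      (tendsto_const_nhds.div_atTop tendsto_id).rpow_const (Or.inr (by positivity))
    rw [Real.zero_rpow (by positivity)] at h0
    exact h0.eventually_lt_const hr₀
  filter_upwards [hsmall, eventually_gt_atTop 0] with lam hlam hlam0
  set ρ := (γ * r / lam) ^ (1 / γ) with hρ
  have hρ0 : 0 < ρ := by positivity
  have hργ : ρ ^ γ = γ * r / lam := by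
    rw [hρ, ← Real.rpow_mul (by positivity), one_div_mul_cancel hγ.ne', Real.rpow_one]
  calc (r : ℝ≥0∞) = ENNReal.ofReal lam * ENNReal.ofReal (ρ ^ γ / γ) := by
        rw [← ENNReal.ofReal_mul hlam0.le, hργ, ← ENNReal.ofReal_coe_nnreal]
        congr 1
        field_simp
    _ = ENNReal.ofReal lam * ∫⁻ y in Ioo x (x + ρ), ENNReal.ofReal (|x - y| ^ (γ - 1)) := by
        rw [lintegral_gap_right hγ x hρ0.le]
    _ ≤ ENNReal.ofReal lam * ∫⁻ y in Ioo x (x + ρ), f lam (x, y) := by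
        gcongr ENNReal.ofReal lam * ?_
        refine setLIntegral_mono' measurableSet_Ioo fun y hy => ?_
        obtain ⟨h1, h2⟩ := hgood y ⟨hy.1, hy.2.trans (by linarith)⟩
        have hy0 : 0 < y - x := sub_pos.2 hy.1
        have hyT : (x, y) ∈ T lam := by
          refine ⟨⟨hy.1, h1⟩, ?_⟩
          simp only
          rw [abs_sub_comm x y, abs_of_pos hy0,
            ENNReal.ofReal_lt_ofReal_iff_of_nonneg (by positivity)]
          refine lt_of_le_of_lt ?_ h2
          rw [add_comm, Real.rpow_add_one hy0.ne', ← mul_assoc]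
          refine mul_le_mul_of_nonneg_right ?_ hy0.le
          calc lam * (y - x) ^ γ ≤ lam * ρ ^ γ := by
                gcongr
                linarith [hy.2]
            _ = γ * r := by rw [hργ]; field_simp
        rw [hf]
        simp only
        rw [indicator_of_mem hyT]
    _ ≤ _ := by
        gcongr ENNReal.ofReal lam * ?_
        exact setLIntegral_le_lintegral _ _

/-! ### Distributional derivatives and increments -/

/-- The function `w` has in `Ω` the distributional derivative `g dx + S - T`, with an integrable
density `g` and finite (in the applications singular) measures `S` and `T`. -/
structure HasWeakDeriv (w : ℝ → ℝ) (Ω : Set ℝ) (g : ℝ → ℝ) (S T : Measure ℝ) : Prop where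
  locallyIntegrableOn : LocallyIntegrableOn w Ω
  measurable : Measurable g
  integrable : Integrable g
  integral_eq : ∀ φ : ℝ → ℝ, ContDiff ℝ 1 φ → HasCompactSupport φ → tsupport φ ⊆ Ω →
    ∫ x in Ω, w x * deriv φ x = -((∫ x, φ x * g x) + ∫ x, φ x ∂S - ∫ x, φ x ∂T)

/-- A smooth step from `0` to `1` on the interval `[x, x + 1 / (n + 1)]`. -/
def smoothStep (n : ℕ) (x t : ℝ) : ℝ := Real.smoothTransition ((n + 1) * (t - x))

theorem contDiff_smoothStep (n : ℕ) (x : ℝ) : ContDiff ℝ 1 (smoothStep n x) :=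
  Real.smoothTransition.contDiff.comp (by fun_prop)

theorem smoothStep_nonneg (n : ℕ) (x t : ℝ) : 0 ≤ smoothStep n x t :=
  Real.smoothTransition.nonneg _

theorem smoothStep_le_one (n : ℕ) (x t : ℝ) : smoothStep n x t ≤ 1 :=
  Real.smoothTransition.le_one _

theorem smoothStep_of_le {n : ℕ} {x t : ℝ} (h : t ≤ x) : smoothStep n x t = 0 :=
  Real.smoothTransition.zero_of_nonpos (mul_nonpos_of_nonneg_of_nonpos (by positivity)
    (by linarith))

theorem smoothStep_of_ge {n : ℕ} {x t : ℝ} (h : x + 1 / (n + 1) ≤ t) : smoothStep n x t = 1 := by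
  refine Real.smoothTransition.one_of_one_le ?_
  have h1 : 1 / ((n : ℝ) + 1) ≤ t - x := by linarith
  rwa [div_le_iff₀' (by positivity)] at h1

theorem deriv_smoothStep_eq_zero {n : ℕ} {x t : ℝ} (h : t ∉ Icc x (x + 1 / (n + 1))) :
    deriv (smoothStep n x) t = 0 := by
  rw [mem_Icc, not_and_or, not_le, not_le] at h
  rcases h with h | h
  · have : smoothStep n x =ᶠ[𝓝 t] fun _ => 0 := by
      filter_upwards [Iio_mem_nhds h] with s hs using smoothStep_of_le hs.le
    rw [this.deriv_eq, deriv_const]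
  · have : smoothStep n x =ᶠ[𝓝 t] fun _ => 1 := by
      filter_upwards [Ioi_mem_nhds h] with s hs using smoothStep_of_ge hs.le
    rw [this.deriv_eq, deriv_const]

theorem hasCompactSupport_deriv_smoothStep (n : ℕ) (x : ℝ) :
    HasCompactSupport (deriv (smoothStep n x)) :=
  HasCompactSupport.intro isCompact_Icc fun _ h => deriv_smoothStep_eq_zero h

theorem continuous_deriv_smoothStep (n : ℕ) (x : ℝ) : Continuous (deriv (smoothStep n x)) :=
  (contDiff_smoothStep n x).continuous_deriv le_rfl

theorem exists_abs_deriv_smoothStep_le :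
    ∃ C : ℝ, 0 ≤ C ∧ ∀ (n : ℕ) (x t : ℝ), |deriv (smoothStep n x) t| ≤ (n + 1) * C := by
  have hcont : Continuous (deriv Real.smoothTransition) :=
    (Real.smoothTransition.contDiff (n := 1)).continuous_deriv le_rfl
  have hsupp : HasCompactSupport (deriv Real.smoothTransition) := by
    have h := hasCompactSupport_deriv_smoothStep 0 0
    have : smoothStep 0 0 = Real.smoothTransition := by
      ext t; simp [smoothStep]
    rwa [this] at h
  obtain ⟨C, hC⟩ := hcont.bounded_above_of_compact_support hsupp
  refine ⟨C, (norm_nonneg _).trans (hC 0), fun n x t => ?_⟩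
  have hd : HasDerivAt (smoothStep n x)
      (deriv Real.smoothTransition ((n + 1) * (t - x)) * (n + 1)) t := by
    have h1 : HasDerivAt Real.smoothTransition _ (((n : ℝ) + 1) * (t - x)) :=
      ((Real.smoothTransition.contDiff (n := 1)).differentiable one_ne_zero _).hasDerivAt
    have h2 : HasDerivAt (fun t : ℝ => ((n : ℝ) + 1) * (t - x)) ((n : ℝ) + 1) t := by
      simpa using ((hasDerivAt_id t).sub_const x).const_mul ((n : ℝ) + 1)
    exact h1.comp t h2
  rw [hd.deriv, abs_mul, abs_of_nonneg (by positivity : (0 : ℝ) ≤ n + 1), mul_comm]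
  gcongr
  exact hC _

theorem integral_deriv_smoothStep (n : ℕ) (x : ℝ) : ∫ t, deriv (smoothStep n x) t = 1 := by
  have hint : Integrable (deriv (smoothStep n x)) :=
    (continuous_deriv_smoothStep n x).integrable_of_hasCompactSupport
      (hasCompactSupport_deriv_smoothStep n x)
  have h := integral_of_hasDerivAt_of_tendsto (f := smoothStep n x) (m := 0) (n := 1)
    (fun t => ((contDiff_smoothStep n x).differentiable one_ne_zero t).hasDerivAt) hint
    (tendsto_const_nhds.congr' ?_) (tendsto_const_nhds.congr' ?_)
  · simpa using h
  · filter_upwards [eventually_le_atBot x] with t ht using (smoothStep_of_le ht).symm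
  · filter_upwards [eventually_ge_atTop (x + 1 / (n + 1))] with t ht
    exact (smoothStep_of_ge ht).symm

theorem integrable_mul_deriv_smoothStep {f : ℝ → ℝ} (hf : LocallyIntegrable f) (n : ℕ) (x : ℝ) :
    Integrable fun t => f t * deriv (smoothStep n x) t :=
  hf.integrable_smul_right_of_hasCompactSupport (continuous_deriv_smoothStep n x)
    (hasCompactSupport_deriv_smoothStep n x)

/-- The derivatives of the steps form an approximate identity at almost every point. -/
theorem ae_tendsto_integral_mul_deriv_smoothStep {f : ℝ → ℝ} (hf : LocallyIntegrable f) :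
    ∀ᵐ x, Tendsto (fun n => ∫ t, f t * deriv (smoothStep n x) t) atTop (𝓝 (f x)) := by
  obtain ⟨C, hC0, hC⟩ := exists_abs_deriv_smoothStep_le
  filter_upwards [IsUnifLocDoublingMeasure.ae_tendsto_average_norm_sub volume hf 1] with x hx
  have hδ : Tendsto (fun n : ℕ => 1 / ((n : ℝ) + 1)) atTop (𝓝[>] 0) :=
    tendsto_nhdsWithin_iff.2 ⟨tendsto_one_div_add_atTop_nhds_zero_nat,
      Eventually.of_forall fun n => mem_Ioi.2 (by positivity)⟩
  have hav := (hx (fun _ : ℕ => x) _ hδ (Eventually.of_forall fun n => by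
    rw [one_mul]; exact Metric.mem_closedBall_self (by positivity))).const_mul (2 * C)
  rw [mul_zero] at hav
  rw [tendsto_iff_norm_sub_tendsto_zero]
  refine squeeze_zero (fun _ => norm_nonneg _) (fun n => ?_) hav
  set δ : ℝ := 1 / ((n : ℝ) + 1) with hδn
  have hδ0 : 0 < δ := by positivity
  have hlocint : IntegrableOn (fun t => ‖f t - f x‖) (Metric.closedBall x δ) :=
    ((hf.sub (locallyIntegrable_const _)).integrableOn_isCompact
      (isCompact_closedBall x δ)).norm
  have hconst : Integrable fun t => f x * deriv (smoothStep n x) t :=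
    integrable_mul_deriv_smoothStep (locallyIntegrable_const _) n x
  have heq : (∫ t, f t * deriv (smoothStep n x) t) - f x
      = ∫ t, (f t - f x) * deriv (smoothStep n x) t := by
    simp_rw [sub_mul]
    rw [integral_sub (integrable_mul_deriv_smoothStep hf n x) hconst, integral_const_mul,
      integral_deriv_smoothStep, mul_one]
  have hsupp : ∀ t ∉ Metric.closedBall x δ, ‖(f t - f x) * deriv (smoothStep n x) t‖ = 0 := by
    intro t ht
    rw [deriv_smoothStep_eq_zero, mul_zero, norm_zero]
    intro ht'
    refine ht ?_
    rw [Real.closedBall_eq_Icc]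
    exact ⟨by linarith [ht'.1], ht'.2⟩
  calc ‖(∫ t, f t * deriv (smoothStep n x) t) - f x‖
      = ‖∫ t, (f t - f x) * deriv (smoothStep n x) t‖ := by rw [heq]
    _ ≤ ∫ t, ‖(f t - f x) * deriv (smoothStep n x) t‖ := norm_integral_le_integral_norm _
    _ = ∫ t in Metric.closedBall x δ, ‖(f t - f x) * deriv (smoothStep n x) t‖ :=
        (setIntegral_eq_integral_of_forall_compl_eq_zero hsupp).symm
    _ ≤ ∫ t in Metric.closedBall x δ, ((n + 1) * C) * ‖f t - f x‖ := by
        refine integral_mono_of_nonneg (Eventually.of_forall fun t => norm_nonneg _)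
          (hlocint.const_mul _) (Eventually.of_forall fun t => ?_)
        simp only [norm_mul]
        rw [mul_comm]
        gcongr
        exact hC n x t
    _ = 2 * C * ⨍ t in Metric.closedBall x δ, ‖f t - f x‖ := by
        rw [integral_const_mul, setAverage_eq, measureReal_def, Real.volume_closedBall,
          ENNReal.toReal_ofReal (by positivity), smul_eq_mul, hδn]
        field_simp

theorem tendsto_smoothStep_sub {x y : ℝ} (hxy : x < y) (t : ℝ) :
    Tendsto (fun n => smoothStep n x t - smoothStep n y t) atTop
      (𝓝 ((Ioc x y).indicator (fun _ => 1) t)) := by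
  have hlarge : ∀ z < t, ∀ᶠ n : ℕ in atTop, smoothStep n z t = 1 := by
    intro z hz
    filter_upwards [tendsto_one_div_add_atTop_nhds_zero_nat.eventually_lt_const
      (sub_pos.2 hz)] with n hn
    exact smoothStep_of_ge (by linarith)
  refine tendsto_const_nhds.congr' ?_
  rcases le_or_gt t x with h | h
  · refine Eventually.of_forall fun n => ?_
    have h0 : t ∉ Ioc x y := fun h' => not_lt.2 h h'.1
    simp only [smoothStep_of_le h, smoothStep_of_le (h.trans hxy.le), sub_self,
      indicator_of_notMem h0]
  rcases le_or_gt t y with h' | h'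
  · filter_upwards [hlarge x h] with n hn
    have h0 : t ∈ Ioc x y := ⟨h, h'⟩
    simp only [hn, smoothStep_of_le h', sub_zero, indicator_of_mem h0]
  · filter_upwards [hlarge x h, hlarge y h'] with n hn hn'
    have h0 : t ∉ Ioc x y := fun h'' => not_lt.2 h''.2 h'
    simp only [hn, hn', sub_self, indicator_of_notMem h0]

theorem abs_smoothStep_sub_le (n : ℕ) (x y t : ℝ) :
    |smoothStep n x t - smoothStep n y t| ≤ 1 := by
  rw [abs_le]
  constructor <;> linarith [smoothStep_nonneg n x t, smoothStep_nonneg n y t,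
    smoothStep_le_one n x t, smoothStep_le_one n y t]

theorem tendsto_integral_smoothStep_sub {x y : ℝ} (hxy : x < y) (μ : Measure ℝ) {g : ℝ → ℝ}
    (hg : Integrable g μ) :
    Tendsto (fun n => ∫ t, (smoothStep n x t - smoothStep n y t) * g t ∂μ) atTop
      (𝓝 (∫ t in Ioc x y, g t ∂μ)) := by
  rw [← integral_indicator measurableSet_Ioc]
  refine tendsto_integral_of_dominated_convergence (fun t => ‖g t‖) (fun n => ?_) hg.norm
    (fun n => Eventually.of_forall fun t => ?_) (Eventually.of_forall fun t => ?_)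
  · exact ((contDiff_smoothStep n x).continuous.sub
      (contDiff_smoothStep n y).continuous).aestronglyMeasurable.mul hg.aestronglyMeasurable
  · rw [norm_mul]
    exact mul_le_of_le_one_left (norm_nonneg _) (abs_smoothStep_sub_le n x y t)
  · have h := (tendsto_smoothStep_sub hxy t).mul_const (g t)
    simp only [← indicator_mul_left, one_mul] at h
    exact h

/-- As `w` is integrable only on compact subsets of `Ω`, it is cut off to intervals. Rational
endpoints keep the exceptional set null. -/
theorem ae_forall_Icc_tendsto {w : ℝ → ℝ} {Ω : Set ℝ} (hw : LocallyIntegrableOn w Ω) :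
    ∀ᵐ x, ∀ α β : ℚ, Icc (α : ℝ) β ⊆ Ω → Tendsto (fun n => ∫ t, (Icc (α : ℝ) β).indicator w t *
      deriv (smoothStep n x) t) atTop (𝓝 ((Icc (α : ℝ) β).indicator w x)) := by
  rw [ae_all_iff]
  intro α
  rw [ae_all_iff]
  intro β
  by_cases h : Icc (α : ℝ) β ⊆ Ω
  · have hint : Integrable ((Icc (α : ℝ) β).indicator w) :=
      (integrable_indicator_iff measurableSet_Icc).2
        (hw.integrableOn_compact_subset h isCompact_Icc)
    filter_upwards [ae_tendsto_integral_mul_deriv_smoothStep hint.locallyIntegrable] with x hx _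
      using hx
  · exact Eventually.of_forall fun x h' => absurd h' h

theorem exists_rat_Icc_subset {Ω : Set ℝ} (hΩ : IsOpen Ω) {x y : ℝ} (hxy : x ≤ y)
    (h : Icc x y ⊆ Ω) : ∃ α β : ℚ, (α : ℝ) < x ∧ y < β ∧ Icc (α : ℝ) β ⊆ Ω := by
  obtain ⟨δ, hδ, hsub⟩ := Metric.isOpen_iff.1 hΩ x (h ⟨le_rfl, hxy⟩)
  obtain ⟨δ', hδ', hsub'⟩ := Metric.isOpen_iff.1 hΩ y (h ⟨hxy, le_rfl⟩)
  obtain ⟨α, hα, hα'⟩ := exists_rat_btwn (sub_lt_self x hδ)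
  obtain ⟨β, hβ, hβ'⟩ := exists_rat_btwn (lt_add_of_pos_right y hδ')
  refine ⟨α, β, hα', hβ, fun z hz => ?_⟩
  rcases lt_or_ge z x with hzx | hzx
  · exact hsub (by rw [Metric.mem_ball, Real.dist_eq, abs_lt]; constructor <;> linarith [hz.1])
  rcases le_or_gt z y with hzy | hzy
  · exact h ⟨hzx, hzy⟩
  · exact hsub' (by rw [Metric.mem_ball, Real.dist_eq, abs_lt]; constructor <;> linarith [hz.2])

/-- For almost every pair `x < y` with `[x, y] ⊆ Ω` the increment of `w` over `[x, y]` is the mass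
of its derivative on `(x, y]`. -/
theorem HasWeakDeriv.ae_sub_eq {w : ℝ → ℝ} {Ω : Set ℝ} (hΩ : IsOpen Ω) {g : ℝ → ℝ}
    {S T : Measure ℝ} [IsFiniteMeasure S] [IsFiniteMeasure T] (h : HasWeakDeriv w Ω g S T) :
    ∀ᵐ p : ℝ × ℝ, p ∈ segs Ω →
      w p.2 - w p.1 = (∫ t in Ioc p.1 p.2, g t) + S.real (Ioc p.1 p.2) - T.real (Ioc p.1 p.2) := by
  have hae := ae_forall_Icc_tendsto h.locallyIntegrableOn
  have hfst : ∀ᵐ p : ℝ × ℝ, _ := Measure.quasiMeasurePreserving_fst.ae hae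
  have hsnd : ∀ᵐ p : ℝ × ℝ, _ := Measure.quasiMeasurePreserving_snd.ae hae
  filter_upwards [hfst, hsnd]
  rintro ⟨x, y⟩ hx hy ⟨hxy, hsub⟩
  simp only at hx hy hxy hsub ⊢
  obtain ⟨α, β, hα, hβ, hαβ⟩ := exists_rat_Icc_subset hΩ hxy.le hsub
  set f := (Icc (α : ℝ) β).indicator w with hf
  have hfint : Integrable f := (integrable_indicator_iff measurableSet_Icc).2
    (h.locallyIntegrableOn.integrableOn_compact_subset hαβ isCompact_Icc)
  have hlim := (hx α β hαβ).sub (hy α β hαβ)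
  rw [indicator_of_mem (by constructor <;> linarith : x ∈ Icc (α : ℝ) β),
    indicator_of_mem (by constructor <;> linarith : y ∈ Icc (α : ℝ) β)] at hlim
  have hlim' := ((tendsto_integral_smoothStep_sub hxy volume h.integrable).add
    (tendsto_integral_smoothStep_sub hxy S (integrable_const 1))).sub
    (tendsto_integral_smoothStep_sub hxy T (integrable_const 1))
  simp only [mul_one, integral_const, measureReal_restrict_apply_univ, smul_eq_mul] at hlim'
  have heq : ∀ᶠ n in atTop, (∫ t, f t * deriv (smoothStep n x) t)
      - ∫ t, f t * deriv (smoothStep n y) t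
      = -((∫ t, (smoothStep n x t - smoothStep n y t) * g t)
        + (∫ t, smoothStep n x t - smoothStep n y t ∂S)
        - ∫ t, smoothStep n x t - smoothStep n y t ∂T) := by
    filter_upwards [tendsto_one_div_add_atTop_nhds_zero_nat.eventually_lt_const
      (sub_pos.2 hβ)] with n hn
    have hzero : ∀ t ∉ Icc x (y + 1 / ((n : ℝ) + 1)),
        smoothStep n x t - smoothStep n y t = 0 := by
      intro t ht
      rw [mem_Icc, not_and_or, not_le, not_le] at ht
      rcases ht with ht | ht
      · rw [smoothStep_of_le ht.le, smoothStep_of_le (ht.le.trans hxy.le), sub_self]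
      · rw [smoothStep_of_ge ht.le, smoothStep_of_ge (by linarith), sub_self]
    have htsupp : tsupport (fun t => smoothStep n x t - smoothStep n y t)
        ⊆ Icc x (y + 1 / ((n : ℝ) + 1)) := by
      refine closure_minimal (fun t ht => ?_) isClosed_Icc
      by_contra hcon
      exact ht (hzero t hcon)
    have hIcc : Icc x (y + 1 / ((n : ℝ) + 1)) ⊆ Icc (α : ℝ) β :=
      Icc_subset_Icc hα.le (by linarith)
    have hd : ∀ t, deriv (fun t => smoothStep n x t - smoothStep n y t) t
        = deriv (smoothStep n x) t - deriv (smoothStep n y) t := fun t =>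
      deriv_fun_sub ((contDiff_smoothStep n x).differentiable one_ne_zero t)
        ((contDiff_smoothStep n y).differentiable one_ne_zero t)
    rw [← h.integral_eq _ ((contDiff_smoothStep n x).sub (contDiff_smoothStep n y))
      (HasCompactSupport.intro isCompact_Icc hzero) (htsupp.trans (hIcc.trans hαβ)),
      ← integral_sub (integrable_mul_deriv_smoothStep hfint.locallyIntegrable n x)
        (integrable_mul_deriv_smoothStep hfint.locallyIntegrable n y),
      ← integral_indicator hΩ.measurableSet]
    refine integral_congr_ae (Eventually.of_forall fun t => ?_)
    simp only [← mul_sub, ← hd t]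
    by_cases ht : t ∈ Icc (α : ℝ) β
    · rw [hf, indicator_of_mem ht, indicator_of_mem (hαβ ht)]
    · have h0 : deriv (fun t => smoothStep n x t - smoothStep n y t) t = 0 :=
        image_eq_zero_of_notMem_tsupport fun h' =>
          ht (hIcc (htsupp (tsupport_deriv_subset h')))
      rw [h0, mul_zero]
      exact (indicator_apply_eq_zero.2 fun _ => by rw [h0, mul_zero]).symm
  have := tendsto_nhds_unique (hlim.congr' heq) hlim'.neg
  linarith

/-! ### The area integrand and its conjugate -/

/-- The gap in Young's inequality `f g ≤ √(1 + g²) - √(1 - f²)` between the area integrand and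
its convex conjugate. For `|f| < 1` it vanishes exactly if
`g = f / √(1 - f²)`. -/
def areaGap (g f : ℝ) : ℝ := √(1 + g ^ 2) - f * g - √(1 - f ^ 2)

theorem sq_le_one_of_abs_le_one {f : ℝ} (hf : |f| ≤ 1) : f ^ 2 ≤ 1 := by
  rwa [sq_le_one_iff_abs_le_one]

theorem one_le_sqrt_one_add_sq (g : ℝ) : 1 ≤ √(1 + g ^ 2) := by
  rw [Real.one_le_sqrt]; nlinarith [sq_nonneg g]

theorem sqrt_one_add_sq_le (g : ℝ) : √(1 + g ^ 2) ≤ 1 + |g| := by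
  rw [Real.sqrt_le_left (by positivity)]
  nlinarith [sq_abs g, abs_nonneg g]

theorem sqrt_one_sub_sq_le_one (f : ℝ) : √(1 - f ^ 2) ≤ 1 := by
  rw [Real.sqrt_le_one]; nlinarith [sq_nonneg f]

theorem areaGap_nonneg (g : ℝ) {f : ℝ} (hf : |f| ≤ 1) : 0 ≤ areaGap g f := by
  have hf' := sq_le_one_of_abs_le_one hf
  have hs := Real.sq_sqrt (sub_nonneg.2 hf')
  have : f * g + √(1 - f ^ 2) ≤ √(1 + g ^ 2) := by
    refine Real.le_sqrt_of_sq_le ?_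
    nlinarith [sq_nonneg (g * √(1 - f ^ 2) - f)]
  unfold areaGap; linarith

theorem sq_le_areaGap (g : ℝ) {f : ℝ} (hf : |f| ≤ 1) :
    (g * √(1 - f ^ 2) - f) ^ 2 ≤ 2 * √(1 + g ^ 2) * areaGap g f := by
  have h0 := areaGap_nonneg g hf
  have hf' := sq_le_one_of_abs_le_one hf
  have hs := Real.sq_sqrt (sub_nonneg.2 hf')
  have hq := Real.sq_sqrt (show 0 ≤ 1 + g ^ 2 by positivity)
  have h1 : (g * √(1 - f ^ 2) - f) ^ 2
      = (√(1 + g ^ 2) + (f * g + √(1 - f ^ 2))) * areaGap g f := by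
    unfold areaGap
    linear_combination (g ^ 2 + 1) * hs - hq
  rw [h1]
  refine mul_le_mul_of_nonneg_right ?_ h0
  unfold areaGap at h0
  linarith

/-- Where `f` stays away from `±1`, the gap controls the distance of `g` to its zero. The gap is
quadratic near this zero and linear at infinity, so a linear estimate needs the additive `κ`. -/
theorem exists_abs_sub_le_areaGap {a κ : ℝ} (ha : a ∈ Ioo (0 : ℝ) 1) (hκ : 0 < κ) :
    ∃ C : ℝ, 0 ≤ C ∧ ∀ g f : ℝ, |f| ≤ a → |g - f / √(1 - f ^ 2)| ≤ κ + C * areaGap g f := by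
  have ha2 : 0 < 1 - a ^ 2 := by nlinarith [ha.1, ha.2]
  set s₀ := √(1 - a ^ 2) with hs₀
  have hs₀0 : 0 < s₀ := Real.sqrt_pos.2 ha2
  refine ⟨2 / s₀ ^ 2 * (1 + (1 + 1 / s₀) / κ), by positivity, fun g f hf => ?_⟩
  have hf1 : |f| ≤ 1 := hf.trans ha.2.le
  have he := areaGap_nonneg g hf1
  have hfa : f ^ 2 ≤ a ^ 2 := by rw [← sq_abs f]; gcongr
  set s := √(1 - f ^ 2) with hs
  have hss : s₀ ≤ s := Real.sqrt_le_sqrt (by linarith)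
  have hs0 : 0 < s := hs₀0.trans_le hss
  set d := |g - f / s| with hd
  have hd0 : 0 ≤ d := abs_nonneg _
  rcases le_or_gt d κ with hdκ | hdκ
  · have : 0 ≤ 2 / s₀ ^ 2 * (1 + (1 + 1 / s₀) / κ) * areaGap g f := by positivity
    linarith
  have hd' : 0 < d := hκ.trans hdκ
  have h1 := sq_le_areaGap g hf1
  have h2 : g * s - f = s * (g - f / s) := by field_simp
  rw [← hs, h2, mul_pow, ← sq_abs (g - f / s), ← hd] at h1
  have hψ : |f / s| ≤ 1 / s₀ := by
    rw [abs_div, abs_of_pos hs0]; gcongr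
  have hg : |g| ≤ d + 1 / s₀ := by
    have := abs_sub_abs_le_abs_sub g (f / s)
    linarith
  have h3 : s₀ ^ 2 * d ^ 2 ≤ 2 * (1 + (d + 1 / s₀)) * areaGap g f := by
    calc s₀ ^ 2 * d ^ 2 ≤ s ^ 2 * d ^ 2 := by gcongr
      _ ≤ _ := h1
      _ ≤ _ := by
        gcongr
        linarith [sqrt_one_add_sq_le g]
  have h4 : 1 + (d + 1 / s₀) ≤ d * (1 + (1 + 1 / s₀) / κ) := by
    have : 1 + 1 / s₀ ≤ d * ((1 + 1 / s₀) / κ) := by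
      rw [mul_div_assoc', le_div_iff₀ hκ, mul_comm]
      gcongr
    linarith
  have h5 : d * (s₀ ^ 2 * d) ≤ d * (2 * (1 + (1 + 1 / s₀) / κ) * areaGap g f) := by
    calc d * (s₀ ^ 2 * d) = s₀ ^ 2 * d ^ 2 := by ring
      _ ≤ _ := h3
      _ ≤ 2 * (d * (1 + (1 + 1 / s₀) / κ)) * areaGap g f := by gcongr
      _ = _ := by ring
  have h6 := le_of_mul_le_mul_left h5 hd'
  have h7 : d ≤ 2 / s₀ ^ 2 * (1 + (1 + 1 / s₀) / κ) * areaGap g f := by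
    rw [div_mul_eq_mul_div, div_mul_eq_mul_div, le_div_iff₀ (by positivity)]
    linarith
  linarith

/-- For bounded slopes the gap is bounded below when `f` is close to `±1`: bounded slopes
correspond to values of `f` away from `±1`. -/
theorem exists_one_le_areaGap {m : ℝ} (hm : 0 ≤ m) :
    ∃ a ∈ Ioo (0 : ℝ) 1, ∃ C : ℝ, 0 ≤ C ∧
      ∀ g f : ℝ, |g| ≤ m → a ≤ |f| → |f| ≤ 1 → 1 ≤ C * areaGap g f := by
  have hlim : Tendsto (fun a : ℝ => a - m * √(1 - a ^ 2)) (𝓝[<] 1) (𝓝 1) := by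
    have : Tendsto (fun a : ℝ => a - m * √(1 - a ^ 2)) (𝓝 1) (𝓝 (1 - m * √(1 - 1 ^ 2))) :=
      Continuous.tendsto (by fun_prop) 1
    simp only [one_pow, sub_self, Real.sqrt_zero, mul_zero, sub_zero] at this
    exact this.mono_left nhdsWithin_le_nhds
  obtain ⟨a, ha, ha01⟩ := ((hlim.eventually_const_lt (show (0 : ℝ) < 1 by norm_num)).and
    (Ioo_mem_nhdsLT (show (0 : ℝ) < 1 by norm_num))).exists
  set c := a - m * √(1 - a ^ 2) with hc
  refine ⟨a, ha01, 2 * √(1 + m ^ 2) / c ^ 2, by positivity, fun g f hg hfa hf => ?_⟩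
  have he := areaGap_nonneg g hf
  have h1 := sq_le_areaGap g hf
  have hs : √(1 - f ^ 2) ≤ √(1 - a ^ 2) := by
    refine Real.sqrt_le_sqrt ?_
    have : a ^ 2 ≤ |f| ^ 2 := pow_le_pow_left₀ ha01.1.le hfa 2
    rw [sq_abs] at this
    linarith
  have h2 : c ≤ |g * √(1 - f ^ 2) - f| := by
    have h3 := abs_sub_abs_le_abs_sub f (g * √(1 - f ^ 2))
    rw [abs_sub_comm, abs_mul, abs_of_nonneg (Real.sqrt_nonneg (1 - f ^ 2))] at h3
    have h4 : |g| * √(1 - f ^ 2) ≤ m * √(1 - a ^ 2) := by gcongr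
    linarith
  have h3 : c ^ 2 ≤ 2 * √(1 + m ^ 2) * areaGap g f := by
    calc c ^ 2 ≤ |g * √(1 - f ^ 2) - f| ^ 2 := by gcongr
      _ = (g * √(1 - f ^ 2) - f) ^ 2 := sq_abs _
      _ ≤ _ := h1
      _ ≤ _ := by
        have : √(1 + g ^ 2) ≤ √(1 + m ^ 2) := by
          refine Real.sqrt_le_sqrt ?_
          have : |g| ^ 2 ≤ m ^ 2 := by gcongr
          rw [sq_abs] at this
          linarith
        gcongr
  rw [div_mul_eq_mul_div, le_div_iff₀ (by positivity), one_mul]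
  exact h3

/-- A slope of the sign opposite to that of `f` is paid for by the gap. -/
theorem mul_neg_le_areaGap {g f b : ℝ} (hb : 0 ≤ b) (hfb : b ≤ f) (hf : f ≤ 1) :
    b * max (-g) 0 ≤ areaGap g f := by
  have h0 := areaGap_nonneg g (f := f) (by rw [abs_le]; constructor <;> linarith)
  rcases le_or_gt 0 g with hg | hg
  · rwa [max_eq_right (by linarith), mul_zero]
  · rw [max_eq_left (by linarith)]
    have h1 := one_le_sqrt_one_add_sq g
    have h2 := sqrt_one_sub_sq_le_one f
    unfold areaGap
    nlinarith

theorem areaGap_neg (g f : ℝ) : areaGap (-g) (-f) = areaGap g f := by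
  simp [areaGap]

/-- The Hölder continuity of `√(1 - f²)` with exponent `1 / 2`, in a form that is linear in
`|f - f₀|` and hence can be integrated. -/
theorem abs_sub_sqrt_le {f f₀ δ : ℝ} (hf : |f| ≤ 1) (hf₀ : |f₀| ≤ 1) (hδ : 0 < δ) :
    √(1 - f₀ ^ 2) - √(1 - f ^ 2) ≤ δ + |f - f₀| / δ := by
  have h1 : √(1 - f₀ ^ 2) ≤ √(1 - f ^ 2) + √(2 * |f - f₀|) := by
    have h2 : 1 - f₀ ^ 2 ≤ 1 - f ^ 2 + 2 * |f - f₀| := by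
      rw [abs_le] at hf hf₀
      rcases le_total f f₀ with h | h
      · rw [abs_of_nonpos (by linarith)]; nlinarith
      · rw [abs_of_nonneg (by linarith)]; nlinarith
    refine Real.sqrt_le_iff.2 ⟨by positivity, ?_⟩
    have hs := Real.sq_sqrt (sub_nonneg.2 (sq_le_one_of_abs_le_one hf))
    have ht := Real.sq_sqrt (show 0 ≤ 2 * |f - f₀| by positivity)
    have hst := mul_nonneg (Real.sqrt_nonneg (1 - f ^ 2)) (Real.sqrt_nonneg (2 * |f - f₀|))
    rw [add_sq, hs, ht]
    linarith
  have h2 : √(2 * |f - f₀|) ≤ δ + |f - f₀| / δ := by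
    refine Real.sqrt_le_iff.2 ⟨by positivity, ?_⟩
    have : (δ + |f - f₀| / δ) ^ 2 = δ ^ 2 + 2 * |f - f₀| + (|f - f₀| / δ) ^ 2 := by
      field_simp; ring
    rw [this]
    nlinarith [sq_nonneg δ, sq_nonneg (|f - f₀| / δ)]
  linarith

theorem areaGap_self (g : ℝ) : areaGap g (g / √(1 + g ^ 2)) = 0 := by
  have hq0 : 0 < √(1 + g ^ 2) := by positivity
  have hq := Real.sq_sqrt (show 0 ≤ 1 + g ^ 2 by positivity)
  have h1 : 1 - (g / √(1 + g ^ 2)) ^ 2 = (1 / √(1 + g ^ 2)) ^ 2 := by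
    field_simp; linarith
  unfold areaGap
  rw [h1, Real.sqrt_sq (by positivity)]
  field_simp
  linarith

theorem abs_div_sqrt_le_one (g : ℝ) : |g / √(1 + g ^ 2)| ≤ 1 := by
  rw [abs_div, abs_of_nonneg (Real.sqrt_nonneg _)]
  refine div_le_one_of_le₀ ?_ (Real.sqrt_nonneg _)
  rw [← Real.sqrt_sq_eq_abs]
  exact Real.sqrt_le_sqrt (by linarith)

/-- The gap is small if `f` is close to the value `g / √(1 + g²)` at which it vanishes. -/
theorem areaGap_le {g f f₀ δ : ℝ} (hf : |f| ≤ 1) (hf₀ : f₀ = g / √(1 + g ^ 2)) (hδ : 0 < δ) :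
    areaGap g f ≤ |g| * |f - f₀| + δ + |f - f₀| / δ := by
  have h0 := areaGap_self g
  have h1 := abs_sub_sqrt_le hf (hf₀ ▸ abs_div_sqrt_le_one g : |f₀| ≤ 1) hδ
  rw [← hf₀] at h0
  have h2 : (f₀ - f) * g ≤ |g| * |f - f₀| := by
    rw [← abs_mul, ← abs_neg]
    refine le_trans (le_of_eq ?_) (le_abs_self _)
    ring
  unfold areaGap at h0 ⊢
  linarith

theorem areaGap_zero_right_le (g : ℝ) : areaGap g 0 ≤ |g| := by
  have := sqrt_one_add_sq_le g
  simp only [areaGap, zero_mul, sub_zero, ne_eq, OfNat.ofNat_ne_zero, not_false_eq_true, zero_pow,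
    Real.sqrt_one]
  linarith

/-! ### The excess area and its duality defect -/

/-- The defect, for the test function `φ`, in the dual representation of the excess area of a
function with derivative `g dx + S - T`. -/
def dualGap (Ω : Set ℝ) (g : ℝ → ℝ) (S T : Measure ℝ) (φ : ℝ → ℝ) : ℝ≥0∞ :=
  (∫⁻ x in Ω, ENNReal.ofReal (areaGap (g x) (φ x)))
    + ((∫⁻ x in Ω, ENNReal.ofReal (1 - φ x) ∂S) + ∫⁻ x in Ω, ENNReal.ofReal (1 + φ x) ∂T)

/-- The excess area in `Ω` of a function with derivative `g dx + S - T`. -/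
def excessOf (Ω : Set ℝ) (g : ℝ → ℝ) (S T : Measure ℝ) : ℝ≥0∞ :=
  (∫⁻ x in Ω, ENNReal.ofReal (√(1 + g x ^ 2) - 1)) + (S Ω + T Ω)

theorem integrable_sqrt_sub_one {g : ℝ → ℝ} (hg : Measurable g) (hgi : Integrable g) :
    Integrable fun x => √(1 + g x ^ 2) - 1 := by
  refine hgi.mono (by fun_prop) (Eventually.of_forall fun x => ?_)
  rw [Real.norm_eq_abs, Real.norm_eq_abs, abs_of_nonneg (sub_nonneg.2 (one_le_sqrt_one_add_sq _))]
  linarith [sqrt_one_add_sq_le (g x)]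

theorem excessOf_ne_top {Ω : Set ℝ} {g : ℝ → ℝ} {S T : Measure ℝ} [IsFiniteMeasure S]
    [IsFiniteMeasure T] (hg : Measurable g) (hgi : Integrable g) : excessOf Ω g S T ≠ ∞ := by
  refine ENNReal.add_ne_top.2 ⟨?_, ENNReal.add_ne_top.2 ⟨measure_ne_top _ _, measure_ne_top _ _⟩⟩
  exact (integrable_sqrt_sub_one hg hgi).integrableOn.lintegral_lt_top.ne

theorem toReal_excessOf {Ω : Set ℝ} {g : ℝ → ℝ} {S T : Measure ℝ} [IsFiniteMeasure S]
    [IsFiniteMeasure T] (hg : Measurable g) (hgi : Integrable g) :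
    (excessOf Ω g S T).toReal = (∫ x in Ω, (√(1 + g x ^ 2) - 1)) + (S.real Ω + T.real Ω) := by
  unfold excessOf
  rw [← ofReal_integral_eq_lintegral_ofReal (integrable_sqrt_sub_one hg hgi).integrableOn
    (Eventually.of_forall fun x => sub_nonneg.2 (one_le_sqrt_one_add_sq _)),
    ENNReal.toReal_add ENNReal.ofReal_ne_top
      (ENNReal.add_ne_top.2 ⟨measure_ne_top _ _, measure_ne_top _ _⟩),
    ENNReal.toReal_add (measure_ne_top _ _) (measure_ne_top _ _), ENNReal.toReal_ofReal]
  · rfl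
  · exact integral_nonneg fun x => sub_nonneg.2 (one_le_sqrt_one_add_sq _)

/-- Integration by parts turns the defect into the excess area up to terms which are continuous
under convergence in `L¹_loc`. -/
theorem HasWeakDeriv.dualGap_eq {w : ℝ → ℝ} {Ω : Set ℝ} {g : ℝ → ℝ}
    {S T : Measure ℝ} [IsFiniteMeasure S] [IsFiniteMeasure T] (h : HasWeakDeriv w Ω g S T)
    {φ : ℝ → ℝ} (hφ : ContDiff ℝ 1 φ) (hφc : HasCompactSupport φ) (hφΩ : tsupport φ ⊆ Ω)
    (hφ1 : ∀ x, |φ x| ≤ 1) :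
    dualGap Ω g S T φ = ENNReal.ofReal ((excessOf Ω g S T).toReal
      + ((∫ x in Ω, w x * deriv φ x) + ∫ x in Ω, (1 - √(1 - φ x ^ 2)))) := by
  have hcont := hφ.continuous
  have hi1 := (integrable_sqrt_sub_one h.measurable h.integrable).integrableOn (s := Ω)
  have hi2 : Integrable (fun x => φ x * g x) := by
    refine h.integrable.norm.mono (by have := h.measurable; fun_prop)
      (Eventually.of_forall fun x => ?_)
    rw [norm_mul, norm_norm]
    exact mul_le_of_le_one_left (norm_nonneg _) (hφ1 x)
  have hi3 : Integrable (fun x => 1 - √(1 - φ x ^ 2)) := by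
    refine Continuous.integrable_of_hasCompactSupport (by fun_prop) ?_
    exact hφc.comp_left (g := fun y => 1 - √(1 - y ^ 2)) (by simp)
  have hiφ : ∀ (μ : Measure ℝ) [IsFiniteMeasure μ], Integrable φ μ := fun μ _ =>
    hcont.integrable_of_hasCompactSupport hφc
  have hsupp : ∀ x ∉ Ω, φ x = 0 := fun x hx =>
    image_eq_zero_of_notMem_tsupport fun h' => hx (hφΩ h')
  have hres : ∀ μ : Measure ℝ, ∫ x in Ω, φ x ∂μ = ∫ x, φ x ∂μ := fun μ =>
    setIntegral_eq_integral_of_forall_compl_eq_zero hsupp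
  have hresg : ∫ x in Ω, φ x * g x = ∫ x, φ x * g x :=
    setIntegral_eq_integral_of_forall_compl_eq_zero fun x hx => by rw [hsupp x hx, zero_mul]
  have hS : (∫⁻ x in Ω, ENNReal.ofReal (1 - φ x) ∂S)
      = ENNReal.ofReal (S.real Ω - ∫ x, φ x ∂S) := by
    have hi : Integrable (fun x => 1 - φ x) S := (integrable_const 1).sub (hiφ S)
    rw [← ofReal_integral_eq_lintegral_ofReal hi.integrableOn
      (Eventually.of_forall fun x => sub_nonneg.2 (abs_le.1 (hφ1 x)).2),
      ← hres S, integral_sub (integrable_const 1) (hiφ S).integrableOn, integral_const]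
    simp
  have hT : (∫⁻ x in Ω, ENNReal.ofReal (1 + φ x) ∂T)
      = ENNReal.ofReal (T.real Ω + ∫ x, φ x ∂T) := by
    have hi : Integrable (fun x => 1 + φ x) T := (integrable_const 1).add (hiφ T)
    rw [← ofReal_integral_eq_lintegral_ofReal hi.integrableOn
      (Eventually.of_forall fun x => by
        have := (abs_le.1 (hφ1 x)).1
        simp only [Pi.zero_apply]
        linarith),
      ← hres T, integral_add (integrable_const 1) (hiφ T).integrableOn, integral_const]
    simp
  have hi12 : IntegrableOn (fun x => √(1 + g x ^ 2) - 1 - φ x * g x) Ω :=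
    hi1.sub hi2.integrableOn
  have hG : (∫⁻ x in Ω, ENNReal.ofReal (areaGap (g x) (φ x)))
      = ENNReal.ofReal ((∫ x in Ω, (√(1 + g x ^ 2) - 1)) - (∫ x, φ x * g x)
        + ∫ x in Ω, (1 - √(1 - φ x ^ 2))) := by
    have heq : ∀ x, areaGap (g x) (φ x)
        = (√(1 + g x ^ 2) - 1) - φ x * g x + (1 - √(1 - φ x ^ 2)) := by
      intro x; unfold areaGap; ring
    rw [← ofReal_integral_eq_lintegral_ofReal _
      (Eventually.of_forall fun x => areaGap_nonneg _ (hφ1 x))]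
    · simp_rw [heq]
      rw [integral_add hi12 hi3.integrableOn,
        integral_sub hi1 hi2.integrableOn, hresg]
    · simp_rw [heq]
      exact hi12.add hi3.integrableOn
  have hn1 : 0 ≤ S.real Ω - ∫ x, φ x ∂S := by
    rw [← hres S, sub_nonneg]
    calc ∫ x in Ω, φ x ∂S ≤ ∫ _ in Ω, (1 : ℝ) ∂S :=
          integral_mono (hiφ S).integrableOn (integrable_const 1) fun x => (abs_le.1 (hφ1 x)).2
      _ = S.real Ω := by simp
  have hn2 : 0 ≤ T.real Ω + ∫ x, φ x ∂T := by
    rw [← hres T]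
    have : ∫ _ in Ω, (-1 : ℝ) ∂T ≤ ∫ x in Ω, φ x ∂T :=
      integral_mono (integrable_const _) (hiφ T).integrableOn fun x => (abs_le.1 (hφ1 x)).1
    simp at this
    linarith
  have hn3 : 0 ≤ (∫ x in Ω, (√(1 + g x ^ 2) - 1)) - (∫ x, φ x * g x)
        + ∫ x in Ω, (1 - √(1 - φ x ^ 2)) := by
    rw [← hresg, ← integral_sub hi1 hi2.integrableOn,
      ← integral_add hi12 hi3.integrableOn]
    refine integral_nonneg fun x => ?_
    have := areaGap_nonneg (g x) (hφ1 x)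
    unfold areaGap at this
    simp only [Pi.zero_apply]
    linarith
  unfold dualGap
  rw [hS, hT, hG, ← ENNReal.ofReal_add hn1 hn2, ← ENNReal.ofReal_add hn3 (add_nonneg hn1 hn2),
    toReal_excessOf h.measurable h.integrable, h.integral_eq φ hφ hφc hφΩ]
  congr 1
  ring

theorem TendstoL1loc.tendsto_integral_mul {v : ℝ → ℝ → ℝ} {u : ℝ → ℝ} {Ω : Set ℝ}
    (h : TendstoL1loc v u Ω) {ψ : ℝ → ℝ} (hψ : Continuous ψ) (hψc : HasCompactSupport ψ)
    (hψΩ : tsupport ψ ⊆ Ω) :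
    Tendsto (fun lam => ∫ x in Ω, v lam x * ψ x) atTop (𝓝 (∫ x in Ω, u x * ψ x)) := by
  obtain ⟨C, hC⟩ := hψ.bounded_above_of_compact_support hψc
  have hint : ∀ w : ℝ → ℝ, LocallyIntegrableOn w Ω → Integrable fun x => w x * ψ x := by
    intro w hw
    rw [← integrableOn_iff_integrable_of_support_subset (s := tsupport ψ)]
    · exact (hw.integrableOn_compact_subset hψΩ hψc).mul_continuousOn hψ.continuousOn hψc
    · exact (Function.support_mul_subset_right w ψ).trans (subset_tsupport ψ)
  refine tendsto_integral_of_L1 _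
    (hint u h.locallyIntegrableOn_limit).integrableOn.aestronglyMeasurable ?_ ?_
  · filter_upwards [eventually_gt_atTop 0] with lam hlam
    exact (hint _ (h.locallyIntegrableOn lam hlam)).integrableOn
  · have hlim := ENNReal.Tendsto.const_mul (a := ‖C‖ₑ) (h.tendsto _ hψc hψΩ)
      (Or.inr enorm_ne_top)
    rw [mul_zero] at hlim
    refine tendsto_of_tendsto_of_tendsto_of_le_of_le tendsto_const_nhds hlim
      (fun _ => zero_le) fun lam => ?_
    simp only
    rw [← lintegral_const_mul' _ _ enorm_ne_top]
    calc ∫⁻ x in Ω, ‖v lam x * ψ x - u x * ψ x‖ₑ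
        ≤ ∫⁻ x, ‖v lam x * ψ x - u x * ψ x‖ₑ := setLIntegral_le_lintegral _ _
      _ = ∫⁻ x in tsupport ψ, ‖v lam x * ψ x - u x * ψ x‖ₑ := by
        refine (setLIntegral_eq_of_support_subset fun x hx => ?_).symm
        by_contra hcon
        exact hx (by simp [image_eq_zero_of_notMem_tsupport hcon])
      _ ≤ ∫⁻ x in tsupport ψ, ‖C‖ₑ * ‖v lam x - u x‖ₑ := by
        refine lintegral_mono fun x => ?_
        rw [← sub_mul, enorm_mul, mul_comm]
        gcongr
        exact enorm_le_iff_norm_le.2 ((hC x).trans (le_abs_self C))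

theorem lintegral_add_ofReal_neg {g : ℝ → ℝ} (hg : Measurable g) (s : Set ℝ) :
    (∫⁻ x in s, ENNReal.ofReal (g x)) + ∫⁻ x in s, ENNReal.ofReal (-g x)
      = ∫⁻ x in s, ENNReal.ofReal |g x| := by
  rw [← lintegral_add_left (by fun_prop)]
  refine lintegral_congr fun x => ?_
  rcases le_total 0 (g x) with h | h
  · rw [abs_of_nonneg h, ENNReal.ofReal_of_nonpos (neg_nonpos.2 h), add_zero]
  · rw [abs_of_nonpos h, ENNReal.ofReal_of_nonpos h, zero_add]

theorem totalVariation_Da (u : ℝ → ℝ) (Ω : Set ℝ) {s : Set ℝ} (hs : MeasurableSet s) :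
    (Da u Ω).totalVariation s = ∫⁻ x in s, ENNReal.ofReal |grad u Ω x| := by
  have hg : Measurable (grad u Ω) := SignedMeasure.measurable_rnDeriv _ _
  have hgi : Integrable (grad u Ω) := SignedMeasure.integrable_rnDeriv _ _
  have h := SignedMeasure.toJordanDecomposition_eq_of_eq_add_withDensity (s := Da u Ω)
    (t := 0) (μ := volume) hg hgi VectorMeasure.MutuallySingular.zero_left
    (by rw [zero_add]; rfl)
  rw [SignedMeasure.totalVariation, h]
  simp only [SignedMeasure.toJordanDecomposition_zero, JordanDecomposition.zero_posPart,
    JordanDecomposition.zero_negPart, zero_add, Measure.add_apply, withDensity_apply _ hs]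
  exact lintegral_add_ofReal_neg hg s

theorem integral_withDensity_ofReal {φ g : ℝ → ℝ} (hg : Measurable g) :
    ∫ x, φ x ∂volume.withDensity (fun x => ENNReal.ofReal (g x)) = ∫ x, max (g x) 0 * φ x := by
  rw [integral_withDensity_eq_integral_toReal_smul (by fun_prop)
    (Eventually.of_forall fun x => ENNReal.ofReal_lt_top)]
  simp only [ENNReal.toReal_ofReal', smul_eq_mul]

/-- The Lebesgue decomposition of `Du` together with the Jordan decomposition of `D^s u` puts the
derivative into the form `g dx + S - T`. -/
theorem hasWeakDeriv_of_memBVdot {u : ℝ → ℝ} {Ω : Set ℝ} (h : MemBVdot u Ω) :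
    HasWeakDeriv u Ω (grad u Ω) (Ds u Ω).toJordanDecomposition.posPart
      (Ds u Ω).toJordanDecomposition.negPart := by
  have hg : Measurable (grad u Ω) := SignedMeasure.measurable_rnDeriv _ _
  have hgi : Integrable (grad u Ω) := SignedMeasure.integrable_rnDeriv _ _
  have hD : IsDistribDeriv u Ω (D u Ω) := by
    unfold D
    rw [dif_pos h.exists_deriv]
    exact h.exists_deriv.choose_spec
  refine ⟨h.locallyIntegrableOn, hg, hgi, fun φ h1 h2 h3 => ?_⟩
  rw [hD.integral_eq φ h1 h2 h3]
  have hJ := SignedMeasure.toJordanDecomposition_eq_of_eq_add_withDensity (s := D u Ω)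
    (t := Ds u Ω) (μ := volume) hg hgi (SignedMeasure.mutuallySingular_singularPart _ _)
    (Ds_add_Da u Ω).symm
  have hφi : ∀ (μ : Measure ℝ) [IsFiniteMeasure μ], Integrable φ μ := fun μ _ =>
    h1.continuous.integrable_of_hasCompactSupport h2
  have := isFiniteMeasure_withDensity_ofReal hgi.2
  have : IsFiniteMeasure (volume.withDensity fun x => ENNReal.ofReal (-grad u Ω x)) :=
    isFiniteMeasure_withDensity_ofReal hgi.neg.2
  obtain ⟨C, hC⟩ := h1.continuous.bounded_above_of_compact_support h2
  have hpi : ∀ f : ℝ → ℝ, Integrable f → Integrable fun x => max (f x) 0 * φ x := fun f hf =>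
    hf.pos_part.mul_bdd (c := C) h1.continuous.aestronglyMeasurable (Eventually.of_forall hC)
  unfold signedIntegral
  rw [hJ]
  simp only
  rw [integral_add_measure (hφi _) (hφi _), integral_add_measure (hφi _) (hφi _),
    integral_withDensity_ofReal hg, integral_withDensity_ofReal (g := fun x => -grad u Ω x)
    (by fun_prop)]
  have hsub : ∫ x, φ x * grad u Ω x
      = (∫ x, max (grad u Ω x) 0 * φ x) - ∫ x, max (-grad u Ω x) 0 * φ x := by
    have hgn : Integrable fun x => -grad u Ω x := hgi.neg
    rw [← integral_sub (hpi _ hgi) (hpi _ hgn)]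
    refine integral_congr_ae (Eventually.of_forall fun x => ?_)
    simp only
    rw [← sub_mul, mul_comm]
    congr 1
    rcases le_total 0 (grad u Ω x) with h | h
    · rw [max_eq_left h, max_eq_right (by linarith), sub_zero]
    · rw [max_eq_right h, max_eq_left (by linarith)]; ring
  rw [hsub]
  ring

theorem excessArea_eq {u : ℝ → ℝ} {Ω : Set ℝ} (h : MemBVdot u Ω) :
    excessArea u Ω = excessOf Ω (grad u Ω) (Ds u Ω).toJordanDecomposition.posPart
      (Ds u Ω).toJordanDecomposition.negPart := by
  unfold excessArea excessOf
  rw [if_pos h, SignedMeasure.totalVariation, Measure.add_apply]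

theorem memBVdot_of_excessArea_ne_top {u : ℝ → ℝ} {Ω : Set ℝ} (h : excessArea u Ω ≠ ∞) :
    MemBVdot u Ω := by
  by_contra hcon
  exact h (by unfold excessArea; rw [if_neg hcon])

/-! ### Near-optimal test functions -/

theorem exists_ofReal_mul_le {c ε : ℝ≥0∞} (hc : c ≠ ∞) (hε : ε ≠ 0) :
    ∃ η : ℝ, 0 < η ∧ ENNReal.ofReal η * c ≤ ε := by
  rcases eq_or_ne ε ∞ with h | h
  · exact ⟨1, one_pos, by rw [h]; exact le_top⟩
  refine ⟨ε.toReal / (c.toReal + 1), div_pos (ENNReal.toReal_pos hε h) (by positivity), ?_⟩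
  rw [← ENNReal.ofReal_toReal hc, ← ENNReal.ofReal_mul (by positivity),
    ENNReal.toReal_ofReal ENNReal.toReal_nonneg]
  refine ENNReal.ofReal_le_of_le_toReal ?_
  rw [div_mul_eq_mul_div, div_le_iff₀ (by positivity)]
  nlinarith [ENNReal.toReal_nonneg (a := ε)]

theorem abs_clamp_sub_le {a b : ℝ} (ha : |a| ≤ 1) :
    |a - max (-1) (min 1 b)| ≤ |a - b| := by
  rw [abs_le] at ha
  rcases le_total b (-1) with h | h
  · rw [min_eq_right (by linarith), max_eq_left h, abs_of_nonneg (by linarith)]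
    exact (by linarith : a - -1 ≤ a - b).trans (le_abs_self _)
  rcases le_total b 1 with h' | h'
  · rw [min_eq_right h', max_eq_right h]
  · rw [min_eq_left h', max_eq_right (by linarith), abs_of_nonpos (by linarith)]
    exact (by linarith : -(a - 1) ≤ -(a - b)).trans (neg_le_abs _)

/-- Smooth approximation of a continuous function with compact support, without enlarging the
support or the bound. -/
theorem exists_contDiff_abs_sub_le {f : ℝ → ℝ} (hf : Continuous f) (hf1 : ∀ x, |f x| ≤ 1) {η : ℝ}
    (hη : 0 < η) : ∃ φ : ℝ → ℝ, ContDiff ℝ 1 φ ∧ (∀ x, |φ x| ≤ 1) ∧ (∀ x, |f x - φ x| ≤ η) ∧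
      ∀ x ∉ tsupport f, φ x = 0 := by
  set t : ℝ → Set ℝ := fun x => {y | |y| ≤ 1 ∧ |f x - y| ≤ η ∧ (x ∉ tsupport f → y = 0)} with ht
  have hconv : ∀ x, Convex ℝ (t x) := by
    intro x
    have h1 : Convex ℝ {y : ℝ | |y| ≤ 1} := by
      have : {y : ℝ | |y| ≤ 1} = Icc (-1) 1 := by ext; simp [abs_le]
      rw [this]; exact convex_Icc _ _
    have h2 : Convex ℝ {y : ℝ | |f x - y| ≤ η} := by
      have : {y : ℝ | |f x - y| ≤ η} = Icc (f x - η) (f x + η) := by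
        ext y
        simp only [mem_ofPred_eq, mem_Icc, abs_le]
        constructor <;> rintro ⟨h, h'⟩ <;> constructor <;> linarith
      rw [this]; exact convex_Icc _ _
    have h3 : Convex ℝ {y : ℝ | x ∉ tsupport f → y = 0} := by
      by_cases hx : x ∈ tsupport f
      · simp only [hx, not_true_eq_false, false_imp_iff]
        exact convex_univ
      · simp only [hx, not_false_eq_true, true_imp_iff]
        exact convex_singleton 0
    exact h1.inter (h2.inter h3)
  obtain ⟨φ, hφ⟩ := exists_contMDiffMap_forall_mem_convex_of_local_const (n := ⊤)
    (I := modelWithCornersSelf ℝ ℝ) (t := t) hconv (fun x => by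
      by_cases hx : f x = 0
      · refine ⟨0, ?_⟩
        have : ∀ᶠ y in 𝓝 x, |f y| < η := by
          have := hf.abs.tendsto x
          rw [hx, abs_zero] at this
          exact this.eventually_lt_const hη
        filter_upwards [this] with y hy
        exact ⟨by simp, by rw [sub_zero]; exact hy.le, fun _ => rfl⟩
      · refine ⟨f x, ?_⟩
        have h1 : ∀ᶠ y in 𝓝 x, |f y - f x| < η := by
          have := (hf.sub continuous_const).abs.tendsto (f := fun y => |f y - f x|) x
          rw [sub_self, abs_zero] at this
          exact this.eventually_lt_const hη
        filter_upwards [h1, hf.continuousAt.eventually_ne hx] with y hy hy'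
        exact ⟨hf1 x, hy.le, fun h => absurd (subset_tsupport f hy') h⟩)
  refine ⟨φ, (contMDiff_iff_contDiff.1 φ.contMDiff).of_le (by norm_num), fun x => (hφ x).1,
    fun x => (hφ x).2.1, fun x hx => (hφ x).2.2 hx⟩

/-- Smooth functions with compact support in `Ω` approximate every measurable function with values
in `[-1, 1]` in `L¹` of a finite measure, with the same bound. -/
theorem exists_contDiff_lintegral_sub_le {Ω : Set ℝ} (hΩ : IsOpen Ω) (m : Measure ℝ)
    [IsFiniteMeasure m] {f : ℝ → ℝ} (hf : Measurable f) (hf1 : ∀ x, |f x| ≤ 1) {ε : ℝ≥0∞}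
    (hε : ε ≠ 0) : ∃ φ : ℝ → ℝ, ContDiff ℝ 1 φ ∧ HasCompactSupport φ ∧ tsupport φ ⊆ Ω ∧
      (∀ x, |φ x| ≤ 1) ∧ ∫⁻ x in Ω, ‖f x - φ x‖ₑ ∂m ≤ ε := by
  have hε4 : ε / 4 ≠ 0 := ENNReal.div_ne_zero.2 ⟨hε, by simp⟩
  have hfi : Integrable f m := Integrable.of_bound hf.aestronglyMeasurable 1
    (Eventually.of_forall hf1)
  obtain ⟨f₁, -, hf₁, hf₁c, -⟩ := hfi.exists_hasCompactSupport_lintegral_sub_le hε4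
  set f₂ : ℝ → ℝ := fun x => max (-1) (min 1 (f₁ x)) with hf₂
  have hf₂c : Continuous f₂ := by fun_prop
  have hf₂1 : ∀ x, |f₂ x| ≤ 1 := fun x =>
    abs_le.2 ⟨le_max_left _ _, max_le (by norm_num) (min_le_left _ _)⟩
  obtain ⟨K, hKΩ, hK, hmK⟩ := hΩ.measurableSet.exists_isCompact_sdiff_lt (μ := m)
    (measure_ne_top _ _) hε4
  obtain ⟨χ, hχ1, hχc, hχ01, hχΩ⟩ : ∃ χ : C(ℝ, ℝ), EqOn χ 1 K ∧ HasCompactSupport χ ∧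
      (∀ x, χ x ∈ Icc (0 : ℝ) 1) ∧ tsupport χ ⊆ Ω := by
    obtain ⟨χ, h1, h2, h3, h4⟩ := exists_continuousMap_one_of_isCompact_subset_isOpen hK hΩ hKΩ
    exact ⟨χ, h1, h2, h4, h3⟩
  set f₃ : ℝ → ℝ := fun x => χ x * f₂ x with hf₃
  have hf₃c : Continuous f₃ := by fun_prop
  have hf₃1 : ∀ x, |f₃ x| ≤ 1 := fun x => by
    rw [hf₃, abs_mul, abs_of_nonneg (hχ01 x).1]
    exact mul_le_one₀ (hχ01 x).2 (abs_nonneg _) (hf₂1 x)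
  have hf₃s : tsupport f₃ ⊆ tsupport χ := closure_mono (Function.support_mul_subset_left _ _)
  obtain ⟨η, hη, hηm⟩ : ∃ η : ℝ, 0 < η ∧ ENNReal.ofReal η * m univ ≤ ε / 4 :=
    exists_ofReal_mul_le (measure_ne_top m univ) hε4
  obtain ⟨φ, hφ, hφ1, hφη, hφ0⟩ := exists_contDiff_abs_sub_le hf₃c hf₃1 hη
  have hφs : tsupport φ ⊆ tsupport χ := by
    refine (closure_minimal (fun x hx => ?_) (isClosed_tsupport f₃)).trans hf₃s
    by_contra hcon
    exact hx (hφ0 x hcon)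
  refine ⟨φ, hφ, hχc.of_isClosed_subset (isClosed_tsupport φ) hφs, hφs.trans hχΩ, hφ1, ?_⟩
  have hptK : ∀ x ∈ K, ‖f x - φ x‖ₑ ≤ ‖f x - f₁ x‖ₑ + ENNReal.ofReal η := by
    intro x hx
    have h1 : f₃ x = f₂ x := by simp only [hf₃, hχ1 hx, Pi.one_apply, one_mul]
    have h2 : |f x - φ x| ≤ |f x - f₁ x| + η := by
      have := abs_sub_le (f x) (f₃ x) (φ x)
      have h3 := abs_clamp_sub_le (b := f₁ x) (hf1 x)
      rw [h1] at this
      have h4 := hφη x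
      rw [h1] at h4
      linarith
    rw [← ofReal_norm, ← ofReal_norm, ← ENNReal.ofReal_add (norm_nonneg _) hη.le]
    exact ENNReal.ofReal_le_ofReal h2
  have hpt : ∀ x, ‖f x - φ x‖ₑ ≤ 2 := by
    intro x
    rw [← ofReal_norm, ← ENNReal.ofReal_ofNat]
    refine ENNReal.ofReal_le_ofReal ?_
    have := abs_sub (f x) (φ x)
    rw [Real.norm_eq_abs]
    linarith [hf1 x, hφ1 x]
  calc ∫⁻ x in Ω, ‖f x - φ x‖ₑ ∂m
      ≤ (∫⁻ x in K, ‖f x - φ x‖ₑ ∂m) + ∫⁻ x in Ω \ K, ‖f x - φ x‖ₑ ∂m := by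
        rw [← union_sdiff_cancel hKΩ]
        refine (lintegral_union_le _ _ _).trans ?_
        rw [union_sdiff_cancel hKΩ]
    _ ≤ (∫⁻ x in K, (‖f x - f₁ x‖ₑ + ENNReal.ofReal η) ∂m) + ∫⁻ x in Ω \ K, 2 ∂m :=
        add_le_add (setLIntegral_mono' hK.measurableSet hptK) (lintegral_mono fun x => hpt x)
    _ ≤ (∫⁻ x, (‖f x - f₁ x‖ₑ + ENNReal.ofReal η) ∂m) + 2 * m (Ω \ K) := by
        rw [setLIntegral_const]
        gcongr
        exact Measure.restrict_le_self
    _ ≤ (ε / 4 + ε / 4) + 2 * (ε / 4) := by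
        rw [lintegral_add_right _ measurable_const, lintegral_const]
        gcongr
    _ = ε := by
        rw [← two_mul, ← two_mul, ← mul_assoc]
        norm_num
        exact ENNReal.mul_div_cancel (by norm_num) (by norm_num)

theorem setLIntegral_le_add_sdiff {Ω J : Set ℝ} (hJ : MeasurableSet J) (μ : Measure ℝ)
    (f : ℝ → ℝ≥0∞) :
    ∫⁻ x in Ω, f x ∂μ ≤ (∫⁻ x in Ω ∩ J, f x ∂μ) + ∫⁻ x in Ω \ J, f x ∂μ :=
  (lintegral_inter_add_sdiff f Ω hJ).ge

theorem exists_measure_compl_Ioo_le (M : Measure ℝ) [IsFiniteMeasure M] {ε : ℝ≥0∞}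
    (hε : ε ≠ 0) : ∃ R : ℝ, 0 < R ∧ M (Ioo (-R) R)ᶜ ≤ ε := by
  obtain ⟨K, -, hK, hMK⟩ := MeasurableSet.univ.exists_isCompact_sdiff_lt (μ := M)
    (measure_ne_top _ _) hε
  obtain ⟨R, hR, hKR⟩ := hK.isBounded.subset_ball_lt 0 0
  have hsub : (Ioo (-R) R)ᶜ ⊆ univ \ K := fun x hx => ⟨mem_univ x, fun hxK => hx (by
    have := hKR hxK
    rwa [Real.ball_eq_Ioo, zero_sub, zero_add] at this)⟩
  exact ⟨R, hR, (measure_mono hsub).trans hMK.le⟩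

/-- The dual representation of the excess area: suitable test functions make the defect small.
They approximate `g / √(1 + g²)` almost everywhere and the sign of `S - T` on the singular part,
inside a bounded interval. -/
theorem exists_dualGap_le {Ω : Set ℝ} (hΩ : IsOpen Ω) {g : ℝ → ℝ} (hg : Measurable g)
    (hgi : Integrable g) {S T : Measure ℝ} [IsFiniteMeasure S] [IsFiniteMeasure T] (hST : S ⟂ₘ T)
    (hS : S ⟂ₘ volume) (hT : T ⟂ₘ volume) {ε : ℝ≥0∞} (hε : ε ≠ 0) :
    ∃ φ : ℝ → ℝ, ContDiff ℝ 1 φ ∧ HasCompactSupport φ ∧ tsupport φ ⊆ Ω ∧ (∀ x, |φ x| ≤ 1) ∧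
      dualGap Ω g S T φ ≤ ε := by
  have hε3 : ε / 3 ≠ 0 := ENNReal.div_ne_zero.2 ⟨hε, by simp⟩
  obtain ⟨s, hs, hSs, hTs⟩ := hST
  obtain ⟨s₁, hs₁, hSs₁, hs₁v⟩ := hS
  obtain ⟨s₂, hs₂, hTs₂, hs₂v⟩ := hT
  classical
  set f : ℝ → ℝ := (s₁ ∩ s₂).piecewise (fun x => g x / √(1 + g x ^ 2))
    (s.piecewise (fun _ => -1) fun _ => 1) with hf
  have hfm : Measurable f := Measurable.piecewise (hs₁.inter hs₂) (by fun_prop)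
    (Measurable.piecewise hs measurable_const measurable_const)
  have hf1 : ∀ x, |f x| ≤ 1 := by
    intro x
    by_cases hx : x ∈ s₁ ∩ s₂
    · rw [hf, piecewise_eq_of_mem _ _ _ hx]
      exact abs_div_sqrt_le_one _
    · rw [hf, piecewise_eq_of_notMem _ _ _ hx]
      by_cases hx' : x ∈ s
      · rw [piecewise_eq_of_mem _ _ _ hx']; norm_num
      · rw [piecewise_eq_of_notMem _ _ _ hx']; norm_num
  have hfv : ∀ᵐ x, f x = g x / √(1 + g x ^ 2) := by
    filter_upwards [measure_eq_zero_iff_ae_notMem.1 hs₁v, measure_eq_zero_iff_ae_notMem.1 hs₂v]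
      with x h1 h2
    exact piecewise_eq_of_mem _ _ _ ⟨not_not.1 h1, not_not.1 h2⟩
  have hfS : ∀ᵐ x ∂S, f x = 1 := by
    filter_upwards [measure_eq_zero_iff_ae_notMem.1 hSs₁, measure_eq_zero_iff_ae_notMem.1 hSs]
      with x h1 h2
    rw [hf, piecewise_eq_of_notMem _ _ _ fun h => h1 h.1, piecewise_eq_of_notMem _ _ _ h2]
  have hfT : ∀ᵐ x ∂T, f x = -1 := by
    filter_upwards [measure_eq_zero_iff_ae_notMem.1 hTs₂, measure_eq_zero_iff_ae_notMem.1 hTs]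
      with x h1 h2
    rw [hf, piecewise_eq_of_notMem _ _ _ fun h => h1 h.2,
      piecewise_eq_of_mem _ _ _ (not_not.1 h2)]
  set V : Measure ℝ := volume.withDensity fun x => ENNReal.ofReal |g x| with hV
  have : IsFiniteMeasure V := isFiniteMeasure_withDensity_ofReal hgi.abs.2
  obtain ⟨R, hR, htail⟩ := exists_measure_compl_Ioo_le (V + (S + T)) hε3
  set J := Ioo (-R) R with hJ
  obtain ⟨δ, hδ, hδR⟩ := exists_ofReal_mul_le (measure_Ioo_lt_top (μ := volume)
    (a := -R) (b := R)).ne hε3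
  obtain ⟨η, hη, hη'⟩ := exists_ofReal_mul_le (c := 1 + ENNReal.ofReal (1 / δ))
    (ENNReal.add_ne_top.2 ⟨ENNReal.one_ne_top, ENNReal.ofReal_ne_top⟩) hε3
  obtain ⟨φ, hφ, hφc, hφΩ, hφ1, hφm⟩ := exists_contDiff_lintegral_sub_le (hΩ.inter isOpen_Ioo)
    (V + (S + T) + volume.restrict J) hfm hf1 (ENNReal.ofReal_pos.2 hη).ne'
  have hφ0 : ∀ x ∉ J, φ x = 0 := fun x hx =>
    image_eq_zero_of_notMem_tsupport fun h => hx (hφΩ h).2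
  refine ⟨φ, hφ, hφc, hφΩ.trans inter_subset_left, hφ1, ?_⟩
  have hmeas : Measurable fun x => ‖f x - φ x‖ₑ := by
    have := hφ.continuous.measurable
    fun_prop
  have hJm : MeasurableSet J := measurableSet_Ioo
  have hsubJ : Ω \ J ⊆ Jᶜ := fun x hx => hx.2
  -- the error terms on `Ω ∩ J`
  set eV := ∫⁻ x in Ω ∩ J, ‖f x - φ x‖ₑ ∂V
  set eS := ∫⁻ x in Ω ∩ J, ‖f x - φ x‖ₑ ∂S
  set eT := ∫⁻ x in Ω ∩ J, ‖f x - φ x‖ₑ ∂T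
  set e0 := ∫⁻ x in Ω ∩ J, ‖f x - φ x‖ₑ
  have he : eV + (eS + eT) + e0 ≤ ENNReal.ofReal η := by
    refine le_trans (le_of_eq ?_) hφm
    rw [Measure.restrict_add, Measure.restrict_add, Measure.restrict_add, lintegral_add_measure,
      lintegral_add_measure, lintegral_add_measure, Measure.restrict_restrict
        (hΩ.measurableSet.inter hJm), inter_assoc, inter_self]
  have hIS : ∫⁻ x in Ω, ENNReal.ofReal (1 - φ x) ∂S ≤ eS + S Jᶜ := by
    refine (setLIntegral_le_add_sdiff hJm S _).trans (add_le_add ?_ ?_)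
    · refine lintegral_mono_ae ?_
      filter_upwards [ae_restrict_of_ae hfS] with x hx
      rw [hx, ← ofReal_norm]
      exact ENNReal.ofReal_le_ofReal (le_abs_self _)
    · calc _ = ∫⁻ _ in Ω \ J, 1 ∂S := by
            refine setLIntegral_congr_fun (hΩ.measurableSet.diff hJm) fun x hx => ?_
            rw [hφ0 x hx.2, sub_zero, ENNReal.ofReal_one]
        _ ≤ S Jᶜ := by rw [setLIntegral_one]; exact measure_mono hsubJ
  have hIT : ∫⁻ x in Ω, ENNReal.ofReal (1 + φ x) ∂T ≤ eT + T Jᶜ := by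
    refine (setLIntegral_le_add_sdiff hJm T _).trans (add_le_add ?_ ?_)
    · refine lintegral_mono_ae ?_
      filter_upwards [ae_restrict_of_ae hfT] with x hx
      rw [hx, ← ofReal_norm, Real.norm_eq_abs, ← abs_neg]
      refine ENNReal.ofReal_le_ofReal (le_trans (le_of_eq ?_) (le_abs_self _))
      ring
    · calc _ = ∫⁻ _ in Ω \ J, 1 ∂T := by
            refine setLIntegral_congr_fun (hΩ.measurableSet.diff hJm) fun x hx => ?_
            rw [hφ0 x hx.2, add_zero, ENNReal.ofReal_one]
        _ ≤ T Jᶜ := by rw [setLIntegral_one]; exact measure_mono hsubJ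
  have heV : eV = ∫⁻ x in Ω ∩ J, ENNReal.ofReal |g x| * ‖f x - φ x‖ₑ := by
    exact setLIntegral_withDensity_eq_setLIntegral_mul volume (by fun_prop) hmeas
      (hΩ.measurableSet.inter hJm)
  have hIg : ∫⁻ x in Ω, ENNReal.ofReal (areaGap (g x) (φ x))
      ≤ eV + ENNReal.ofReal δ * volume J + ENNReal.ofReal (1 / δ) * e0 + V Jᶜ := by
    refine (setLIntegral_le_add_sdiff hJm volume _).trans (add_le_add ?_ ?_)
    · have hle : ∀ᵐ x ∂volume.restrict (Ω ∩ J), ENNReal.ofReal (areaGap (g x) (φ x))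
          ≤ ENNReal.ofReal |g x| * ‖f x - φ x‖ₑ + ENNReal.ofReal δ
            + ENNReal.ofReal (1 / δ) * ‖f x - φ x‖ₑ := by
        filter_upwards [ae_restrict_of_ae hfv] with x hx
        have h := areaGap_le (hφ1 x) hx hδ
        rw [← ofReal_norm, ← ENNReal.ofReal_mul (abs_nonneg _),
          ← ENNReal.ofReal_mul (by positivity), ← ENNReal.ofReal_add (by positivity) hδ.le,
          ← ENNReal.ofReal_add (by positivity) (by positivity)]
        refine ENNReal.ofReal_le_ofReal (h.trans (le_of_eq ?_))
        rw [Real.norm_eq_abs, abs_sub_comm (f x)]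
        ring
      refine (lintegral_mono_ae hle).trans ?_
      rw [lintegral_add_right _ (by fun_prop), lintegral_add_right _ measurable_const, ← heV,
        setLIntegral_const, lintegral_const_mul _ hmeas]
      gcongr
      exact inter_subset_right
    · calc _ ≤ ∫⁻ x in Ω \ J, ENNReal.ofReal |g x| := by
            refine setLIntegral_mono' (hΩ.measurableSet.diff hJm) fun x hx => ?_
            rw [hφ0 x hx.2]
            exact ENNReal.ofReal_le_ofReal (areaGap_zero_right_le _)
        _ ≤ V Jᶜ := by
            rw [hV, withDensity_apply _ hJm.compl]
            exact lintegral_mono_set hsubJ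
  calc dualGap Ω g S T φ
      ≤ (eV + ENNReal.ofReal δ * volume J + ENNReal.ofReal (1 / δ) * e0 + V Jᶜ)
        + ((eS + S Jᶜ) + (eT + T Jᶜ)) := add_le_add hIg (add_le_add hIS hIT)
    _ = (eV + (eS + eT)) + ENNReal.ofReal (1 / δ) * e0 + ENNReal.ofReal δ * volume J
        + (V + (S + T)) Jᶜ := by
        simp only [Measure.add_apply]; ring
    _ ≤ ENNReal.ofReal η * (1 + ENNReal.ofReal (1 / δ)) + ε / 3 + ε / 3 := by
        gcongr
        rw [mul_add, mul_one, mul_comm (ENNReal.ofReal η)]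
        gcongr
        · exact le_self_add.trans he
        · exact le_add_self.trans he
    _ ≤ ε / 3 + ε / 3 + ε / 3 := by gcongr
    _ = ε := ENNReal.add_thirds ε

/-! ### The region of moderate slope -/

/-- The pairs `x < y` with `[x, y] ⊆ U` and `|w x - w y| > lam * |x - y| ^ (1 + γ)`. -/
def steepPairs (γ lam : ℝ) (w : ℝ → ℝ) (U : Set ℝ) : Set (ℝ × ℝ) :=
  {p ∈ segs U | lam * |p.1 - p.2| ^ (1 + γ) < |w p.1 - w p.2|}

/-- The slope `f / √(1 - f²)` at which `areaGap · f` vanishes, with `f` first truncated to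
`[-a, a]`. For `a < 1` this is a continuous function of `f`. -/
def truncSlope (a f : ℝ) : ℝ := max (-a) (min a f) / √(1 - max (-a) (min a f) ^ 2)

theorem truncSlope_of_abs_le {a f : ℝ} (h : |f| ≤ a) : truncSlope a f = f / √(1 - f ^ 2) := by
  rw [abs_le] at h
  rw [truncSlope, min_eq_right h.2, max_eq_right h.1]

theorem continuous_truncSlope {a : ℝ} (ha : a ∈ Ioo (0 : ℝ) 1) : Continuous (truncSlope a) := by
  unfold truncSlope
  refine Continuous.div (by fun_prop) (by fun_prop) fun f => (Real.sqrt_pos.2 ?_).ne'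
  have h1 : -a ≤ max (-a) (min a f) := le_max_left _ _
  have h2 : max (-a) (min a f) ≤ a := max_le (by linarith [ha.1]) (min_le_left _ _)
  nlinarith [ha.1, ha.2]

/-- The part in `G` of the difference between a derivative `g dx + S - T` and `ψ dx`, as a positive
measure. -/
def slopeError (g ψ : ℝ → ℝ) (S T : Measure ℝ) (G : Set ℝ) : Measure ℝ :=
  (S + T + volume.withDensity fun x => ENNReal.ofReal |g x - ψ x|).restrict G

theorem ofReal_abs_integral_le {f : ℝ → ℝ} (s : Set ℝ) :
    ENNReal.ofReal |∫ x in s, f x| ≤ ∫⁻ x in s, ENNReal.ofReal |f x| := by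
  rw [← Real.norm_eq_abs, ofReal_norm]
  refine (enorm_integral_le_lintegral_enorm f).trans (le_of_eq ?_)
  simp only [← ofReal_norm, Real.norm_eq_abs]

/-- The increments of a primitive of `ψ` exceed those of `w` by at most the mass of
`slopeError`. -/
theorem HasWeakDeriv.ofReal_abs_sub_le {w : ℝ → ℝ} {Ω G : Set ℝ} (hΩ : IsOpen Ω) (hGΩ : G ⊆ Ω)
    {g : ℝ → ℝ} {S T : Measure ℝ} [IsFiniteMeasure S] [IsFiniteMeasure T]
    (h : HasWeakDeriv w Ω g S T) {Ψ ψ : ℝ → ℝ} (hψ : Continuous ψ)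
    (hΨ : ∀ x, HasDerivAt Ψ (ψ x) x) :
    ∀ᵐ p : ℝ × ℝ, p ∈ segs G → ENNReal.ofReal |Ψ p.1 - Ψ p.2|
      ≤ ENNReal.ofReal |w p.1 - w p.2| + slopeError g ψ S T G (Ioc p.1 p.2) := by
  filter_upwards [h.ae_sub_eq hΩ] with p hp hpG
  have hw := hp (segs_mono hGΩ hpG)
  have hIG : Ioc p.1 p.2 ⊆ G := Ioc_subset_Icc_self.trans hpG.2
  have hΨ' : Ψ p.2 - Ψ p.1 = ∫ t in Ioc p.1 p.2, ψ t := by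
    rw [← intervalIntegral.integral_of_le hpG.1.le]
    exact (intervalIntegral.integral_eq_sub_of_hasDerivAt (fun x _ => hΨ x)
      (hψ.intervalIntegrable _ _)).symm
  have hψi : IntegrableOn ψ (Ioc p.1 p.2) :=
    (hψ.continuousOn.integrableOn_Icc).mono_set Ioc_subset_Icc_self
  have hsub : (∫ t in Ioc p.1 p.2, g t) - ∫ t in Ioc p.1 p.2, ψ t
      = ∫ t in Ioc p.1 p.2, (g t - ψ t) := (integral_sub h.integrable.integrableOn hψi).symm
  have hτ : slopeError g ψ S T G (Ioc p.1 p.2) = S (Ioc p.1 p.2) + T (Ioc p.1 p.2)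
      + ∫⁻ t in Ioc p.1 p.2, ENNReal.ofReal |g t - ψ t| := by
    rw [slopeError, Measure.restrict_apply measurableSet_Ioc, inter_eq_self_of_subset_left hIG,
      Measure.add_apply, Measure.add_apply, withDensity_apply _ measurableSet_Ioc]
  have hle : |Ψ p.1 - Ψ p.2| ≤ |w p.1 - w p.2| + (S.real (Ioc p.1 p.2) + T.real (Ioc p.1 p.2)
      + |∫ t in Ioc p.1 p.2, (g t - ψ t)|) := by
    have h1 : Ψ p.1 - Ψ p.2 = (w p.1 - w p.2) + (S.real (Ioc p.1 p.2) - T.real (Ioc p.1 p.2)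
        + ∫ t in Ioc p.1 p.2, (g t - ψ t)) := by
      rw [← hsub]; linarith
    rw [h1]
    refine (abs_add_le _ _).trans (add_le_add_right ((abs_add_le _ _).trans
      (add_le_add_left ?_ _)) _)
    rw [abs_le]
    constructor <;> linarith [measureReal_nonneg (μ := S) (s := Ioc p.1 p.2),
      measureReal_nonneg (μ := T) (s := Ioc p.1 p.2)]
  refine (ENNReal.ofReal_le_ofReal hle).trans ?_
  rw [ENNReal.ofReal_add (abs_nonneg _) (by positivity), ENNReal.ofReal_add (by positivity)
    (abs_nonneg _), ENNReal.ofReal_add measureReal_nonneg measureReal_nonneg, ofReal_measureReal,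
    ofReal_measureReal, hτ]
  gcongr
  exact ofReal_abs_integral_le _

theorem measure_le_mul_lintegral (μ : Measure ℝ) {G Ω : Set ℝ} (hG : MeasurableSet G)
    (hGΩ : G ⊆ Ω) {f : ℝ → ℝ} {c : ℝ} (hc : 0 ≤ c) (hf : ∀ x ∈ G, 1 ≤ c * f x) :
    μ G ≤ ENNReal.ofReal c * ∫⁻ x in Ω, ENNReal.ofReal (f x) ∂μ := by
  calc μ G = ∫⁻ _ in G, 1 ∂μ := (setLIntegral_one G).symm
    _ ≤ ∫⁻ x in G, ENNReal.ofReal c * ENNReal.ofReal (f x) ∂μ := by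
        refine setLIntegral_mono' hG fun x hx => ?_
        rw [← ENNReal.ofReal_mul hc]
        exact ENNReal.one_le_ofReal.2 (hf x hx)
    _ = ENNReal.ofReal c * ∫⁻ x in G, ENNReal.ofReal (f x) ∂μ :=
        lintegral_const_mul' _ _ ENNReal.ofReal_ne_top
    _ ≤ _ := by gcongr

/-- Where the test function stays away from `±1`, a small defect forces the derivative to be close
in total variation to the slope determined by the test function. -/
theorem slopeError_univ_le {Ω G : Set ℝ} (hG : MeasurableSet G) (hGΩ : G ⊆ Ω)
    {g φ : ℝ → ℝ} (S T : Measure ℝ) {a κ C : ℝ} (ha : a ∈ Ioo (0 : ℝ) 1)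
    (hφ : ∀ x ∈ G, |φ x| ≤ a) (hκ : 0 ≤ κ) (hC : 0 ≤ C)
    (hgap : ∀ g f : ℝ, |f| ≤ a → |g - f / √(1 - f ^ 2)| ≤ κ + C * areaGap g f) :
    slopeError g (fun x => truncSlope a (φ x)) S T G univ
      ≤ ENNReal.ofReal κ * volume G
        + ENNReal.ofReal (C + 1 / (1 - a)) * dualGap Ω g S T φ := by
  have ha' : 0 < 1 - a := sub_pos.2 ha.2
  have hb : ∀ x ∈ G, -a ≤ φ x ∧ φ x ≤ a := fun x hx => abs_le.1 (hφ x hx)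
  have hS : S G ≤ ENNReal.ofReal (1 / (1 - a)) * ∫⁻ x in Ω, ENNReal.ofReal (1 - φ x) ∂S := by
    refine measure_le_mul_lintegral S hG hGΩ (by positivity) fun x hx => ?_
    rw [one_div, inv_mul_eq_div, one_le_div ha']
    linarith [(hb x hx).2]
  have hT : T G ≤ ENNReal.ofReal (1 / (1 - a)) * ∫⁻ x in Ω, ENNReal.ofReal (1 + φ x) ∂T := by
    refine measure_le_mul_lintegral T hG hGΩ (by positivity) fun x hx => ?_
    rw [one_div, inv_mul_eq_div, one_le_div ha']
    linarith [(hb x hx).1]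
  have hg : ∫⁻ x in G, ENNReal.ofReal |g x - truncSlope a (φ x)| ≤ ENNReal.ofReal κ * volume G
      + ENNReal.ofReal C * ∫⁻ x in Ω, ENNReal.ofReal (areaGap (g x) (φ x)) := by
    calc _ ≤ ∫⁻ x in G, (ENNReal.ofReal κ
          + ENNReal.ofReal C * ENNReal.ofReal (areaGap (g x) (φ x))) := by
          refine setLIntegral_mono' hG fun x hx => ?_
          have h0 := areaGap_nonneg (g x) ((hφ x hx).trans ha.2.le)
          rw [truncSlope_of_abs_le (hφ x hx), ← ENNReal.ofReal_mul hC,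
            ← ENNReal.ofReal_add hκ (by positivity)]
          exact ENNReal.ofReal_le_ofReal (hgap _ _ (hφ x hx))
      _ = ENNReal.ofReal κ * volume G
          + ENNReal.ofReal C * ∫⁻ x in G, ENNReal.ofReal (areaGap (g x) (φ x)) := by
          rw [lintegral_add_left measurable_const, setLIntegral_const,
            lintegral_const_mul' _ _ ENNReal.ofReal_ne_top]
      _ ≤ _ := by gcongr
  calc slopeError g (fun x => truncSlope a (φ x)) S T G univ
      = S G + T G + ∫⁻ x in G, ENNReal.ofReal |g x - truncSlope a (φ x)| := by
        rw [slopeError, Measure.restrict_apply_univ, Measure.add_apply, Measure.add_apply,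
          withDensity_apply _ hG]
    _ ≤ _ := add_le_add (add_le_add hS hT) hg
    _ ≤ ENNReal.ofReal κ * volume G + (ENNReal.ofReal C * dualGap Ω g S T φ
        + ENNReal.ofReal (1 / (1 - a)) * dualGap Ω g S T φ) := by
        unfold dualGap
        simp only [mul_add]
        set A := ENNReal.ofReal κ * volume G
        set B := ENNReal.ofReal C * ∫⁻ x in Ω, ENNReal.ofReal (areaGap (g x) (φ x))
        set D := ENNReal.ofReal (1 / (1 - a)) * ∫⁻ x in Ω, ENNReal.ofReal (1 - φ x) ∂S
        set E := ENNReal.ofReal (1 / (1 - a)) * ∫⁻ x in Ω, ENNReal.ofReal (1 + φ x) ∂T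
        calc D + E + (A + B) = A + (B + (D + E)) := by ring
          _ ≤ _ := add_le_add_right (add_le_add le_self_add le_add_self) A
    _ = _ := by rw [ENNReal.ofReal_add hC (by positivity), add_mul]

/-- Comparison of `w` with a primitive `Ψ` of `ψ`. -/
theorem HasWeakDeriv.nu_primitive_le {γ κ lam : ℝ} (hγ : 0 < γ) (hκ : 0 < κ) (hlam : 0 < lam)
    {w : ℝ → ℝ} {Ω G : Set ℝ} (hΩ : IsOpen Ω) (hGΩ : G ⊆ Ω) {g : ℝ → ℝ} {S T : Measure ℝ}
    [IsFiniteMeasure S] [IsFiniteMeasure T] (h : HasWeakDeriv w Ω g S T) {Ψ ψ : ℝ → ℝ}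
    (hψ : Continuous ψ) (hΨ : ∀ x, HasDerivAt Ψ (ψ x) x) :
    ENNReal.ofReal ((1 + κ) * lam) * nu γ {p ∈ segs G |
        ENNReal.ofReal ((1 + κ) * lam * |p.1 - p.2| ^ (1 + γ)) < ENNReal.ofReal |Ψ p.1 - Ψ p.2|}
      ≤ ENNReal.ofReal (1 + κ) * (ENNReal.ofReal lam * nu γ (steepPairs γ lam w G)
        + ENNReal.ofReal (maximalConst γ / κ) * slopeError g ψ S T G univ) := by
  have hCγ := maximalConst_pos hγ
  rw [ENNReal.ofReal_mul (by positivity), mul_assoc]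
  refine mul_le_mul_right ?_ _
  rcases eq_or_ne (slopeError g ψ S T G univ) ∞ with htop | htop
  · rw [htop, ENNReal.mul_top (ENNReal.ofReal_pos.2 (by positivity)).ne', add_top]
    exact le_top
  have : IsFiniteMeasure (slopeError g ψ S T G) := ⟨htop.lt_top⟩
  have key := nu_perturbation_le hγ (slopeError g ψ S T G) hlam hκ
    (fun p => ENNReal.ofReal |Ψ p.1 - Ψ p.2|) w (h.ofReal_abs_sub_le hΩ hGΩ hψ hΨ)
  calc _ ≤ ENNReal.ofReal lam * (nu γ (steepPairs γ lam w G)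
        + ENNReal.ofReal (maximalConst γ / (κ * lam)) * slopeError g ψ S T G univ) :=
        mul_le_mul_right key _
    _ = _ := by
        rw [mul_add, ← mul_assoc (ENNReal.ofReal lam) (ENNReal.ofReal _),
          ← ENNReal.ofReal_mul hlam.le]
        congr 3
        field_simp

/-! ### Regions of nearly monotone behaviour -/

/-- The part in `H` of the measure `S + g⁺ dx`. -/
def upperPart (g : ℝ → ℝ) (S : Measure ℝ) (H : Set ℝ) : Measure ℝ :=
  (S + volume.withDensity fun x => ENNReal.ofReal (g x)).restrict H

theorem isFiniteMeasure_upperPart {g : ℝ → ℝ} (hg : Integrable g) (S : Measure ℝ)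
    [IsFiniteMeasure S] (H : Set ℝ) : IsFiniteMeasure (upperPart g S H) := by
  have := isFiniteMeasure_withDensity_ofReal hg.2
  unfold upperPart
  infer_instance

theorem upperPart_apply {g : ℝ → ℝ} {S : Measure ℝ} {H s : Set ℝ} (hs : MeasurableSet s)
    (hsH : s ⊆ H) : upperPart g S H s = S s + ∫⁻ x in s, ENNReal.ofReal (g x) := by
  rw [upperPart, Measure.restrict_apply hs, inter_eq_self_of_subset_left hsH, Measure.add_apply,
    withDensity_apply _ hs]

theorem upperPart_univ {g : ℝ → ℝ} {S : Measure ℝ} {H : Set ℝ} (hH : MeasurableSet H) :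
    upperPart g S H univ = S H + ∫⁻ x in H, ENNReal.ofReal (g x) := by
  rw [upperPart, Measure.restrict_apply_univ, Measure.add_apply, withDensity_apply _ hH]

/-- The mass of the positive part of the derivative exceeds the increments of `w` by at most the
mass of the negative part. -/
theorem HasWeakDeriv.ae_upperPart_le {w : ℝ → ℝ} {Ω H : Set ℝ} (hΩ : IsOpen Ω) (hHΩ : H ⊆ Ω)
    {g : ℝ → ℝ} {S T : Measure ℝ} [IsFiniteMeasure S] [IsFiniteMeasure T]
    (h : HasWeakDeriv w Ω g S T) :
    ∀ᵐ p : ℝ × ℝ, p ∈ segs H → upperPart g S H (Ioc p.1 p.2)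
      ≤ ENNReal.ofReal |w p.1 - w p.2| + upperPart (fun x => -g x) T H (Ioc p.1 p.2) := by
  have := isFiniteMeasure_upperPart h.integrable S H
  have : IsFiniteMeasure (upperPart (fun x => -g x) T H) :=
    isFiniteMeasure_upperPart h.integrable.neg T H
  filter_upwards [h.ae_sub_eq hΩ] with p hp hpH
  have hw := hp (segs_mono hHΩ hpH)
  have hIH : Ioc p.1 p.2 ⊆ H := Ioc_subset_Icc_self.trans hpH.2
  have hf1 : ∫⁻ x in Ioc p.1 p.2, ENNReal.ofReal (g x) ≠ ∞ :=
    h.integrable.integrableOn.lintegral_lt_top.ne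
  have hf2 : ∫⁻ x in Ioc p.1 p.2, ENNReal.ofReal (-g x) ≠ ∞ :=
    (Integrable.integrableOn h.integrable.neg).lintegral_lt_top.ne
  have hP : (upperPart g S H (Ioc p.1 p.2)).toReal
      = S.real (Ioc p.1 p.2) + (∫⁻ x in Ioc p.1 p.2, ENNReal.ofReal (g x)).toReal := by
    rw [upperPart_apply measurableSet_Ioc hIH, ENNReal.toReal_add (measure_ne_top _ _) hf1]; rfl
  have hN : (upperPart (fun x => -g x) T H (Ioc p.1 p.2)).toReal
      = T.real (Ioc p.1 p.2) + (∫⁻ x in Ioc p.1 p.2, ENNReal.ofReal (-g x)).toReal := by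
    rw [upperPart_apply measurableSet_Ioc hIH, ENNReal.toReal_add (measure_ne_top _ _) hf2]; rfl
  have hg := integral_eq_lintegral_pos_part_sub_lintegral_neg_part
    (h.integrable.integrableOn (s := Ioc p.1 p.2))
  rw [← ENNReal.ofReal_toReal (measure_ne_top (upperPart g S H) (Ioc p.1 p.2)),
    ← ENNReal.ofReal_toReal (measure_ne_top (upperPart (fun x => -g x) T H) (Ioc p.1 p.2)),
    ← ENNReal.ofReal_add (abs_nonneg _) ENNReal.toReal_nonneg]
  refine ENNReal.ofReal_le_ofReal ?_
  rw [hP, hN]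
  have := neg_abs_le (w p.1 - w p.2)
  linarith

/-- Where the test function is positive, a small defect makes the negative part of the derivative
small. -/
theorem upperPart_neg_univ_le {Ω H : Set ℝ} (hH : MeasurableSet H) (hHΩ : H ⊆ Ω) (g : ℝ → ℝ)
    {φ : ℝ → ℝ} (S T : Measure ℝ) {a : ℝ} (ha : 0 < a) (hφa : ∀ x ∈ H, a ≤ φ x)
    (hφ1 : ∀ x, |φ x| ≤ 1) :
    upperPart (fun x => -g x) T H univ ≤ ENNReal.ofReal (1 / a) * dualGap Ω g S T φ := by
  have hT : T H ≤ ENNReal.ofReal (1 / a) * ∫⁻ x in Ω, ENNReal.ofReal (1 + φ x) ∂T := by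
    refine measure_le_mul_lintegral T hH hHΩ (by positivity) fun x hx => ?_
    rw [one_div, inv_mul_eq_div, one_le_div ha]
    linarith [hφa x hx]
  have hg : ∫⁻ x in H, ENNReal.ofReal (-g x)
      ≤ ENNReal.ofReal (1 / a) * ∫⁻ x in Ω, ENNReal.ofReal (areaGap (g x) (φ x)) := by
    calc _ ≤ ∫⁻ x in H, ENNReal.ofReal (1 / a) * ENNReal.ofReal (areaGap (g x) (φ x)) := by
          refine setLIntegral_mono' hH fun x hx => ?_
          rw [← ENNReal.ofReal_mul (by positivity)]
          refine ENNReal.ofReal_le_ofReal ?_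
          rw [one_div, inv_mul_eq_div, le_div_iff₀ ha, mul_comm]
          exact (mul_le_mul_of_nonneg_left (le_max_left _ _) ha.le).trans
            (mul_neg_le_areaGap ha.le (hφa x hx) (abs_le.1 (hφ1 x)).2)
      _ = ENNReal.ofReal (1 / a) * ∫⁻ x in H, ENNReal.ofReal (areaGap (g x) (φ x)) :=
          lintegral_const_mul' _ _ ENNReal.ofReal_ne_top
      _ ≤ _ := by gcongr
  rw [upperPart_univ hH, dualGap, mul_add, mul_add, add_comm]
  exact add_le_add hg (hT.trans le_add_self)

/-- Since `g ≤ √(1 + g²)`, the mass is bounded by the excess area up to the length of `H`. -/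
theorem upperPart_univ_le {Ω H : Set ℝ} (hH : MeasurableSet H) (hHΩ : H ⊆ Ω) (g : ℝ → ℝ)
    (S T : Measure ℝ) : upperPart g S H univ ≤ excessOf Ω g S T + volume H := by
  have hg : ∫⁻ x in H, ENNReal.ofReal (g x)
      ≤ (∫⁻ x in Ω, ENNReal.ofReal (√(1 + g x ^ 2) - 1)) + volume H := by
    calc _ ≤ ∫⁻ x in H, (ENNReal.ofReal (√(1 + g x ^ 2) - 1) + 1) := by
          refine lintegral_mono fun x => ?_
          rw [← ENNReal.ofReal_one, ← ENNReal.ofReal_add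
            (sub_nonneg.2 (one_le_sqrt_one_add_sq _)) zero_le_one, sub_add_cancel]
          refine ENNReal.ofReal_le_ofReal (Real.le_sqrt_of_sq_le (by linarith))
      _ = (∫⁻ x in H, ENNReal.ofReal (√(1 + g x ^ 2) - 1)) + volume H := by
          rw [lintegral_add_right _ measurable_const, setLIntegral_one]
      _ ≤ _ := by gcongr
  rw [upperPart_univ hH, excessOf]
  calc _ ≤ S Ω + ((∫⁻ x in Ω, ENNReal.ofReal (√(1 + g x ^ 2) - 1)) + volume H) :=
        add_le_add (measure_mono hHΩ) hg
    _ = (∫⁻ x in Ω, ENNReal.ofReal (√(1 + g x ^ 2) - 1)) + S Ω + volume H := by ring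
    _ ≤ _ := by gcongr; exact le_self_add

/-- A smooth cutoff between the level sets `{φ ≤ b}` and `{c ≤ φ}`. -/
def levelCutoff (b c : ℝ) (φ : ℝ → ℝ) (x : ℝ) : ℝ := Real.smoothTransition ((φ x - b) / (c - b))

theorem contDiff_levelCutoff (b c : ℝ) {φ : ℝ → ℝ} (hφ : ContDiff ℝ 1 φ) :
    ContDiff ℝ 1 (levelCutoff b c φ) :=
  Real.smoothTransition.contDiff.comp ((hφ.sub contDiff_const).div_const _)

theorem levelCutoff_of_le {b c : ℝ} (hbc : b < c) {φ : ℝ → ℝ} {x : ℝ} (h : φ x ≤ b) :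
    levelCutoff b c φ x = 0 :=
  Real.smoothTransition.zero_of_nonpos (div_nonpos_of_nonpos_of_nonneg (by linarith)
    (by linarith))

theorem levelCutoff_of_ge {b c : ℝ} (hbc : b < c) {φ : ℝ → ℝ} {x : ℝ} (h : c ≤ φ x) :
    levelCutoff b c φ x = 1 := by
  refine Real.smoothTransition.one_of_one_le ?_
  rw [one_le_div (by linarith)]
  linarith

theorem tsupport_levelCutoff_subset {b c : ℝ} (hb : 0 < b) (hbc : b < c) {φ : ℝ → ℝ} :
    tsupport (levelCutoff b c φ) ⊆ tsupport φ := by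
  refine closure_mono fun x hx h0 => hx (levelCutoff_of_le hbc ?_)
  rw [h0]; exact hb.le

theorem ofReal_integral_cutoff_le {b c : ℝ} (hbc : b < c) {φ : ℝ → ℝ} (hφ : ContDiff ℝ 1 φ)
    (μ : Measure ℝ) {f : ℝ → ℝ} (hf : Integrable f μ) :
    ENNReal.ofReal (∫ x, levelCutoff b c φ x * f x ∂μ)
      ≤ ∫⁻ x in {x | b ≤ φ x}, ENNReal.ofReal (f x) ∂μ := by
  have hcont := (contDiff_levelCutoff b c hφ).continuous
  have hKm : MeasurableSet {x | b ≤ φ x} := measurableSet_le measurable_const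
    hφ.continuous.measurable
  have h01 : ∀ x, 0 ≤ levelCutoff b c φ x ∧ levelCutoff b c φ x ≤ 1 := fun x =>
    ⟨Real.smoothTransition.nonneg _, Real.smoothTransition.le_one _⟩
  have hi : Integrable (fun x => levelCutoff b c φ x * f x) μ := by
    refine hf.bdd_mul (c := 1) hcont.aestronglyMeasurable (Eventually.of_forall fun x => ?_)
    rw [Real.norm_eq_abs, abs_of_nonneg (h01 x).1]
    exact (h01 x).2
  have h1 : ENNReal.ofReal (∫ x, levelCutoff b c φ x * f x ∂μ)
      ≤ ∫⁻ x, ENNReal.ofReal (levelCutoff b c φ x * f x) ∂μ := by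
    rw [integral_eq_lintegral_pos_part_sub_lintegral_neg_part hi]
    refine (ENNReal.ofReal_le_ofReal (sub_le_self _ ENNReal.toReal_nonneg)).trans ?_
    exact ENNReal.ofReal_toReal_le
  refine h1.trans ?_
  rw [← lintegral_indicator hKm]
  refine lintegral_mono fun x => ?_
  by_cases hx : b ≤ φ x
  · rw [indicator_of_mem (mem_ofPred_eq ▸ hx), ENNReal.ofReal_mul (h01 x).1]
    refine mul_le_of_le_one_left zero_le ?_
    exact ENNReal.ofReal_le_one.2 (h01 x).2
  · rw [levelCutoff_of_le hbc (not_le.1 hx).le, zero_mul, ENNReal.ofReal_zero]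
    exact zero_le

theorem HasWeakDeriv.neg_integral_cutoff {w : ℝ → ℝ} {Ω : Set ℝ} {g : ℝ → ℝ} {S T : Measure ℝ}
    (h : HasWeakDeriv w Ω g S T) {b c : ℝ} (hb : 0 < b) (hbc : b < c) {φ : ℝ → ℝ}
    (hφ : ContDiff ℝ 1 φ) (hφc : HasCompactSupport φ) (hφΩ : tsupport φ ⊆ Ω) :
    -∫ x in Ω, w x * deriv (levelCutoff b c φ) x = (∫ x, levelCutoff b c φ x * g x)
      + ∫ x, levelCutoff b c φ x * 1 ∂S - ∫ x, levelCutoff b c φ x * 1 ∂T := by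
  rw [h.integral_eq _ (contDiff_levelCutoff b c hφ) (hφc.of_isClosed_subset (isClosed_tsupport _)
    (tsupport_levelCutoff_subset hb hbc)) ((tsupport_levelCutoff_subset hb hbc).trans hφΩ),
    neg_neg]
  simp only [mul_one]

/-- Testing the derivative with a cutoff of `φ` bounds the mass on a level set from below. Unlike
this mass, the integral passes to the limit under convergence in `L¹_loc`. -/
theorem HasWeakDeriv.ofReal_neg_integral_cutoff_le {w : ℝ → ℝ} {Ω H : Set ℝ} {g : ℝ → ℝ}
    {S T : Measure ℝ} [IsFiniteMeasure S] (h : HasWeakDeriv w Ω g S T) {b c : ℝ} (hb : 0 < b)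
    (hbc : b < c) {φ : ℝ → ℝ} (hφ : ContDiff ℝ 1 φ) (hφc : HasCompactSupport φ)
    (hφΩ : tsupport φ ⊆ Ω) (hH : {x | b ≤ φ x} ⊆ H) :
    ENNReal.ofReal (-∫ x in Ω, w x * deriv (levelCutoff b c φ) x)
      ≤ upperPart g S H {x | b ≤ φ x} := by
  have hKm : MeasurableSet {x | b ≤ φ x} := measurableSet_le measurable_const
    hφ.continuous.measurable
  have hT : 0 ≤ ∫ x, levelCutoff b c φ x * 1 ∂T :=
    integral_nonneg fun x => mul_nonneg (Real.smoothTransition.nonneg _) zero_le_one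
  rw [h.neg_integral_cutoff hb hbc hφ hφc hφΩ, upperPart_apply hKm hH, add_comm (S _)]
  refine (ENNReal.ofReal_le_ofReal (sub_le_self _ hT)).trans (ENNReal.ofReal_add_le.trans
    (add_le_add (ofReal_integral_cutoff_le hbc hφ _ h.integrable) ?_))
  refine (ofReal_integral_cutoff_le hbc hφ S (integrable_const 1)).trans (le_of_eq ?_)
  rw [ENNReal.ofReal_one, setLIntegral_one]

/-- The singular measure `S` is captured by the test function up to the defect. -/
theorem HasWeakDeriv.measure_le_ofReal_cutoff {w : ℝ → ℝ} {Ω : Set ℝ} (hΩ : IsOpen Ω)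
    {g : ℝ → ℝ} {S T : Measure ℝ} [IsFiniteMeasure S] [IsFiniteMeasure T]
    (h : HasWeakDeriv w Ω g S T) {b c : ℝ} (hb : 0 < b) (hbc : b < c) (hc : c < 1) {φ : ℝ → ℝ}
    (hφ : ContDiff ℝ 1 φ) (hφc : HasCompactSupport φ) (hφΩ : tsupport φ ⊆ Ω)
    (hφ1 : ∀ x, |φ x| ≤ 1) :
    S Ω ≤ ENNReal.ofReal (-∫ x in Ω, w x * deriv (levelCutoff b c φ) x)
      + ENNReal.ofReal (1 / b + 1 / (1 - c)) * dualGap Ω g S T φ := by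
  have hc' : 0 < 1 - c := sub_pos.2 hc
  have hφm := hφ.continuous.measurable
  have hKm : MeasurableSet {x | b ≤ φ x} := measurableSet_le measurable_const hφm
  have hcm : MeasurableSet {x | c ≤ φ x} := measurableSet_le measurable_const hφm
  have hKΩ : {x | b ≤ φ x} ⊆ Ω := fun x (hx : b ≤ φ x) =>
    hφΩ (subset_tsupport φ (by rw [Function.mem_support]; linarith))
  set χ := levelCutoff b c φ with hχ
  have hχi : Integrable χ S :=
    (contDiff_levelCutoff b c hφ).continuous.integrable_of_hasCompactSupport
      (hφc.of_isClosed_subset (isClosed_tsupport _) (tsupport_levelCutoff_subset hb hbc))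
  have h1 : S (Ω \ {x | c ≤ φ x}) ≤ ENNReal.ofReal (1 / (1 - c)) * dualGap Ω g S T φ := by
    refine (measure_le_mul_lintegral S (hΩ.measurableSet.diff hcm) sdiff_subset
      (f := fun x => 1 - φ x) (c := 1 / (1 - c)) (by positivity) fun x hx => ?_).trans ?_
    · have : φ x < c := not_le.1 hx.2
      rw [one_div, inv_mul_eq_div, one_le_div hc']
      linarith
    · gcongr
      exact le_self_add.trans le_add_self
  have h2 : S {x | c ≤ φ x} ≤ ENNReal.ofReal (∫ x, χ x * 1 ∂S) := by
    simp only [mul_one]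
    rw [ofReal_integral_eq_lintegral_ofReal hχi (Eventually.of_forall fun x =>
      Real.smoothTransition.nonneg _), ← setLIntegral_one]
    refine le_trans (setLIntegral_mono' hcm fun x hx => ?_) (setLIntegral_le_lintegral _ _)
    rw [hχ, levelCutoff_of_ge hbc hx, ENNReal.ofReal_one]
  have h3 : ENNReal.ofReal (∫ x, χ x * 1 ∂S)
      ≤ ENNReal.ofReal (-∫ x in Ω, w x * deriv χ x)
        + upperPart (fun x => -g x) T {x | b ≤ φ x} univ := by
    have heq : ∫ x, χ x * 1 ∂S = (-∫ x in Ω, w x * deriv χ x) + ((∫ x, χ x * 1 ∂T)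
        + ∫ x, χ x * (-g x)) := by
      rw [h.neg_integral_cutoff hb hbc hφ hφc hφΩ]
      simp only [mul_neg, integral_neg]
      ring
    rw [heq, upperPart_univ hKm]
    refine ENNReal.ofReal_add_le.trans (add_le_add_right (ENNReal.ofReal_add_le.trans
      (add_le_add ?_ ?_)) _)
    · refine (ofReal_integral_cutoff_le hbc hφ T (integrable_const 1)).trans (le_of_eq ?_)
      rw [ENNReal.ofReal_one, setLIntegral_one]
    · exact ofReal_integral_cutoff_le hbc hφ volume h.integrable.neg
  have h4 := upperPart_neg_univ_le hKm hKΩ g S T hb (fun x hx => hx) hφ1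
  have h5 : S Ω ≤ S {x | c ≤ φ x} + S (Ω \ {x | c ≤ φ x}) := by
    refine (measure_mono fun x hx => ?_).trans (measure_union_le _ _)
    by_cases h' : c ≤ φ x
    · exact Or.inl h'
    · exact Or.inr ⟨hx, h'⟩
  calc S Ω ≤ _ := h5
    _ ≤ (ENNReal.ofReal (-∫ x in Ω, w x * deriv χ x)
        + ENNReal.ofReal (1 / b) * dualGap Ω g S T φ)
        + ENNReal.ofReal (1 / (1 - c)) * dualGap Ω g S T φ :=
        add_le_add (h2.trans (h3.trans (add_le_add_right h4 _))) h1
    _ = _ := by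
        rw [ENNReal.ofReal_add (by positivity) (by positivity)]; ring

/-- The sharp lower bound on a set on which `w` is nearly increasing. -/
theorem HasWeakDeriv.upperPart_le_nu {γ κ lam η : ℝ} (hγ : 0 < γ) (hκ : 0 < κ) (hlam : 0 < lam)
    (hη : 0 < η) {w : ℝ → ℝ} {Ω H K : Set ℝ} (hΩ : IsOpen Ω) (hH : IsOpen H) (hHΩ : H ⊆ Ω)
    (hK : MeasurableSet K) (hKH : ∀ q ∈ K, Icc (q - η) (q + η) ⊆ H) {g : ℝ → ℝ}
    {S T : Measure ℝ} [IsFiniteMeasure S] [IsFiniteMeasure T] (h : HasWeakDeriv w Ω g S T)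
    (hP : upperPart g S H univ ≤ ENNReal.ofReal ((1 + κ) * lam * η ^ (1 + γ))) :
    ENNReal.ofReal (1 / (γ + 1)) * upperPart g S H K ≤
      ENNReal.ofReal (1 + κ) * (ENNReal.ofReal lam * nu γ (steepPairs γ lam w H)
        + ENNReal.ofReal (maximalConst γ / κ) * upperPart (fun x => -g x) T H univ) := by
  have hCγ := maximalConst_pos hγ
  have := isFiniteMeasure_upperPart h.integrable S H
  have : IsFiniteMeasure (upperPart (fun x => -g x) T H) :=
    isFiniteMeasure_upperPart h.integrable.neg T H
  have hlow := le_nu_of_measure hγ (show 0 < (1 + κ) * lam by positivity) hη hH hK hKH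
    (upperPart g S H) hP
  have hup := nu_perturbation_le hγ (upperPart (fun x => -g x) T H) hlam hκ
    (fun p => upperPart g S H (Ioc p.1 p.2)) w (h.ae_upperPart_le hΩ hHΩ)
  calc ENNReal.ofReal (1 / (γ + 1)) * upperPart g S H K
      = ENNReal.ofReal (1 + κ) * (ENNReal.ofReal lam
        * (ENNReal.ofReal (1 / ((γ + 1) * ((1 + κ) * lam))) * upperPart g S H K)) := by
        rw [← mul_assoc, ← mul_assoc, ← ENNReal.ofReal_mul (by positivity),
          ← ENNReal.ofReal_mul (by positivity)]
        congr 2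
        field_simp
    _ ≤ ENNReal.ofReal (1 + κ) * (ENNReal.ofReal lam * (nu γ (steepPairs γ lam w H)
        + ENNReal.ofReal (maximalConst γ / (κ * lam))
          * upperPart (fun x => -g x) T H univ)) := by
        gcongr
        exact hlow.trans hup
    _ = _ := by
        rw [mul_add, ← mul_assoc (ENNReal.ofReal lam) (ENNReal.ofReal _),
          ← ENNReal.ofReal_mul hlam.le]
        congr 4
        field_simp

theorem HasWeakDeriv.neg {w : ℝ → ℝ} {Ω : Set ℝ} {g : ℝ → ℝ} {S T : Measure ℝ}
    (h : HasWeakDeriv w Ω g S T) :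
    HasWeakDeriv (fun x => -w x) Ω (fun x => -g x) T S where
  locallyIntegrableOn := h.locallyIntegrableOn.neg
  measurable := h.measurable.neg
  integrable := h.integrable.neg
  integral_eq φ h1 h2 h3 := by
    simp only [neg_mul, mul_neg, integral_neg]
    rw [h.integral_eq φ h1 h2 h3]
    ring

theorem dualGap_neg (Ω : Set ℝ) (g : ℝ → ℝ) (S T : Measure ℝ) (φ : ℝ → ℝ) :
    dualGap Ω (fun x => -g x) T S (fun x => -φ x) = dualGap Ω g S T φ := by
  simp only [dualGap, areaGap_neg, sub_neg_eq_add, ← sub_eq_add_neg]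
  rw [add_comm (∫⁻ x in Ω, ENNReal.ofReal (1 + φ x) ∂T)]

theorem excessOf_neg (Ω : Set ℝ) (g : ℝ → ℝ) (S T : Measure ℝ) :
    excessOf Ω (fun x => -g x) T S = excessOf Ω g S T := by
  simp only [excessOf, neg_sq, add_comm (T Ω)]

theorem steepPairs_neg (γ lam : ℝ) (w : ℝ → ℝ) (U : Set ℝ) :
    steepPairs γ lam (fun x => -w x) U = steepPairs γ lam w U := by
  ext p
  simp only [steepPairs, mem_ofPred_eq]
  rw [← abs_neg (w p.1 - w p.2)]
  ring_nf

/-! ### Stability under area-strict convergence -/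

theorem nu_steepPairs_add_le (γ lam : ℝ) (w : ℝ → ℝ) {U V W : Set ℝ} (hU : MeasurableSet U)
    (hUV : Disjoint U V) (hUW : U ⊆ W) (hVW : V ⊆ W) :
    nu γ (steepPairs γ lam w U) + nu γ (steepPairs γ lam w V) ≤ nu γ (steepPairs γ lam w W) := by
  have hsub : ∀ Z : Set ℝ, Z ⊆ W →
      steepPairs γ lam w Z ⊆ steepPairs γ lam w W ∩ Prod.fst ⁻¹' Z := fun Z hZ p hp =>
    ⟨⟨segs_mono hZ hp.1, hp.2⟩, hp.1.2 ⟨le_rfl, hp.1.1.le⟩⟩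
  exact (add_le_add (nu_mono γ (hsub U hUW)) (nu_mono γ (hsub V hVW))).trans
    (nu_inter_add_le γ _ (measurable_fst hU) (hUV.preimage _))

/-- Area-strict convergence of `v lam` to `u` in terms of derivatives
`g' lam dx + S' lam - T' lam` and `g dx + S - T`. -/
structure IsAreaStrict (v : ℝ → ℝ → ℝ) (u : ℝ → ℝ) (Ω : Set ℝ) (g' : ℝ → ℝ → ℝ)
    (S' T' : ℝ → Measure ℝ) (g : ℝ → ℝ) (S T : Measure ℝ) : Prop where
  isOpen : IsOpen Ω
  finite_pos : ∀ lam, IsFiniteMeasure (S' lam)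
  finite_neg : ∀ lam, IsFiniteMeasure (T' lam)
  finite_pos_limit : IsFiniteMeasure S
  finite_neg_limit : IsFiniteMeasure T
  hasWeakDeriv : ∀ᶠ lam in atTop, HasWeakDeriv (v lam) Ω (g' lam) (S' lam) (T' lam)
  hasWeakDeriv_limit : HasWeakDeriv u Ω g S T
  tendsto_integral : ∀ ψ : ℝ → ℝ, Continuous ψ → HasCompactSupport ψ → tsupport ψ ⊆ Ω →
    Tendsto (fun lam => ∫ x in Ω, v lam x * ψ x) atTop (𝓝 (∫ x in Ω, u x * ψ x))
  tendsto_excess : Tendsto (fun lam => excessOf Ω (g' lam) (S' lam) (T' lam)) atTop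
    (𝓝 (excessOf Ω g S T))

section

variable {v : ℝ → ℝ → ℝ} {u : ℝ → ℝ} {Ω : Set ℝ} {g' : ℝ → ℝ → ℝ} {S' T' : ℝ → Measure ℝ}
  {g : ℝ → ℝ} {S T : Measure ℝ}

theorem IsAreaStrict.neg (h : IsAreaStrict v u Ω g' S' T' g S T) :
    IsAreaStrict (fun lam x => -v lam x) (fun x => -u x) Ω (fun lam x => -g' lam x) T' S'
      (fun x => -g x) T S where
  isOpen := h.isOpen
  finite_pos := h.finite_neg
  finite_neg := h.finite_pos
  finite_pos_limit := h.finite_neg_limit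
  finite_neg_limit := h.finite_pos_limit
  hasWeakDeriv := h.hasWeakDeriv.mono fun _ hl => hl.neg
  hasWeakDeriv_limit := h.hasWeakDeriv_limit.neg
  tendsto_integral ψ h1 h2 h3 := by
    simp only [neg_mul, integral_neg]
    exact (h.tendsto_integral ψ h1 h2 h3).neg
  tendsto_excess := by
    simp only [excessOf_neg]
    exact h.tendsto_excess

theorem IsAreaStrict.tendsto_integral_deriv (h : IsAreaStrict v u Ω g' S' T' g S T) {φ : ℝ → ℝ}
    (hφ : ContDiff ℝ 1 φ) (hφc : HasCompactSupport φ) (hφΩ : tsupport φ ⊆ Ω) :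
    Tendsto (fun lam => ∫ x in Ω, v lam x * deriv φ x) atTop
      (𝓝 (∫ x in Ω, u x * deriv φ x)) :=
  h.tendsto_integral _ (hφ.continuous_deriv le_rfl) hφc.deriv
    ((tsupport_deriv_subset (𝕜 := ℝ) (f := φ)).trans hφΩ)

/-- The defect of a fixed test function is continuous under area-strict convergence. -/
theorem IsAreaStrict.tendsto_dualGap (h : IsAreaStrict v u Ω g' S' T' g S T) {φ : ℝ → ℝ}
    (hφ : ContDiff ℝ 1 φ) (hφc : HasCompactSupport φ) (hφΩ : tsupport φ ⊆ Ω)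
    (hφ1 : ∀ x, |φ x| ≤ 1) :
    Tendsto (fun lam => dualGap Ω (g' lam) (S' lam) (T' lam) φ) atTop
      (𝓝 (dualGap Ω g S T φ)) := by
  have := h.finite_pos
  have := h.finite_neg
  have := h.finite_pos_limit
  have := h.finite_neg_limit
  have hu := h.hasWeakDeriv_limit
  rw [hu.dualGap_eq hφ hφc hφΩ hφ1]
  have hlim := (ENNReal.continuous_ofReal.tendsto _).comp
    (((ENNReal.tendsto_toReal (excessOf_ne_top hu.measurable hu.integrable)).comp
      h.tendsto_excess).add ((h.tendsto_integral_deriv hφ hφc hφΩ).add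
        (tendsto_const_nhds (x := ∫ x in Ω, (1 - √(1 - φ x ^ 2))))))
  refine hlim.congr' ?_
  filter_upwards [h.hasWeakDeriv] with lam hlam
  exact (hlam.dualGap_eq hφ hφc hφΩ hφ1).symm

/-- The level sets of a test function with small defect see the singular part with the constant
of jumps. -/
theorem IsAreaStrict.eventually_measure_le (h : IsAreaStrict v u Ω g' S' T' g S T) {γ κ a b c : ℝ}
    (hγ : 0 < γ) (hκ : 0 < κ) (ha : 0 < a) (hab : a < b) (hbc : b < c) (hc : c < 1) {ε : ℝ≥0∞}
    (hε : ε ≠ 0) {φ : ℝ → ℝ} (hφ : ContDiff ℝ 1 φ) (hφc : HasCompactSupport φ)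
    (hφΩ : tsupport φ ⊆ Ω) (hφ1 : ∀ x, |φ x| ≤ 1) (hgap : dualGap Ω g S T φ ≤ ε)
    (hgap' : ∀ᶠ lam in atTop, dualGap Ω (g' lam) (S' lam) (T' lam) φ ≤ ε) :
    ∀ᶠ lam : ℝ in atTop, ENNReal.ofReal (1 / (γ + 1)) * S Ω
      ≤ ENNReal.ofReal (1 + κ) * (ENNReal.ofReal lam
          * nu γ (steepPairs γ lam (v lam) {x | a < φ x}))
        + (ENNReal.ofReal (1 + κ) * (ENNReal.ofReal (maximalConst γ / κ) * ENNReal.ofReal (1 / a))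
          + ENNReal.ofReal (1 / (γ + 1)) * (1 + ENNReal.ofReal (1 / b + 1 / (1 - c)))) * ε := by
  have := h.finite_pos
  have := h.finite_neg
  have := h.finite_pos_limit
  have := h.finite_neg_limit
  have hu := h.hasWeakDeriv_limit
  have hΩ := h.isOpen
  set H : Set ℝ := {x | a < φ x} with hH
  set K : Set ℝ := {x | b ≤ φ x} with hK
  have hHo : IsOpen H := isOpen_lt continuous_const hφ.continuous
  have hKm : MeasurableSet K := measurableSet_le measurable_const hφ.continuous.measurable
  have hHs : H ⊆ tsupport φ := fun x (hx : a < φ x) =>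
    subset_tsupport φ (by rw [Function.mem_support]; linarith)
  have hHΩ : H ⊆ Ω := hHs.trans hφΩ
  have hKH : K ⊆ H := fun x (hx : b ≤ φ x) => hab.trans_le hx
  have hHv : volume H ≠ ∞ := ((measure_mono hHs).trans_lt hφc.isCompact.measure_lt_top).ne
  have hb : 0 < b := ha.trans hab
  -- uniform continuity separates the two level sets
  obtain ⟨η₀, hη₀, hη₀φ⟩ := Metric.uniformContinuous_iff.1
    (hφc.uniformContinuous_of_continuous hφ.continuous) (b - a) (sub_pos.2 hab)
  set η := η₀ / 2 with hηdef
  have hη : 0 < η := by positivity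
  have hηK : ∀ q ∈ K, Icc (q - η) (q + η) ⊆ H := by
    intro q (hq : b ≤ φ q) x hx
    have hd : dist x q < η₀ := by
      rw [Real.dist_eq, abs_lt]; constructor <;> linarith [hx.1, hx.2]
    have := hη₀φ hd
    rw [Real.dist_eq, abs_lt] at this
    exact mem_ofPred_eq ▸ (by linarith : a < φ x)
  -- the total masses stay bounded
  set M := excessOf Ω g S T + 1 + volume H with hM
  have hexc := excessOf_ne_top (Ω := Ω) (S := S) (T := T) hu.measurable hu.integrable
  have hMtop : M ≠ ∞ := ENNReal.add_ne_top.2 ⟨ENNReal.add_ne_top.2 ⟨hexc, ENNReal.one_ne_top⟩, hHv⟩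
  have hbig : ∀ᶠ lam : ℝ in atTop, M.toReal ≤ (1 + κ) * lam * η ^ (1 + γ) := by
    have : Tendsto (fun lam : ℝ => (1 + κ) * lam * η ^ (1 + γ)) atTop atTop :=
      (tendsto_id.const_mul_atTop (by positivity)).atTop_mul_const (by positivity)
    exact this.eventually_ge_atTop _
  have hexc' : ∀ᶠ lam in atTop, excessOf Ω (g' lam) (S' lam) (T' lam) ≤ excessOf Ω g S T + 1 :=
    h.tendsto_excess.eventually_le_const (ENNReal.lt_add_right hexc one_ne_zero)
  -- the mass carried by the upper level set is lower semicontinuous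
  have hχ := contDiff_levelCutoff b c hφ
  have hχs := tsupport_levelCutoff_subset (φ := φ) hb hbc
  have hχlim := (ENNReal.continuous_ofReal.tendsto _).comp (h.tendsto_integral_deriv hχ
    (hφc.of_isClosed_subset (isClosed_tsupport _) hχs) (hχs.trans hφΩ)).neg
  have hmass : ∀ᶠ lam in atTop,
      ENNReal.ofReal (-∫ x in Ω, u x * deriv (levelCutoff b c φ) x)
        ≤ ENNReal.ofReal (-∫ x in Ω, v lam x * deriv (levelCutoff b c φ) x) + ε := by
    have h1 := hχlim.add (tendsto_const_nhds (x := ε))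
    exact (h1.eventually_const_lt (ENNReal.lt_add_right ENNReal.ofReal_ne_top hε)).mono
      fun lam hlam => hlam.le
  filter_upwards [h.hasWeakDeriv, hgap', hbig, hexc', hmass, eventually_gt_atTop 0]
    with lam hw hgl hbl hel hml hl0
  have hP : upperPart (g' lam) (S' lam) H univ
      ≤ ENNReal.ofReal ((1 + κ) * lam * η ^ (1 + γ)) := by
    refine (upperPart_univ_le hHo.measurableSet hHΩ (g' lam) (S' lam) (T' lam)).trans ?_
    refine (add_le_add_left hel _).trans ?_
    rw [← hM, ← ENNReal.ofReal_toReal hMtop]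
    exact ENNReal.ofReal_le_ofReal hbl
  have hlow := hw.upperPart_le_nu hγ hκ hl0 hη hΩ hHo hHΩ hKm hηK hP
  have hN : upperPart (fun x => -g' lam x) (T' lam) H univ ≤ ENNReal.ofReal (1 / a) * ε :=
    (upperPart_neg_univ_le hHo.measurableSet hHΩ (g' lam) (S' lam) (T' lam) ha
      (fun x (hx : a < φ x) => hx.le) hφ1).trans (by gcongr)
  have hS : S Ω ≤ upperPart (g' lam) (S' lam) H K + ε
      + ENNReal.ofReal (1 / b + 1 / (1 - c)) * ε :=
    (hu.measure_le_ofReal_cutoff hΩ hb hbc hc hφ hφc hφΩ hφ1).trans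
      (add_le_add (hml.trans (add_le_add_left
        (hw.ofReal_neg_integral_cutoff_le hb hbc hφ hφc hφΩ hKH) _)) (by gcongr))
  calc ENNReal.ofReal (1 / (γ + 1)) * S Ω
      ≤ ENNReal.ofReal (1 / (γ + 1)) * (upperPart (g' lam) (S' lam) H K + ε
        + ENNReal.ofReal (1 / b + 1 / (1 - c)) * ε) := by gcongr
    _ = ENNReal.ofReal (1 / (γ + 1)) * upperPart (g' lam) (S' lam) H K
        + ENNReal.ofReal (1 / (γ + 1)) * (1 + ENNReal.ofReal (1 / b + 1 / (1 - c))) * ε := by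
        ring
    _ ≤ ENNReal.ofReal (1 + κ) * (ENNReal.ofReal lam * nu γ (steepPairs γ lam (v lam) H)
        + ENNReal.ofReal (maximalConst γ / κ) * (ENNReal.ofReal (1 / a) * ε))
        + ENNReal.ofReal (1 / (γ + 1)) * (1 + ENNReal.ofReal (1 / b + 1 / (1 - c))) * ε := by
        refine add_le_add_left (hlow.trans ?_) _
        gcongr
    _ = _ := by ring

/-- The part of `Ω` in which the test function stays away from `±1` sees the slope prescribed by
the test function with the constant of smooth functions. -/
theorem IsAreaStrict.eventually_slope_le (h : IsAreaStrict v u Ω g' S' T' g S T)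
    {γ κ κ' a C : ℝ} (hγ : 0 < γ) (hκ : 0 < κ) (ha : a ∈ Ioo (0 : ℝ) 1) (hκ' : 0 ≤ κ')
    (hC : 0 ≤ C) (hgapC : ∀ g f : ℝ, |f| ≤ a → |g - f / √(1 - f ^ 2)| ≤ κ' + C * areaGap g f)
    {G : Set ℝ} (hG : IsOpen G) (hGΩ : G ⊆ Ω) (hGv : volume G ≠ ∞) {ε : ℝ≥0∞}
    (hε : ε ≠ 0) {φ : ℝ → ℝ} (hφ : Continuous φ) (hφG : ∀ x ∈ G, |φ x| ≤ a)
    (hgap' : ∀ᶠ lam in atTop, dualGap Ω (g' lam) (S' lam) (T' lam) φ ≤ ε) :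
    ∀ᶠ lam : ℝ in atTop, ENNReal.ofReal (1 / γ)
        * ∫⁻ x in G, ENNReal.ofReal |truncSlope a (φ x)|
      ≤ ENNReal.ofReal (1 + κ) * (ENNReal.ofReal lam * nu γ (steepPairs γ lam (v lam) G))
        + (ENNReal.ofReal (1 + κ) * (ENNReal.ofReal (maximalConst γ / κ)
            * (ENNReal.ofReal κ' * volume G + ENNReal.ofReal (C + 1 / (1 - a)) * ε)) + ε) := by
  have := h.finite_pos
  have := h.finite_neg
  set ψ : ℝ → ℝ := fun x => truncSlope a (φ x) with hψ
  have hψc : Continuous ψ := (continuous_truncSlope ha).comp hφ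
  set Ψ : ℝ → ℝ := fun x => ∫ t in (0 : ℝ)..x, ψ t
  have hΨ : ∀ x, HasDerivAt Ψ (ψ x) x := fun x => hψc.integral_hasStrictDerivAt 0 x |>.hasDerivAt
  set X := ENNReal.ofReal (1 / γ) * ∫⁻ x in G, ENNReal.ofReal |ψ x| with hX
  have hXtop : X ≠ ∞ := by
    have hb : ∀ f, |truncSlope a f| ≤ a / √(1 - a ^ 2) := by
      intro f
      have h1 : -a ≤ max (-a) (min a f) := le_max_left _ _
      have h2 : max (-a) (min a f) ≤ a := max_le (by linarith [ha.1]) (min_le_left _ _)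
      have h3 : |max (-a) (min a f)| ≤ a := abs_le.2 ⟨h1, h2⟩
      have h4 : 0 < √(1 - a ^ 2) := Real.sqrt_pos.2 (by nlinarith [ha.1, ha.2])
      rw [truncSlope, abs_div, abs_of_nonneg (Real.sqrt_nonneg _)]
      refine div_le_div₀ ha.1.le h3 h4 (Real.sqrt_le_sqrt ?_)
      nlinarith
    refine ENNReal.mul_ne_top ENNReal.ofReal_ne_top (ne_top_of_le_ne_top
      (ENNReal.mul_ne_top (ENNReal.ofReal_ne_top (r := a / √(1 - a ^ 2))) hGv) ?_)
    rw [← setLIntegral_const]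
    exact lintegral_mono fun x => ENNReal.ofReal_le_ofReal (hb _)
  have hlim := le_liminf_nu_of_hasDerivAt hγ hG hΨ
  have hev : ∀ᶠ lam : ℝ in atTop, X ≤ ENNReal.ofReal lam * nu γ {p ∈ segs G |
      ENNReal.ofReal (lam * |p.1 - p.2| ^ (1 + γ)) < ENNReal.ofReal |Ψ p.1 - Ψ p.2|} + ε := by
    rcases le_or_gt X ε with hXε | hXε
    · exact Eventually.of_forall fun lam => hXε.trans le_add_self
    have hlt : X - ε < X := ENNReal.sub_lt_self hXtop (hε.bot_lt.trans hXε).ne' hε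
    filter_upwards [eventually_lt_of_lt_liminf (hlt.trans_le hlim)] with lam hlam
    exact tsub_le_iff_right.1 hlam.le
  have hmul : Tendsto (fun lam : ℝ => (1 + κ) * lam) atTop atTop :=
    tendsto_id.const_mul_atTop (by positivity)
  -- the bound for `Ψ` is used at `(1 + κ) * lam`, the level at which `v lam` is compared with `Ψ`
  filter_upwards [hmul.eventually hev, h.hasWeakDeriv, hgap', eventually_gt_atTop 0]
    with lam hl hw hgl hl0
  have h1 := hw.nu_primitive_le hγ hκ hl0 h.isOpen hGΩ hψc hΨ
  have h2 : slopeError (g' lam) ψ (S' lam) (T' lam) G univ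
      ≤ ENNReal.ofReal κ' * volume G + ENNReal.ofReal (C + 1 / (1 - a)) * ε :=
    (slopeError_univ_le hG.measurableSet hGΩ (S' lam) (T' lam) ha hφG hκ' hC hgapC).trans
      (by gcongr)
  calc X ≤ _ := hl
    _ ≤ ENNReal.ofReal (1 + κ) * (ENNReal.ofReal lam * nu γ (steepPairs γ lam (v lam) G)
        + ENNReal.ofReal (maximalConst γ / κ)
          * (ENNReal.ofReal κ' * volume G + ENNReal.ofReal (C + 1 / (1 - a)) * ε)) + ε := by
        refine add_le_add_left (h1.trans ?_) _
        gcongr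
    _ = _ := by ring

end

/-! ### The lower bound for truncated slopes -/

/-- A test function with small defect recovers `|g|` on the set of moderate slopes. -/
theorem lintegral_abs_le_truncSlope {Ω J G : Set ℝ} (hΩ : MeasurableSet Ω) (hJ : MeasurableSet J)
    {g φ : ℝ → ℝ} (hg : Measurable g) (hφ : Measurable φ) (S T : Measure ℝ) {a m κ C C₁ : ℝ}
    (ha : a ∈ Ioo (0 : ℝ) 1) (hm : 0 ≤ m) (hκ : 0 ≤ κ) (hC : 0 ≤ C) (hC₁ : 0 ≤ C₁)
    (hgap : ∀ g f : ℝ, |f| ≤ a → |g - f / √(1 - f ^ 2)| ≤ κ + C * areaGap g f)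
    (hgap₁ : ∀ g f : ℝ, |g| ≤ m → a ≤ |f| → |f| ≤ 1 → 1 ≤ C₁ * areaGap g f)
    (hφ1 : ∀ x, |φ x| ≤ 1) (hG : G = Ω ∩ J ∩ {x | |φ x| < a}) :
    ∫⁻ x in Ω ∩ J ∩ {x | |g x| ≤ m}, ENNReal.ofReal |g x|
      ≤ (∫⁻ x in G, ENNReal.ofReal |truncSlope a (φ x)|)
        + (ENNReal.ofReal κ * volume G + ENNReal.ofReal (C + 1 / (1 - a)) * dualGap Ω g S T φ
          + ENNReal.ofReal (m * C₁) * dualGap Ω g S T φ) := by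
  have hAm : MeasurableSet {x | |φ x| < a} := measurableSet_lt (by fun_prop) measurable_const
  have hGm : MeasurableSet G := by rw [hG]; exact (hΩ.inter hJ).inter hAm
  have hGΩ : G ⊆ Ω := by rw [hG]; exact fun x hx => hx.1.1
  have hGa : ∀ x ∈ G, |φ x| ≤ a := by rw [hG]; exact fun x hx => le_of_lt hx.2
  set Z : Set ℝ := Ω ∩ J ∩ {x | |g x| ≤ m} with hZ
  have hZm : MeasurableSet Z :=
    (hΩ.inter hJ).inter (measurableSet_le (by fun_prop) measurable_const)
  have herr := slopeError_univ_le hGm hGΩ (g := g) S T ha hGa hκ hC hgap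
  have hτ : ∫⁻ x in G, ENNReal.ofReal |g x - truncSlope a (φ x)|
      ≤ slopeError g (fun x => truncSlope a (φ x)) S T G univ := by
    rw [slopeError, Measure.restrict_apply_univ, Measure.add_apply, withDensity_apply _ hGm]
    exact le_add_self
  have h1 : ∫⁻ x in Z ∩ {x | |φ x| < a}, ENNReal.ofReal |g x|
      ≤ (∫⁻ x in G, ENNReal.ofReal |truncSlope a (φ x)|)
        + ∫⁻ x in G, ENNReal.ofReal |g x - truncSlope a (φ x)| := by
    have hsub : Z ∩ {x | |φ x| < a} ⊆ G := by
      rw [hG]; exact fun x hx => ⟨hx.1.1, hx.2⟩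
    have hψm : Measurable fun x => ENNReal.ofReal |truncSlope a (φ x)| := by
      have := (continuous_truncSlope ha).measurable.comp hφ
      simp only [Function.comp_def] at this
      fun_prop
    refine (lintegral_mono_set hsub).trans ?_
    rw [← lintegral_add_left hψm]
    refine lintegral_mono fun x => ?_
    rw [← ENNReal.ofReal_add (abs_nonneg _) (abs_nonneg _)]
    refine ENNReal.ofReal_le_ofReal ?_
    calc |g x| = |truncSlope a (φ x) + (g x - truncSlope a (φ x))| := by ring_nf
      _ ≤ _ := abs_add_le _ _
  -- where `|φ| ≥ a` the gap is at least `1 / C₁`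
  have h2 : ∫⁻ x in Z \ {x | |φ x| < a}, ENNReal.ofReal |g x|
      ≤ ENNReal.ofReal (m * C₁) * dualGap Ω g S T φ := by
    calc _ ≤ ∫⁻ x in Z \ {x | |φ x| < a},
          ENNReal.ofReal (m * C₁) * ENNReal.ofReal (areaGap (g x) (φ x)) := by
          refine setLIntegral_mono' (hZm.diff hAm) fun x hx => ?_
          have hgm : |g x| ≤ m := hx.1.2
          have hφa : a ≤ |φ x| := not_lt.1 hx.2
          rw [← ENNReal.ofReal_mul (by positivity)]
          refine ENNReal.ofReal_le_ofReal ?_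
          calc |g x| ≤ m * 1 := by rwa [mul_one]
            _ ≤ m * (C₁ * areaGap (g x) (φ x)) := by
                gcongr
                exact hgap₁ _ _ hgm hφa (hφ1 x)
            _ = _ := by ring
      _ = ENNReal.ofReal (m * C₁)
          * ∫⁻ x in Z \ {x | |φ x| < a}, ENNReal.ofReal (areaGap (g x) (φ x)) :=
          lintegral_const_mul' _ _ ENNReal.ofReal_ne_top
      _ ≤ _ := by
          have hsub : Z \ {x | |φ x| < a} ⊆ Ω := fun x hx => hx.1.1.1
          gcongr
          exact (lintegral_mono_set hsub).trans le_self_add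
  calc _ = _ := (lintegral_inter_add_sdiff _ Z hAm).symm
    _ ≤ _ := add_le_add (h1.trans (add_le_add_right (hτ.trans herr) _)) h2
    _ = _ := by ring

section

variable {v : ℝ → ℝ → ℝ} {u : ℝ → ℝ} {Ω : Set ℝ} {g' : ℝ → ℝ → ℝ} {S' T' : ℝ → Measure ℝ}
  {g : ℝ → ℝ} {S T : Measure ℝ}

/-- The lower bound for the slopes up to `m` in a bounded interval and the whole singular part. -/
theorem IsAreaStrict.le_mul_liminf (h : IsAreaStrict v u Ω g' S' T' g S T) (hST : S ⟂ₘ T)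
    (hS : S ⟂ₘ volume) (hT : T ⟂ₘ volume) {γ κ m R : ℝ} (hγ : 0 < γ) (hκ : 0 < κ) (hm : 0 ≤ m) :
    ENNReal.ofReal (1 / γ) * (∫⁻ x in Ω ∩ Ioo (-R) R ∩ {x | |g x| ≤ m}, ENNReal.ofReal |g x|)
        + ENNReal.ofReal (1 / (γ + 1)) * (S Ω + T Ω)
      ≤ ENNReal.ofReal (1 + κ) * liminf (fun lam : ℝ =>
          ENNReal.ofReal lam * nu γ (steepPairs γ lam (v lam) Ω)) atTop := by
  have := h.finite_pos_limit
  have := h.finite_neg_limit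
  have hΩ := h.isOpen
  have hu := h.hasWeakDeriv_limit
  refine ENNReal.le_of_forall_pos_le_add fun e he _ => ?_
  have he2 : (e : ℝ≥0∞) / 2 ≠ 0 := (ENNReal.half_pos (by exact_mod_cast he.ne')).ne'
  set J := Ioo (-R) R with hJ
  have hJv : volume J ≠ ∞ := measure_Ioo_lt_top.ne
  obtain ⟨a, ha, C₁, hC₁, hgap₁⟩ := exists_one_le_areaGap hm
  have hCγ := maximalConst_pos hγ
  set k := ENNReal.ofReal (1 + κ)
  set B := k * ENNReal.ofReal (maximalConst γ / κ) + ENNReal.ofReal (1 / γ) with hB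
  have hk : k ≠ ∞ := ENNReal.ofReal_ne_top
  have hBtop : B ≠ ∞ := by finiteness
  -- the slope resolution is chosen first, as the constant `C` depends on it
  obtain ⟨κ', hκ', hκ'B⟩ := exists_ofReal_mul_le (c := B * volume J) (by finiteness) he2
  obtain ⟨C, hC, hgapC⟩ := exists_abs_sub_le_areaGap ha hκ'
  set D := ENNReal.ofReal (C + 1 / (1 - a)) with hD
  -- the levels `a < b < c < 1` are those of the sets `{±φ > a}` and of the cutoffs of `±φ`
  set b := a + (1 - a) / 3 with hb
  set c := a + 2 * (1 - a) / 3 with hc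
  have ha1 := ha.2
  have ha0 := ha.1
  -- `A * ε` is the loss on each of the sets `{±φ > a}`, and `A' * ε` the total one due to the
  -- defect
  set A := k * (ENNReal.ofReal (maximalConst γ / κ) * ENNReal.ofReal (1 / a))
    + ENNReal.ofReal (1 / (γ + 1)) * (1 + ENNReal.ofReal (1 / b + 1 / (1 - c))) with hA
  set A' := B * D + 1 + ENNReal.ofReal (1 / γ) * ENNReal.ofReal (m * C₁) + (A + A) with hA'
  have hAtop : A' ≠ ∞ := by finiteness
  obtain ⟨ε₀, hε₀, hε₀A⟩ := exists_ofReal_mul_le hAtop he2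
  set ε := ENNReal.ofReal ε₀ with hε
  have hε0 : ε ≠ 0 := (ENNReal.ofReal_pos.2 hε₀).ne'
  have hεtop : ε ≠ ∞ := ENNReal.ofReal_ne_top
  obtain ⟨φ, hφ, hφc, hφΩ, hφ1, hφgap⟩ := exists_dualGap_le hΩ hu.measurable hu.integrable hST hS hT
    (ENNReal.half_pos hε0).ne'
  have hgap : dualGap Ω g S T φ ≤ ε := hφgap.trans ENNReal.half_le_self
  have hgap' : ∀ᶠ lam in atTop, dualGap Ω (g' lam) (S' lam) (T' lam) φ ≤ ε :=
    (h.tendsto_dualGap hφ hφc hφΩ hφ1).eventually_le_const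
      (hφgap.trans_lt (ENNReal.half_lt_self hε0 hεtop))
  set G := Ω ∩ J ∩ {x | |φ x| < a} with hG
  have hGo : IsOpen G := (hΩ.inter isOpen_Ioo).inter (isOpen_lt (by have := hφ.continuous; fun_prop)
    continuous_const)
  have hGΩ : G ⊆ Ω := fun x hx => hx.1.1
  have hGJ : volume G ≤ volume J := measure_mono fun x hx => hx.1.2
  have hGv : volume G ≠ ∞ := ne_top_of_le_ne_top hJv hGJ
  have hu1 := lintegral_abs_le_truncSlope hΩ.measurableSet (measurableSet_Ioo (a := -R) (b := R))
    hu.measurable hφ.continuous.measurable S T ha hm hκ'.le hC hC₁ hgapC hgap₁ hφ1 hG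
  have hev1 := h.eventually_slope_le hγ hκ ha hκ'.le hC hgapC hGo hGΩ hGv hε0 hφ.continuous
    (fun x hx => le_of_lt hx.2) hgap'
  have hev2 := h.eventually_measure_le hγ hκ ha0 (show a < b by rw [hb]; linarith)
    (show b < c by rw [hb, hc]; linarith) (show c < 1 by rw [hc]; linarith) hε0 hφ hφc hφΩ hφ1
    hgap hgap'
  -- the set `{-φ > a}` is treated by passing to `-v` and `-φ`
  have hts : tsupport (fun x => -φ x) ⊆ tsupport φ :=
    closure_mono fun x hx h0 => hx (by simp only [h0, neg_zero])
  have hev3 := h.neg.eventually_measure_le hγ hκ ha0 (show a < b by rw [hb]; linarith)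
    (show b < c by rw [hb, hc]; linarith) (show c < 1 by rw [hc]; linarith) hε0 hφ.neg
    (hφc.of_isClosed_subset (isClosed_tsupport _) hts) (hts.trans hφΩ)
    (fun x => by rw [abs_neg]; exact hφ1 x)
    (by rw [dualGap_neg]; exact hgap) (by simp only [dualGap_neg]; exact hgap')
  simp only [steepPairs_neg] at hev3
  set P : Set ℝ := {x | a < φ x} with hP
  set N : Set ℝ := {x | a < -φ x} with hN
  have hPN : ∀ lam, nu γ (steepPairs γ lam (v lam) G) + nu γ (steepPairs γ lam (v lam) P)
      + nu γ (steepPairs γ lam (v lam) N) ≤ nu γ (steepPairs γ lam (v lam) Ω) := by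
    intro lam
    have hsupp : ∀ x, φ x ≠ 0 → x ∈ Ω := fun x hx => hφΩ (subset_tsupport φ hx)
    have hPm : MeasurableSet P := measurableSet_lt measurable_const hφ.continuous.measurable
    have hPΩ : P ⊆ Ω := fun x (hx : a < φ x) => hsupp x (by linarith)
    have hNΩ : N ⊆ Ω := fun x (hx : a < -φ x) => hsupp x (by linarith)
    have hd1 : Disjoint G P := disjoint_left.2 fun x hx (hx' : a < φ x) =>
      absurd (lt_of_abs_lt hx.2) (not_lt.2 hx'.le)
    have hd2 : Disjoint (G ∪ P) N := disjoint_left.2 fun x hx (hx' : a < -φ x) => by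
      rcases hx with hx | (hx : a < φ x)
      · have hxa : |φ x| < a := hx.2
        linarith [neg_lt_of_abs_lt hxa]
      · linarith
    exact (add_le_add_left (nu_steepPairs_add_le γ lam (v lam) hGo.measurableSet hd1
      subset_union_left subset_union_right) _).trans
      (nu_steepPairs_add_le γ lam (v lam) (hGo.measurableSet.union hPm) hd2
        (union_subset hGΩ hPΩ) hNΩ)
  set L := ENNReal.ofReal (1 / γ)
      * (∫⁻ x in Ω ∩ J ∩ {x | |g x| ≤ m}, ENNReal.ofReal |g x|)
    + ENNReal.ofReal (1 / (γ + 1)) * (S Ω + T Ω) with hL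
  have hmain : ∀ᶠ lam : ℝ in atTop,
      (L - e) / k ≤ ENNReal.ofReal lam * nu γ (steepPairs γ lam (v lam) Ω) := by
    filter_upwards [hev1, hev2, hev3] with lam h1 h2 h3
    refine ENNReal.div_le_of_le_mul' (tsub_le_iff_right.2 ?_)
    set nG := nu γ (steepPairs γ lam (v lam) G)
    set nP := nu γ (steepPairs γ lam (v lam) P)
    set nN := nu γ (steepPairs γ lam (v lam) N)
    calc L ≤ ENNReal.ofReal (1 / γ) * ((∫⁻ x in G, ENNReal.ofReal |truncSlope a (φ x)|)
          + (ENNReal.ofReal κ' * volume J + D * ε + ENNReal.ofReal (m * C₁) * ε))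
          + (ENNReal.ofReal (1 / (γ + 1)) * S Ω + ENNReal.ofReal (1 / (γ + 1)) * T Ω) := by
          rw [hL, mul_add (ENNReal.ofReal (1 / (γ + 1)))]
          gcongr
          refine hu1.trans ?_
          gcongr
      _ = ENNReal.ofReal (1 / γ) * (∫⁻ x in G, ENNReal.ofReal |truncSlope a (φ x)|)
          + ENNReal.ofReal (1 / γ)
            * (ENNReal.ofReal κ' * volume J + D * ε + ENNReal.ofReal (m * C₁) * ε)
          + (ENNReal.ofReal (1 / (γ + 1)) * S Ω + ENNReal.ofReal (1 / (γ + 1)) * T Ω) := by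
          rw [mul_add]
      _ ≤ (k * (ENNReal.ofReal lam * nG) + (k * (ENNReal.ofReal (maximalConst γ / κ)
            * (ENNReal.ofReal κ' * volume J + D * ε)) + ε))
          + ENNReal.ofReal (1 / γ)
            * (ENNReal.ofReal κ' * volume J + D * ε + ENNReal.ofReal (m * C₁) * ε)
          + ((k * (ENNReal.ofReal lam * nP) + A * ε)
            + (k * (ENNReal.ofReal lam * nN) + A * ε)) := by
          refine add_le_add (add_le_add_left (h1.trans ?_) _) (add_le_add h2 h3)
          gcongr
      _ = k * (ENNReal.ofReal lam * (nG + nP + nN)) + (ENNReal.ofReal κ' * (B * volume J)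
          + ε * A') := by
          rw [hA', hB]; ring
      _ ≤ k * (ENNReal.ofReal lam * nu γ (steepPairs γ lam (v lam) Ω)) + (e / 2 + e / 2) := by
          gcongr
          exact hPN lam
      _ = _ := by rw [ENNReal.add_halves]
  have hlim := le_liminf_of_le (by isBoundedDefault) hmain
  have hk0 : k ≠ 0 := (ENNReal.ofReal_pos.2 (by linarith)).ne'
  rw [ENNReal.div_le_iff hk0 hk, mul_comm, tsub_le_iff_right] at hlim
  exact hlim

end

/-! ### The lower bound for the functional -/

/-- The lower bound in terms of the pairs `x < y`. -/
theorem IsAreaStrict.le_liminf {v : ℝ → ℝ → ℝ} {u : ℝ → ℝ} {Ω : Set ℝ} {g' : ℝ → ℝ → ℝ}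
    {S' T' : ℝ → Measure ℝ} {g : ℝ → ℝ} {S T : Measure ℝ}
    (h : IsAreaStrict v u Ω g' S' T' g S T) (hST : S ⟂ₘ T)
    (hS : S ⟂ₘ volume) (hT : T ⟂ₘ volume) {γ : ℝ} (hγ : 0 < γ) :
    ENNReal.ofReal (1 / γ) * (∫⁻ x in Ω, ENNReal.ofReal |g x|)
        + ENNReal.ofReal (1 / (γ + 1)) * (S Ω + T Ω)
      ≤ liminf (fun lam : ℝ => ENNReal.ofReal lam * nu γ (steepPairs γ lam (v lam) Ω)) atTop := by
  set L := liminf (fun lam : ℝ => ENNReal.ofReal lam * nu γ (steepPairs γ lam (v lam) Ω)) atTop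
  set Z : ℕ → Set ℝ := fun n => Ω ∩ Ioo (-(n : ℝ)) n ∩ {x | |g x| ≤ n} with hZ
  have hfin : ∀ n : ℕ, ENNReal.ofReal (1 / γ) * (∫⁻ x in Z n, ENNReal.ofReal |g x|)
      + ENNReal.ofReal (1 / (γ + 1)) * (S Ω + T Ω) ≤ L := by
    intro n
    have hlim : Tendsto (fun κ : ℝ => ENNReal.ofReal (1 + κ) * L) (𝓝[>] 0) (𝓝 L) := by
      have h1 : Tendsto (fun κ : ℝ => ENNReal.ofReal (1 + κ)) (𝓝[>] 0) (𝓝 1) := by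
        have : Tendsto (fun κ : ℝ => ENNReal.ofReal (1 + κ)) (𝓝 0) (𝓝 (ENNReal.ofReal (1 + 0))) :=
          (ENNReal.continuous_ofReal.comp (by fun_prop)).tendsto 0
        rw [add_zero, ENNReal.ofReal_one] at this
        exact this.mono_left nhdsWithin_le_nhds
      have h2 := ENNReal.Tendsto.mul_const (b := L) h1 (Or.inl one_ne_zero)
      rwa [one_mul] at h2
    refine ge_of_tendsto hlim ?_
    filter_upwards [self_mem_nhdsWithin] with κ hκ
    exact h.le_mul_liminf hST hS hT hγ hκ n.cast_nonneg
  have hmono : Monotone Z := by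
    intro n n' hn x hx
    have hn' : (n : ℝ) ≤ n' := by exact_mod_cast hn
    have hxg : |g x| ≤ n := hx.2
    exact ⟨⟨hx.1.1, by linarith [hx.1.2.1], hx.1.2.2.trans_le hn'⟩, hxg.trans hn'⟩
  have hunion : ⋃ n, Z n = Ω := by
    refine Subset.antisymm (iUnion_subset fun n x hx => hx.1.1) fun x hx => ?_
    obtain ⟨n, hn⟩ := exists_nat_gt (max |x| |g x|)
    rw [max_lt_iff] at hn
    exact mem_iUnion.2 ⟨n, ⟨hx, abs_lt.1 hn.1⟩, hn.2.le⟩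
  rw [← hunion, setLIntegral_iUnion_of_directed _ hmono.directed_le, hunion, ENNReal.mul_iSup,
    ENNReal.iSup_add]
  exact iSup_le hfin

end NonlocalBV

end

theorem proposition3p8 (γ : ℝ) (hγ : 0 < γ) (Ω : Set ℝ) (hΩ : IsOpen Ω)
    (u : ℝ → ℝ) (hu : NonlocalBV.MemBVdot u Ω)
    (v : ℝ → ℝ → ℝ) (hv : NonlocalBV.TendstoAreaStrict v u Ω) :
    ENNReal.ofReal (2 / γ) * (NonlocalBV.Da u Ω).totalVariation Ω
        + ENNReal.ofReal (2 / (γ + 1)) * (NonlocalBV.Ds u Ω).totalVariation Ω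
      ≤ liminf (fun lam : ℝ => NonlocalBV.nonlocalF γ lam (v lam) Ω) atTop := by
  have hEu := NonlocalBV.excessArea_eq hu
  have hduw := NonlocalBV.hasWeakDeriv_of_memBVdot hu
  have hEtop : NonlocalBV.excessArea u Ω ≠ ∞ := by
    rw [hEu]
    exact NonlocalBV.excessOf_ne_top hduw.measurable hduw.integrable
  -- the areas are eventually finite, which makes the functions `v lam` of bounded variation
  have hmem : ∀ᶠ lam in atTop, NonlocalBV.MemBVdot (v lam) Ω :=
    (hv.tendsto_excessArea.eventually_lt_const hEtop.lt_top).mono fun lam hlam =>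
      NonlocalBV.memBVdot_of_excessArea_ne_top hlam.ne
  have hstrict : NonlocalBV.IsAreaStrict v u Ω (fun lam => NonlocalBV.grad (v lam) Ω)
      (fun lam => (NonlocalBV.Ds (v lam) Ω).toJordanDecomposition.posPart)
      (fun lam => (NonlocalBV.Ds (v lam) Ω).toJordanDecomposition.negPart)
      (NonlocalBV.grad u Ω) (NonlocalBV.Ds u Ω).toJordanDecomposition.posPart
      (NonlocalBV.Ds u Ω).toJordanDecomposition.negPart :=
    { isOpen := hΩ
      finite_pos := fun _ => inferInstance
      finite_neg := fun _ => inferInstance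
      finite_pos_limit := inferInstance
      finite_neg_limit := inferInstance
      hasWeakDeriv := hmem.mono fun _ hl => NonlocalBV.hasWeakDeriv_of_memBVdot hl
      hasWeakDeriv_limit := hduw
      tendsto_integral := fun _ h1 h2 h3 => hv.tendstoL1loc.tendsto_integral_mul h1 h2 h3
      tendsto_excess := by
        rw [← hEu]
        exact hv.tendsto_excessArea.congr' (hmem.mono fun _ hl => NonlocalBV.excessArea_eq hl) }
  have hsing := SignedMeasure.mutuallySingular_singularPart (NonlocalBV.D u Ω) volume
  rw [SignedMeasure.mutuallySingular_ennreal_iff,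
    SignedMeasure.totalVariation_mutuallySingular_iff,
    VectorMeasure.ennrealToMeasure_toENNRealVectorMeasure] at hsing
  have hkey := hstrict.le_liminf (JordanDecomposition.mutuallySingular _) hsing.1 hsing.2 hγ
  have htwo : ∀ c : ℝ, ENNReal.ofReal (2 / c) = 2 * ENNReal.ofReal (1 / c) := by
    intro c
    rw [← ENNReal.ofReal_ofNat 2, ← ENNReal.ofReal_mul zero_le_two, mul_one_div]
  rw [NonlocalBV.totalVariation_Da u Ω hΩ.measurableSet, SignedMeasure.totalVariation,
    Measure.add_apply, htwo, htwo, mul_assoc, mul_assoc, ← mul_add]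
  refine (mul_le_mul_right hkey 2).trans ?_
  rw [← ENNReal.liminf_const_mul_of_ne_top (by norm_num)]
  refine liminf_le_liminf (Eventually.of_forall fun lam => ?_)
  calc 2 * (ENNReal.ofReal lam * NonlocalBV.nu γ (NonlocalBV.steepPairs γ lam (v lam) Ω))
      = ENNReal.ofReal lam
        * (2 * NonlocalBV.nu γ (NonlocalBV.steepPairs γ lam (v lam) Ω)) := by ring
    _ ≤ _ := mul_le_mul_right (NonlocalBV.two_mul_nu_le γ lam (v lam) Ω) _
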